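/- **Setting.** Let $(T_i,X_i,U_i)$, $i\ge 1$, be i.i.d. copies of $(T,X,U)$, where $T$ is a real treatment, $X\in\mathbb R^r$ is a covariate vector, and $U$ is a measurement error independent of $(T,X)$. Observed are $(S_i,X_i)$ with $S_i=T_i+U_i$. Let $F_X$ be the law of $X$, let $\mathcal X$ and $\mathcal T$ be the supports of $X$ and $T$, let $f_{T|X}(t|x)$ be the conditional density of $T$ given $X=x$, let $f_T(t)=\int f_{T|X}(t|x)\,dF_X(x)$, and let $\pi_0(t,x)=f_T(t)/f_{T|X}(t|x)$. Write $\mathbb E[g(X)|T=t]=\int g(x)f_{T|X}(t|x)\,dF_X(x)/f_T(t)$. The characteristic function $\phi_U$ of $U$ is known and has no zeros. Let $L:\mathbb R\to\mathbb R$ be a kernel with Fourier transform $\phi_L(w)=\int e^{iwv}L(v)\,dv$. For a bandwidth $h_0>0$ put $L_U(v)=\frac1{2\pi}\int e^{-iwv}\phi_L(w)/\phi_U(w/h_0)\,dw$. Let $\rho$ be a twice continuously differentiable function with $\rho''<0$ on an open interval $D\subseteq\mathbb R$ (for instance $D=\mathbb R$, or $D=(-1,\infty)$ for $\rho(v)=\log(1+v)$).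 Let $u_K(x)=(u_{K,1}(x),\dots,u_{K,K}(x))^\top$ be measurable basis functions. For $t\in\mathcal T$ and $\lambda\in\mathbb R^K$ such that $\lambda^\top u_K(X_i)\in D$ for all $i\le N$, let $$\widehat G_t(\lambda)=\frac{\sum_{i=1}^N\rho\{\lambda^\top u_K(X_i)\}L_U\{(t-S_i)/h_0\}}{\sum_{i=1}^N L_U\{(t-S_i)/h_0\}}-\lambda^\top\frac1N\sum_{i=1}^N u_K(X_i).$$ For a maximiser $\widehat\lambda_t$ of $\widehat G_t$ put $\widehat\pi(t,x)=\rho'\{\widehat\lambda_t^\top u_K(x)\}$. Here $K=K_N\to\infty$ and $0<h_0=h_{0,N}\to0$. **Assumptions.** 1. (Ordinary smooth error of order $\beta\ge1$.) For some $c>0$, $t^\beta\phi_U(t)\to c$ and $t^{\beta+1}\phi_U'(t)\to-c\beta$ as $t\to\infty$. 2. (Assumption O.) $\|\phi_L\|_\infty<\infty$, $\int|t|^{\beta+1}\{|\phi_L(t)|+|\phi_L'(t)|\}\,dt<\infty$ and $\int|t^\beta\phi_L(t)|^2\,dt<\infty$. 3. $L$ is even and integrable, $\int L=1$, and $\int v^2|L(v)|\,dv<\infty$.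 4. $\mathcal X$ and $\mathcal T$ are compact, and for some $\eta_{\min}>0$, $f_{T|X}(t|x)\ge\eta_{\min}$ for all $t\in\mathcal T$, $x\in\mathcal X$. 5. There is a constant $B$ such that for $F_X$-almost every $x$ the function $f_{T|X}(\cdot|x)$ is three times continuously differentiable on the interior of $\mathcal T$, is at most $B$ on $\mathcal T$, and its derivatives of orders $0,1,2$ are bounded by $B$ in absolute value on the interior of $\mathcal T$. 6. For every $t\in\mathcal T$: the values $\pi_0(t,x)$, $x\in\mathcal X$, lie in $\rho'(D)$, and the closure of $\{(\rho')^{-1}(\pi_0(t,x)):x\in\mathcal X\}$ is contained in $D$; and there are vectors $\lambda_t\in\mathbb R^K$ with $\sup_{x\in\mathcal X}|(\rho')^{-1}\{\pi_0(t,x)\}-\lambda_t^\top u_K(x)|=O(K^{-\alpha})$ as $K\to\infty$, where $\alpha>0$ does not depend on $t$. 7. For every $t\in\mathcal T$ the eigenvalues of $\mathbb E[u_K(X)u_K(X)^\top|T=t]$ are bounded away from zero and infinity uniformly in $K$. Moreover $\sup_{x\in\mathcal X}\|u_K(x)\|\le\zeta(K)$ and $\zeta(K)\{K^{-\alpha}+h_0^2\}\to0$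 as $N\to\infty$. 8. $\zeta(K)\sqrt{K/(Nh_0^{1+2\beta})}\to0$ as $N\to\infty$. **Theorem.** For every fixed $t$ in the interior of $\mathcal T$ consider the rates $$\sup_{x\in\mathcal X}|\widehat\pi(t,x)-\pi_0(t,x)|=O_p\Big(\zeta(K)\{K^{-\alpha}+h_0^2\}+\zeta(K)\sqrt{\tfrac{K}{Nh_0^{1+2\beta}}}\Big),$$ $$\int_{\mathcal X}|\widehat\pi(t,x)-\pi_0(t,x)|^2\,dF_X(x)=O_p\Big(\{K^{-2\alpha}+h_0^4\}+\tfrac{K}{Nh_0^{1+2\beta}}\Big),$$ $$\frac1N\sum_{i=1}^N|\widehat\pi(t,X_i)-\pi_0(t,X_i)|^2=O_p\Big(\{K^{-2\alpha}+h_0^4\}+\tfrac{K}{Nh_0^{1+2\beta}}\Big).$$ (a) There are $\widehat\lambda_t=\widehat\lambda_{t,N}$ that, with probability tending to one, are local maximisers of $\widehat G_t$ (with $\widehat\lambda_t^\top u_K(x)\in D$ for all $x\in\mathcal X$) and for which the three rates hold. (b) For any choice of $\widehat\lambda_t=\widehat\lambda_{t,N}$ the three rates hold on the events that $\widehat G_t$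 is concave on its domain and $\widehat\lambda_t$ is a global maximiser of it: for every $\varepsilon>0$ there is $M$ such that for all large $N$ the probability that this event occurs and the error exceeds $M$ times the rate is at most $\varepsilon$. In particular, if these events have probability tending to one, the three rates hold without restriction. -/

import Mathlib

open MeasureTheory ProbabilityTheory Filter Topology
open scoped ENNReal

noncomputable section

namespace DeconvWeights

/-- The Euclidean space of real vectors of dimension `n`. -/
abbrev Vec (n : ℕ) : Type := EuclideanSpace ℝ (Fin n)

/-! ### Population quantities -/

section Population

variable {r : ℕ} (PX : Measure (Vec r)) (f : ℝ → Vec r → ℝ)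

/-- The marginal density of the treatment at `t`, where `f t x` is the conditional density of the
treatment at `t` given the covariates `x`, and `PX` is the law of the covariates. -/
def margDensity (t : ℝ) : ℝ := ∫ x, f t x ∂PX

/-- The stabilised weight: marginal density divided by conditional density. -/
def stabWeight (t : ℝ) (x : Vec r) : ℝ := margDensity PX f t / f t x

/-- The conditional mean of `g (X)` given that the treatment equals `t`, by the Bayes formula. -/
def condMean (t : ℝ) (g : Vec r → ℝ) : ℝ := (∫ x, g x * f t x ∂PX) / margDensity PX f t

/-- The matrix of conditional second moments of the `k` basis functions given treatment `t`. -/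
def condGram {k : ℕ} (b : Vec r → Vec k) (t : ℝ) : Matrix (Fin k) (Fin k) ℝ :=
  Matrix.of fun i j => condMean PX f t fun x => b x i * b x j

end Population

/-! ### Deconvolution kernel -/

/-- The Fourier transform of the kernel `L`, namely `w ↦ ∫ exp (i w v) L v dv`. -/
def kernelFT (L : ℝ → ℝ) (w : ℝ) : ℂ :=
  ∫ v : ℝ, Complex.exp (Complex.I * (w : ℂ) * (v : ℂ)) * (L v : ℂ)

/-- The deconvolution kernel with bandwidth `h`, for an error with characteristic function `φU`.
The integral is a real number for an even real kernel; the real part makes this a real function. -/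
def deconvKernel (L : ℝ → ℝ) (φU : ℝ → ℂ) (h v : ℝ) : ℝ :=
  ((1 / (2 * Real.pi) : ℂ) * ∫ w : ℝ, Complex.exp (-(Complex.I * (w : ℂ) * (v : ℂ))) *
    (kernelFT L w / φU (w / h))).re

/-- The characteristic function `φ` is that of an ordinary smooth error of order `β`. -/
def OrdinarySmooth (β : ℝ) (φ : ℝ → ℂ) : Prop :=
  1 ≤ β ∧ ∃ c : ℝ, 0 < c ∧
    Tendsto (fun w : ℝ => ((w ^ β : ℝ) : ℂ) * φ w) atTop (𝓝 (c : ℂ)) ∧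
    Tendsto (fun w : ℝ => ((w ^ (β + 1) : ℝ) : ℂ) * deriv φ w) atTop (𝓝 ((-(c * β) : ℝ) : ℂ))

/-- The conditions on the Fourier transform of the kernel in the ordinary smooth case. -/
def KernelOrdinary (β : ℝ) (L : ℝ → ℝ) : Prop :=
  (∃ C : ℝ, ∀ w : ℝ, ‖kernelFT L w‖ ≤ C) ∧
  Integrable (fun w : ℝ => |w| ^ (β + 1) * (‖kernelFT L w‖ + ‖deriv (kernelFT L) w‖)) ∧
  Integrable (fun w : ℝ => (|w| ^ β * ‖kernelFT L w‖) ^ 2)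

/-! ### The local generalised empirical likelihood estimator

Here `ρ` is a function on an open interval `D` (the whole line or, for example, `(-1, ∞)` for
`ρ v = log (1 + v)`), `b` is the vector of `k` basis functions, `W s` is the kernel weight of an
observation `s`, and `S`, `X` are the observed sequences, of which the first `N` terms are used. -/

section Estimator

variable {r k : ℕ}

/-- The inverse of the derivative of `ρ` on its domain `D`. -/
def linkInv (ρ : ℝ → ℝ) (D : Set ℝ) (y : ℝ) : ℝ := Function.invFunOn (deriv ρ) D y

/-- The parameters at which the objective function is defined. -/
def feasible (D : Set ℝ) (b : Vec r → Vec k) (N : ℕ) (X : ℕ → Vec r) : Set (Vec k) :=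
  {l | ∀ i ∈ Finset.range N, inner ℝ l (b (X i)) ∈ D}

/-- The sample objective function. -/
def objective (ρ : ℝ → ℝ) (b : Vec r → Vec k) (W : ℝ → ℝ) (N : ℕ)
    (S : ℕ → ℝ) (X : ℕ → Vec r) (l : Vec k) : ℝ :=
  (∑ i ∈ Finset.range N, ρ (inner ℝ l (b (X i))) * W (S i)) / (∑ i ∈ Finset.range N, W (S i)) -
    inner ℝ l ((N : ℝ)⁻¹ • ∑ i ∈ Finset.range N, b (X i))

/-- The estimated weight function that belongs to the parameter `l`. -/
def weightEst (ρ : ℝ → ℝ) (b : Vec r → Vec k) (l : Vec k) (x : Vec r) : ℝ :=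
  deriv ρ (inner ℝ l (b x))

end Estimator

/-! ### Error criteria, with values in `[0, ∞]` -/

section Errors

variable {r : ℕ}

/-- Supremum over `A` of `|p - q|`. -/
def supErr (A : Set (Vec r)) (p q : Vec r → ℝ) : ℝ≥0∞ := ⨆ x ∈ A, ENNReal.ofReal |p x - q x|

/-- Integral of `|p - q| ^ 2` with respect to `PX`. -/
def l2Err (PX : Measure (Vec r)) (p q : Vec r → ℝ) : ℝ≥0∞ :=
  ∫⁻ x, ENNReal.ofReal (|p x - q x| ^ 2) ∂PX

/-- Average of `|p - q| ^ 2` over the first `N` sample points. -/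
def empErr (N : ℕ) (X : ℕ → Vec r) (p q : Vec r → ℝ) : ℝ≥0∞ :=
  ENNReal.ofReal ((N : ℝ)⁻¹ * ∑ i ∈ Finset.range N, |p (X i) - q (X i)| ^ 2)

end Errors

/-- `R N = O_p (a N)` on the events `A N`: for every `ε > 0` there is `M` such that for all large
`N` the probability that `A N` happens and `R N > M * a N` is at most `ε`. For `A N` equal to the
whole sample space this is the usual `O_p`. Sets that are not measurable are measured by outer
probability. -/
def BigOInProbOn {Ω : Type*} [MeasurableSpace Ω] (P : Measure Ω) (A : ℕ → Set Ω)
    (R : ℕ → Ω → ℝ≥0∞) (a : ℕ → ℝ) : Prop :=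
  ∀ ε : ℝ, 0 < ε → ∃ M : ℝ, 0 < M ∧ ∀ᶠ N in atTop,
    P (A N ∩ {ω | ENNReal.ofReal (M * a N) < R N ω}) ≤ ENNReal.ofReal ε

/-- The usual stochastic order `R N = O_p (a N)`. -/
def BigOInProb {Ω : Type*} [MeasurableSpace Ω] (P : Measure Ω)
    (R : ℕ → Ω → ℝ≥0∞) (a : ℕ → ℝ) : Prop :=
  BigOInProbOn P (fun _ => Set.univ) R a

end DeconvWeights

end

noncomputable section

namespace DeconvWeights

open scoped FourierTransform SchwartzMap

/-! ### Fourier inversion almost everywhere and Plancherel's theorem on the real line -/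

/-! Put `w s = h⁻¹ L_U((t - s)/h)`; the factor `h⁻¹` cancels in the objective function. Two facts
about these weights drive the proof. Since averaging `L_U(v - U/h)` over the error returns `L v`,
one has `E[w(S) g(X)] = ∫ g q dP_X`, where `q` is the conditional density smoothed by `L`, so that
`|q - f(t|·)| = O(h²)` by a second order Taylor expansion (`integral_deconvKernel`,
`abs_smoothDensity_sub_le`). By Plancherel and the decay of the characteristic function, `E[w(S)²
g(X)] ≤ V ∫ g dP_X` with `V` of order `h^{-(1+2β)}` (`exists_lintegral_deconvKernel_sq_le`).
Averages of `K`-dimensional vectors then fluctuate by `σ = √(V K / N)`.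

Expand the objective function around the sieve approximation `λ₀` of the index `z = (ρ')⁻¹(π₀)`.
Because `ρ'(z) f(t|·)` is constantly the marginal density, the score at `λ₀` would have mean zero
without approximation error and smoothing bias; altogether its norm is `O(K^{-α} + h² + σ)`
(`norm_score_le`). No factor `ζ` is lost here: the coefficients of a bounded function against a
basis with bounded second moment matrix have bounded Euclidean norm.

The weights may be negative, so the objective function need not be concave. Its Taylor remainder is
nevertheless at most `-const ‖d‖²` in mean, because `q` is bounded below. Symmetrisation and
contraction bound the fluctuation of the remainder uniformly over the ball `‖d‖ ≤ R` by `R · Rζ · σ`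
up to a constant (`measure_process_gt_le`), which is of smaller order than `R²` because `ζσ → 0`.
Hence, for `R` a large multiple of `K^{-α} + h² + σ`, the objective function on the sphere of radius
`R` stays below its value at the centre with probability close to one (`objective_lt`,
`exists_goodSample`).

A maximiser over the closed ball is then interior, which yields a local maximiser, and a concave
objective function cannot have a global maximiser outside the ball. Either way the estimate lies
within `R` of `λ₀`. The Lipschitz property of `ρ'` turns this into the three rates: through `‖u_K‖ ≤
ζ` for the supremum, through the population second moment matrix for the integral, and through the
empirical one for the sample average. -/

theorem integral_fourier_mul_flip {f g : ℝ → ℂ} (hf : Integrable f) (hg : Integrable g) :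
    ∫ x, 𝓕 f x * g x = ∫ x, f x * 𝓕 g x := by
  simpa using! VectorFourier.integral_fourierIntegral_smul_eq_flip (L := innerₗ ℝ)
    Real.continuous_fourierChar continuous_inner hf hg

theorem integral_fourierInv_mul_flip {f g : ℝ → ℂ} (hf : Integrable f) (hg : Integrable g) :
    ∫ x, 𝓕⁻ f x * g x = ∫ x, f x * 𝓕⁻ g x := by
  have h := integral_fourier_mul_flip hf (g := fun x => g (-x)) hg.comp_neg
  have e1 : ∫ x, 𝓕⁻ f x * g x = ∫ x, 𝓕 f x * g (-x) := by
    rw [← integral_neg_eq_self]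
    simp [Real.fourierInv_eq_fourier_neg]
  rw [e1, h]
  congr 1 with x
  rw [Real.fourierInv_eq_fourier_comp_neg]

theorem continuous_fourier_of_integrable {f : ℝ → ℂ} (hf : Integrable f) : Continuous (𝓕 f) :=
  VectorFourier.fourierIntegral_continuous Real.continuous_fourierChar (L := innerₗ ℝ)
    continuous_inner hf

theorem continuous_fourierInv_of_integrable {f : ℝ → ℂ} (hf : Integrable f) :
    Continuous (𝓕⁻ f) := by
  have : 𝓕⁻ f = fun x => 𝓕 f (-x) := by
    ext x; rw [Real.fourierInv_eq_fourier_neg]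
  rw [this]
  exact (continuous_fourier_of_integrable hf).comp continuous_neg

theorem ae_eq_of_integral_schwartz_mul {f f' : ℝ → ℂ} (hf : LocallyIntegrable f)
    (hf' : LocallyIntegrable f')
    (h : ∀ φ : 𝓢(ℝ, ℂ), ∫ x, φ x * f x = ∫ x, φ x * f' x) : f =ᵐ[volume] f' := by
  refine ae_eq_of_integral_contDiff_smul_eq hf hf' fun g hg hgc => ?_
  have h1 : HasCompactSupport (fun x => (g x : ℂ)) :=
    hgc.comp_left (g := fun y : ℝ => (y : ℂ)) (by simp)
  have h2 : ContDiff ℝ (⊤ : ℕ∞) (fun x => (g x : ℂ)) := Complex.ofRealCLM.contDiff.comp hg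
  simpa using h (h1.toSchwartzMap h2)

/-- No continuity of `f` is available, so inversion is tested against Schwartz functions: both
transforms are moved onto the test function, where inversion is exact. -/
theorem fourierInv_fourier_ae {f : ℝ → ℂ} (hf : Integrable f) (hf' : Integrable (𝓕 f)) :
    𝓕⁻ (𝓕 f) =ᵐ[volume] f := by
  refine ae_eq_of_integral_schwartz_mul
    (continuous_fourierInv_of_integrable hf').locallyIntegrable hf.locallyIntegrable fun φ => ?_
  have h1 : 𝓕⁻ (φ : ℝ → ℂ) = ((𝓕⁻ φ : 𝓢(ℝ, ℂ)) : ℝ → ℂ) := (SchwartzMap.fourierInv_coe φ).symm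
  have h2 : 𝓕 ((𝓕⁻ φ : 𝓢(ℝ, ℂ)) : ℝ → ℂ) = φ := by
    rw [← SchwartzMap.fourier_coe]; simp
  rw [← integral_fourierInv_mul_flip φ.integrable hf', h1, 
    ← integral_fourier_mul_flip (𝓕⁻ φ : 𝓢(ℝ, ℂ)).integrable hf, h2]

/-- The Fourier integral and the unitary extension to `L²` define the same tempered distribution,
hence agree almost everywhere. This transfers Plancherel to the concrete integral. -/
theorem fourier_ae_eq_toLp {g : ℝ → ℂ} (hg : Integrable g) (hg2 : MemLp g 2) :
    𝓕 g =ᵐ[volume] (𝓕 hg2.toLp : Lp (α := ℝ) ℂ 2) := by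
  refine ae_eq_of_integral_schwartz_mul
    (continuous_fourier_of_integrable hg).locallyIntegrable
    ((Lp.memLp _).locallyIntegrable (by norm_num)) fun φ => ?_
  have h := DFunLike.congr_fun (Lp.fourier_toTemperedDistribution_eq hg2.toLp) φ
  rw [TemperedDistribution.fourier_apply] at h
  simp only [Lp.toTemperedDistribution_apply, smul_eq_mul] at h
  rw [← h, ← integral_fourier_mul_flip φ.integrable hg, SchwartzMap.fourier_coe]
  refine integral_congr_ae ?_
  filter_upwards [hg2.coeFn_toLp] with x hx
  rw [hx]

theorem eLpNorm_fourier {g : ℝ → ℂ} (hg : Integrable g) (hg2 : MemLp g 2) :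
    eLpNorm (𝓕 g) 2 = eLpNorm g 2 := by
  rw [eLpNorm_congr_ae (fourier_ae_eq_toLp hg hg2), ← eLpNorm_congr_ae hg2.coeFn_toLp,
    ← Lp.enorm_def, ← Lp.enorm_def, enorm_eq_iff_norm_eq, Lp.norm_fourier_eq]

theorem lintegral_enorm_sq_fourier {g : ℝ → ℂ} (hg : Integrable g) (hg2 : MemLp g 2) :
    ∫⁻ x, ‖𝓕 g x‖ₑ ^ 2 = ∫⁻ x, ‖g x‖ₑ ^ 2 := by
  have h := eLpNorm_fourier hg hg2
  rw [eLpNorm_eq_lintegral_rpow_enorm_toReal (by norm_num) (by norm_num),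
    eLpNorm_eq_lintegral_rpow_enorm_toReal (by norm_num) (by norm_num)] at h
  have := congrArg (fun z : ℝ≥0∞ => z ^ (2 : ℝ)) h
  simp only [ENNReal.toReal_ofNat, ← ENNReal.rpow_mul] at this
  norm_num at this
  exact this

end DeconvWeights

end

noncomputable section

namespace DeconvWeights

open scoped FourierTransform

/-! ### The deconvolution kernel -/

theorem lintegral_comp_sub_div {F : ℝ → ℝ≥0∞} (hF : Measurable F) (c : ℝ) {h : ℝ} (hh : 0 < h) :
    ∫⁻ s, F ((c - s) / h) = ENNReal.ofReal h * ∫⁻ s, F s := by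
  rw [lintegral_sub_left_eq_self (fun s => F (s / h)) c]
  nth_rewrite 1 [← Real.smul_map_volume_mul_left hh.ne']
  rw [lintegral_smul_measure, lintegral_map (by fun_prop) (by fun_prop), abs_of_pos hh]
  simp [mul_div_cancel_left₀ _ hh.ne']

/-- Large positive arguments are governed by the limit of `w^β φ(w)`, bounded ones by continuity and
the absence of zeros, negative ones by conjugate symmetry. -/
theorem exists_inv_charFun_le {μ : Measure ℝ} [IsProbabilityMeasure μ] {β : ℝ}
    (h0 : ∀ w, charFun μ w ≠ 0) (hs : OrdinarySmooth β (charFun μ)) :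
    ∃ C : ℝ, 0 < C ∧ ∀ w : ℝ, ‖charFun μ w‖⁻¹ ≤ C * (1 + |w| ^ β) := by
  obtain ⟨hβ, c, hc, hlim, -⟩ := hs
  have h1 : ∀ᶠ w : ℝ in atTop, c / 2 < ‖((w ^ β : ℝ) : ℂ) * charFun μ w‖ := by
    have : Tendsto (fun w : ℝ => ‖((w ^ β : ℝ) : ℂ) * charFun μ w‖) atTop (𝓝 c) := by
      simpa [abs_of_pos hc] using hlim.norm
    exact this.eventually_const_lt (by linarith)
  obtain ⟨W, hW⟩ := eventually_atTop.1 (h1.and (eventually_gt_atTop 0))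
  have hcont : Continuous fun w => ‖charFun μ w‖⁻¹ :=
    continuous_charFun.norm.inv₀ fun w => norm_ne_zero_iff.2 (h0 w)
  obtain ⟨M, hM⟩ := (isCompact_Icc (a := (-|W|)) (b := |W|)).exists_bound_of_continuousOn
    hcont.continuousOn
  have hpos : ∀ w : ℝ, W ≤ w → ‖charFun μ w‖⁻¹ ≤ 2 / c * w ^ β := by
    intro w hw
    obtain ⟨h2, h3⟩ := hW w hw
    have h4 : 0 < ‖charFun μ w‖ := norm_pos_iff.2 (h0 w)
    have h5 : 0 ≤ w ^ β := Real.rpow_nonneg h3.le _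
    rw [norm_mul, Complex.norm_real, Real.norm_of_nonneg h5] at h2
    rw [inv_le_iff_one_le_mul₀ h4]
    have : 2 / c * w ^ β * ‖charFun μ w‖ = (2 / c) * (w ^ β * ‖charFun μ w‖) := by ring
    rw [this]
    calc (1 : ℝ) = (2 / c) * (c / 2) := by field_simp
      _ ≤ _ := by gcongr
  refine ⟨|M| + 2 / c, by positivity, fun w => ?_⟩
  have hw0 : 0 ≤ |w| ^ β := by positivity
  by_cases hw : |w| ≤ |W|
  · have h2 := hM w (abs_le.1 hw)
    rw [Real.norm_eq_abs, abs_of_nonneg (by positivity)] at h2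
    calc _ ≤ M := h2
      _ ≤ |M| * 1 := by rw [mul_one]; exact le_abs_self M
      _ ≤ _ := by gcongr <;> linarith [show 0 < 2 / c by positivity]
  · push Not at hw
    have h2 : ‖charFun μ |w|‖ = ‖charFun μ w‖ := by
      rcases abs_choice w with h | h <;> rw [h]
      rw [charFun_neg]; simp
    have h3 := hpos |w| ((le_abs_self W).trans hw.le)
    rw [h2] at h3
    calc _ ≤ _ := h3
      _ ≤ _ := by gcongr <;> linarith [abs_nonneg M]

/-- The kernel transform uses `exp(iwv)`, Mathlib's uses `exp(2πiwv)`; a dilation by `2π` passes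
between the conventions here and in the next lemmas. -/
theorem kernelFT_eq_fourierInv (L : ℝ → ℝ) (w : ℝ) :
    kernelFT L w = 𝓕⁻ (fun v => (L v : ℂ)) (w / (2 * Real.pi)) := by
  rw [Real.fourierInv_eq']
  unfold kernelFT
  congr 1 with v
  rw [smul_eq_mul]
  congr 2
  have : (Real.pi : ℂ) ≠ 0 := by exact_mod_cast Real.pi_ne_zero
  simp
  field_simp

theorem integral_exp_neg_eq_fourier (q : ℝ → ℂ) (v : ℝ) :
    ∫ w : ℝ, Complex.exp (-(Complex.I * (w : ℂ) * (v : ℂ))) * q w =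
      𝓕 q (v / (2 * Real.pi)) := by
  rw [Real.fourier_eq']
  congr 1 with w
  rw [smul_eq_mul]
  congr 2
  have : (Real.pi : ℂ) ≠ 0 := by exact_mod_cast Real.pi_ne_zero
  simp
  field_simp

theorem deconvKernel_eq_fourier (L : ℝ → ℝ) (φU : ℝ → ℂ) (h v : ℝ) :
    deconvKernel L φU h v = ((1 / (2 * Real.pi) : ℂ) *
      𝓕 (fun w => kernelFT L w / φU (w / h)) (v / (2 * Real.pi))).re := by
  rw [deconvKernel, integral_exp_neg_eq_fourier]

theorem continuous_kernelFT {L : ℝ → ℝ} (hL : Integrable L) : Continuous (kernelFT L) := by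
  have : kernelFT L = fun w => 𝓕⁻ (fun v => (L v : ℂ)) (w / (2 * Real.pi)) := by
    ext w; rw [kernelFT_eq_fourierInv]
  rw [this]
  exact (continuous_fourierInv_of_integrable hL.ofReal).comp (by fun_prop)

theorem rpow_le_one_add_rpow {x a b : ℝ} (hx : 0 ≤ x) (ha : 0 ≤ a) (hab : a ≤ b) :
    x ^ a ≤ 1 + x ^ b := by
  rcases le_total x 1 with h | h
  · linarith [Real.rpow_le_one hx h ha, Real.rpow_nonneg hx b]
  · linarith [Real.rpow_le_rpow_of_exponent_le h hab]

/-! ### Integrability, unbiasedness and squared norm of the deconvolution kernel -/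

section Kernel

variable {β : ℝ} {L : ℝ → ℝ} (hβ : 0 ≤ β) (hL : Integrable L) (hK : KernelOrdinary β L)

include hL hK

theorem integrable_rpow_mul_kernelFT (hβ : 0 ≤ β) :
    Integrable (fun w : ℝ => |w| ^ (β + 1) * ‖kernelFT L w‖) := by
  refine hK.2.1.mono' ?_ (Eventually.of_forall fun w => ?_)
  · have := continuous_kernelFT hL
    exact (Continuous.mul (continuous_abs.rpow_const fun x => Or.inr (by linarith))
      this.norm).aestronglyMeasurable
  · rw [Real.norm_of_nonneg (by positivity)]
    gcongr
    linarith [norm_nonneg (deriv (kernelFT L) w)]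

/-- On `[-1, 1]` the transform is bounded; outside, `|w|^{β+1} ≥ 1`, so the moment condition
dominates it. -/
theorem integrable_kernelFT (hβ : 0 ≤ β) : Integrable (kernelFT L) := by
  obtain ⟨C, hC⟩ := hK.1
  have hC0 : 0 ≤ C := (norm_nonneg _).trans (hC 0)
  have h1 : Integrable (fun w : ℝ => Set.indicator (Set.Icc (-1) 1) (fun _ => C) w) :=
    (integrable_indicator_iff measurableSet_Icc).2 (integrableOn_const (by simp))
  refine (h1.add (integrable_rpow_mul_kernelFT hL hK hβ)).mono'
    (continuous_kernelFT hL).aestronglyMeasurable (Eventually.of_forall fun w => ?_)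
  have h2 : 0 ≤ |w| ^ (β + 1) := by positivity
  by_cases hw : w ∈ Set.Icc (-1 : ℝ) 1
  · simp only [Pi.add_apply, Set.indicator_of_mem hw]
    nlinarith [hC w, mul_nonneg h2 (norm_nonneg (kernelFT L w))]
  · simp only [Pi.add_apply, Set.indicator_of_notMem hw, zero_add]
    have h3 : 1 ≤ |w| := by
      by_contra h
      push Not at h
      exact hw (abs_le.1 h.le)
    have h4 := Real.one_le_rpow h3 (show 0 ≤ β + 1 by linarith)
    nlinarith [norm_nonneg (kernelFT L w)]

theorem integrable_one_add_rpow_mul_kernelFT (hβ : 0 ≤ β) :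
    Integrable (fun w : ℝ => (1 + |w| ^ β) * ‖kernelFT L w‖) := by
  refine (((integrable_kernelFT hL hK hβ).norm.const_mul 2).add
    (integrable_rpow_mul_kernelFT hL hK hβ)).mono' ?_ (Eventually.of_forall fun w => ?_)
  · have := continuous_kernelFT hL
    exact (Continuous.mul (continuous_const.add
      (continuous_abs.rpow_const fun x => Or.inr (by linarith))) this.norm).aestronglyMeasurable
  · rw [Real.norm_of_nonneg (by positivity)]
    have := rpow_le_one_add_rpow (abs_nonneg w) hβ (show β ≤ β + 1 by linarith)
    simp only [Pi.add_apply]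
    nlinarith [norm_nonneg (kernelFT L w)]

theorem integrable_one_add_rpow_mul_kernelFT_sq (hβ : 0 ≤ β) :
    Integrable (fun w : ℝ => ((1 + |w| ^ β) * ‖kernelFT L w‖) ^ 2) := by
  obtain ⟨C, hC⟩ := hK.1
  refine (((integrable_kernelFT hL hK hβ).norm.const_mul (2 * C)).add
    (hK.2.2.const_mul 2)).mono' ?_ (Eventually.of_forall fun w => ?_)
  · have := continuous_kernelFT hL
    exact ((Continuous.mul (continuous_const.add
      (continuous_abs.rpow_const fun x => Or.inr (by linarith)))
      this.norm).pow 2).aestronglyMeasurable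
  · rw [Real.norm_of_nonneg (by positivity)]
    simp only [Pi.add_apply]
    nlinarith [norm_nonneg (kernelFT L w), hC w,
      sq_nonneg (‖kernelFT L w‖ - |w| ^ β * ‖kernelFT L w‖)]

variable {μ : Measure ℝ} [IsProbabilityMeasure μ] (h0 : ∀ w, charFun μ w ≠ 0)

omit hK in
include h0 in
theorem continuous_kernelFT_div (h : ℝ) :
    Continuous (fun w => kernelFT L w / charFun μ (w / h)) :=
  (continuous_kernelFT hL).div (continuous_charFun.comp (by fun_prop)) fun w => h0 _

omit hL hK [IsProbabilityMeasure μ] in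
theorem norm_kernelFT_div_le {C h : ℝ} (hC : ∀ w : ℝ, ‖charFun μ w‖⁻¹ ≤ C * (1 + |w| ^ β))
    (hh : 0 < h) (w : ℝ) : ‖kernelFT L w / charFun μ (w / h)‖ ≤
      C * (1 + h ^ (-β)) * ((1 + |w| ^ β) * ‖kernelFT L w‖) := by
  have h1 := hC (w / h)
  have hC0 : 0 ≤ C := by
    have := (inv_nonneg.2 (norm_nonneg (charFun μ 0))).trans (hC 0)
    by_contra hneg
    push Not at hneg
    have : 0 < 1 + |(0 : ℝ)| ^ β := by positivity
    nlinarith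
  rw [abs_div, abs_of_pos hh, Real.div_rpow (abs_nonneg w) hh.le] at h1
  rw [norm_div, div_eq_mul_inv, mul_comm]
  have h2 : |w| ^ β / h ^ β = h ^ (-β) * |w| ^ β := by
    rw [Real.rpow_neg hh.le]; ring
  rw [h2] at h1
  have h3 : 0 ≤ |w| ^ β := by positivity
  have h4 : 0 < h ^ (-β) := by positivity
  rw [← mul_assoc]
  gcongr
  refine h1.trans ?_
  rw [mul_assoc]
  gcongr
  nlinarith

theorem integrable_kernelFT_div (hβ : 0 ≤ β) (h0 : ∀ w, charFun μ w ≠ 0)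
    {C h : ℝ} (hC : ∀ w : ℝ, ‖charFun μ w‖⁻¹ ≤ C * (1 + |w| ^ β))
    (hh : 0 < h) : Integrable (fun w => kernelFT L w / charFun μ (w / h)) :=
  ((integrable_one_add_rpow_mul_kernelFT hL hK hβ).const_mul _).mono'
    (continuous_kernelFT_div hL h0 h).aestronglyMeasurable
    (Eventually.of_forall fun w => norm_kernelFT_div_le hC hh w)

theorem continuous_deconvKernel (hβ : 0 ≤ β) (h0 : ∀ w, charFun μ w ≠ 0)
    {C h : ℝ} (hC : ∀ w : ℝ, ‖charFun μ w‖⁻¹ ≤ C * (1 + |w| ^ β))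
    (hh : 0 < h) : Continuous (deconvKernel L (charFun μ) h) := by
  have : deconvKernel L (charFun μ) h = fun v => ((1 / (2 * Real.pi) : ℂ) *
      𝓕 (fun w => kernelFT L w / charFun μ (w / h)) (v / (2 * Real.pi))).re := by
    ext v; rw [deconvKernel_eq_fourier]
  rw [this]
  have h1 := continuous_fourier_of_integrable (integrable_kernelFT_div hL hK hβ h0 hC hh)
  exact Complex.continuous_re.comp (continuous_const.mul (h1.comp (by fun_prop)))

/-- This is the inversion formula for `L`. It holds only almost everywhere because `L` is not
assumed continuous, and that suffices since `L` is only ever integrated. -/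
theorem kernel_eq_fourier_kernelFT (hβ : 0 ≤ β) :
    ∀ᵐ v, ((1 / (2 * Real.pi) : ℂ) * 𝓕 (kernelFT L) (v / (2 * Real.pi))).re = L v := by
  have hpi : (0 : ℝ) < 2 * Real.pi := by positivity
  have hi : Integrable (𝓕⁻ (fun v => (L v : ℂ))) := by
    have h1 := (integrable_kernelFT hL hK hβ).comp_mul_left' hpi.ne'
    refine h1.congr (Eventually.of_forall fun w => ?_)
    simp only [kernelFT_eq_fourierInv]
    rw [mul_div_cancel_left₀ _ hpi.ne']
  have hi' : Integrable (𝓕 (fun v => (L v : ℂ))) := by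
    refine (hi.comp_neg).congr (Eventually.of_forall fun w => ?_)
    simp [Real.fourierInv_eq_fourier_neg]
  have key : ∀ v, (1 / (2 * Real.pi) : ℂ) * 𝓕 (kernelFT L) (v / (2 * Real.pi)) =
      𝓕⁻ (𝓕 (fun v => (L v : ℂ))) v := by
    intro v
    rw [← integral_exp_neg_eq_fourier]
    have e1 := Measure.integral_comp_mul_left
      (fun w : ℝ => Complex.exp (-(Complex.I * (w : ℂ) * (v : ℂ))) * kernelFT L w) (2 * Real.pi)
    rw [abs_of_pos (inv_pos.2 hpi)] at e1
    have e2 : (1 / (2 * Real.pi) : ℂ) * ∫ w : ℝ,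
        Complex.exp (-(Complex.I * (w : ℂ) * (v : ℂ))) * kernelFT L w = (2 * Real.pi)⁻¹ •
        ∫ w : ℝ, Complex.exp (-(Complex.I * (w : ℂ) * (v : ℂ))) * kernelFT L w := by
      rw [Complex.real_smul]; push_cast; rw [one_div]
    rw [e2, ← e1, Real.fourierInv_eq', ← integral_neg_eq_self]
    congr 1 with w
    rw [kernelFT_eq_fourierInv, mul_div_cancel_left₀ _ hpi.ne', smul_eq_mul,
      Real.fourierInv_eq_fourier_neg, neg_neg]
    congr 2
    simp
    ring
  filter_upwards [fourierInv_fourier_ae (f := fun v => (L v : ℂ)) hL.ofReal hi'] with v hv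
  rw [key, hv, Complex.ofReal_re]

/-- Averaging the deconvolution kernel over the error gives back the kernel. -/
theorem integral_deconvKernel (hβ : 0 ≤ β) (h0 : ∀ w, charFun μ w ≠ 0)
    {C h : ℝ} (hC : ∀ w : ℝ, ‖charFun μ w‖⁻¹ ≤ C * (1 + |w| ^ β)) (hh : 0 < h) :
    ∀ᵐ v, ∫ e, deconvKernel L (charFun μ) h (v - e / h) ∂μ = L v := by
  filter_upwards [kernel_eq_fourier_kernelFT hL hK hβ] with v hv
  have hq := integrable_kernelFT_div hL hK hβ h0 hC hh
  set q : ℝ → ℂ := fun w => kernelFT L w / charFun μ (w / h) with hqdef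
  -- Fubini applies because the exponential has modulus one and `q` is integrable.
  have hint : Integrable (fun p : ℝ × ℝ =>
      Complex.exp (-(Complex.I * (p.2 : ℂ) * ((v - p.1 / h : ℝ) : ℂ))) * q p.2)
      (μ.prod volume) := by
    have h1 : Integrable (fun p : ℝ × ℝ => q p.2) (μ.prod volume) := hq.comp_snd μ
    refine h1.mono ?_ (Eventually.of_forall fun p => ?_)
    · refine AEStronglyMeasurable.mul ?_ h1.1
      exact Continuous.aestronglyMeasurable (by fun_prop)
    · rw [norm_mul, Complex.norm_exp]
      simp
  rw [← hv]
  simp only [deconvKernel]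
  have hint2 := hint.integral_prod_left
  rw [show ∀ g : ℝ → ℂ, (∫ e, (g e).re ∂μ) = ∫ e, RCLike.re (g e) ∂μ from fun _ => rfl,
    integral_re (hint2.const_mul _)]
  simp only [RCLike.re_to_complex]
  congr 1
  rw [integral_const_mul, integral_integral_swap hint, ← integral_exp_neg_eq_fourier]
  congr 2 with w
  -- The error enters only through `exp(iwe/h)`, whose mean is the characteristic function at `w/h`.
  -- This cancels the denominator of `q`.
  have : ∀ e : ℝ, Complex.exp (-(Complex.I * (w : ℂ) * ((v - e / h : ℝ) : ℂ))) * q w =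
      Complex.exp (-(Complex.I * (w : ℂ) * (v : ℂ))) * q w *
        Complex.exp (((w / h : ℝ) : ℂ) * e * Complex.I) := by
    intro e
    have h1 : Complex.exp (-(Complex.I * (w : ℂ) * ((v - e / h : ℝ) : ℂ))) =
        Complex.exp (-(Complex.I * (w : ℂ) * (v : ℂ))) *
          Complex.exp (((w / h : ℝ) : ℂ) * e * Complex.I) := by
      rw [← Complex.exp_add]
      congr 1
      push_cast
      ring
    rw [h1, mul_right_comm]
  simp only [this]
  rw [integral_const_mul, ← charFun_apply_real, mul_assoc]
  congr 1
  simp only [hqdef]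
  rw [div_mul_cancel₀ _ (h0 _)]

omit hL hK [IsProbabilityMeasure μ] in
theorem abs_deconvKernel_le (h : ℝ) :
    ∃ M : ℝ, ∀ v, |deconvKernel L (charFun μ) h v| ≤ M := by
  refine ⟨‖(1 / (2 * Real.pi) : ℂ)‖ * ∫ w, ‖kernelFT L w / charFun μ (w / h)‖, fun v => ?_⟩
  refine (Complex.abs_re_le_norm _).trans ?_
  rw [norm_mul]
  gcongr
  refine (norm_integral_le_integral_norm _).trans (le_of_eq ?_)
  congr 1 with w
  rw [norm_mul, Complex.norm_exp]
  simp

/-- The squared norm of the deconvolution kernel. -/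
theorem exists_lintegral_deconvKernel_sq_le (hβ : 0 ≤ β) (h0 : ∀ w, charFun μ w ≠ 0)
    {C : ℝ} (hC : ∀ w : ℝ, ‖charFun μ w‖⁻¹ ≤ C * (1 + |w| ^ β)) :
    ∃ V : ℝ, 0 < V ∧ ∀ h : ℝ, 0 < h → h ≤ 1 →
      ∫⁻ v, ENNReal.ofReal (deconvKernel L (charFun μ) h v ^ 2) ≤
        ENNReal.ofReal (V * h ^ (-(2 * β))) := by
  have hsq := integrable_one_add_rpow_mul_kernelFT_sq hL hK hβ
  set I : ℝ := ∫ w : ℝ, ((1 + |w| ^ β) * ‖kernelFT L w‖) ^ 2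
  have hI0 : 0 ≤ I := integral_nonneg fun w => sq_nonneg _
  refine ⟨4 * C ^ 2 * I + 1, by positivity, fun h hh hh1 => ?_⟩
  have hq := integrable_kernelFT_div hL hK hβ h0 hC hh
  have hqc := continuous_kernelFT_div (L := L) hL h0 h
  set q : ℝ → ℂ := fun w => kernelFT L w / charFun μ (w / h)
  have hh2 : 1 ≤ h ^ (-β) := Real.one_le_rpow_of_pos_of_le_one_of_nonpos hh hh1 (by linarith)
  have hC0 : 0 ≤ C := by
    have := (inv_nonneg.2 (norm_nonneg (charFun μ 0))).trans (hC 0)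
    by_contra hneg
    push Not at hneg
    have : 0 < 1 + |(0 : ℝ)| ^ β := by positivity
    nlinarith
  -- As `h ≤ 1`, one has `1 + h^{-β} ≤ 2 h^{-β}`; squaring gives the factor `4 h^{-2β}`.
  have hb : ∀ w, ‖q w‖ ^ 2 ≤ 4 * C ^ 2 * h ^ (-(2 * β)) * ((1 + |w| ^ β) * ‖kernelFT L w‖) ^ 2 := by
    intro w
    have h1 := norm_kernelFT_div_le (L := L) hC hh w
    have h2 : h ^ (-(2 * β)) = (h ^ (-β)) ^ 2 := by
      rw [← Real.rpow_natCast, ← Real.rpow_mul hh.le]; congr 1; push_cast; ring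
    rw [h2]
    calc ‖q w‖ ^ 2 ≤ (C * (1 + h ^ (-β)) * ((1 + |w| ^ β) * ‖kernelFT L w‖)) ^ 2 := by gcongr
      _ ≤ (C * (h ^ (-β) + h ^ (-β)) * ((1 + |w| ^ β) * ‖kernelFT L w‖)) ^ 2 := by gcongr
      _ = _ := by ring
  have hq2 : MemLp q 2 := by
    rw [memLp_two_iff_integrable_sq_norm hqc.aestronglyMeasurable]
    refine (hsq.const_mul (4 * C ^ 2 * h ^ (-(2 * β)))).mono' (hqc.norm.pow 2).aestronglyMeasurable
      (Eventually.of_forall fun w => ?_)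
    rw [Real.norm_of_nonneg (by positivity)]
    exact hb w
  have hpi : (1 : ℝ) ≤ 2 * Real.pi := by nlinarith [Real.pi_gt_three]
  have hpi0 : (0 : ℝ) < 2 * Real.pi := by linarith
  have hFm : Measurable (fun x => ‖𝓕 q x‖ₑ ^ 2) :=
    ((continuous_fourier_of_integrable hq).measurable.enorm).pow_const 2
  -- Reflection leaves Lebesgue measure unchanged and brings the argument to the form `(0 - v)/(2π)`
  -- of `lintegral_comp_sub_div`. The total constant `(2π)⁻² · 2π` is at most one.
  calc ∫⁻ v, ENNReal.ofReal (deconvKernel L (charFun μ) h v ^ 2)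
      ≤ ∫⁻ v, ENNReal.ofReal ((1 / (2 * Real.pi)) ^ 2) *
          ‖𝓕 q ((0 - v) / (2 * Real.pi))‖ₑ ^ 2 ∂(Measure.map (fun x : ℝ => -x) volume) := by
        rw [lintegral_map (by
          exact Measurable.const_mul (hFm.comp (by fun_prop)) _) (by fun_prop)]
        refine lintegral_mono fun v => ?_
        rw [deconvKernel_eq_fourier, sub_neg_eq_add, zero_add, ← ofReal_norm, 
          ← ENNReal.ofReal_pow (norm_nonneg _), ← ENNReal.ofReal_mul (by positivity)]
        refine ENNReal.ofReal_le_ofReal ?_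
        rw [← sq_abs, ← mul_pow]
        refine pow_le_pow_left₀ (abs_nonneg _) ((Complex.abs_re_le_norm _).trans ?_) 2
        rw [norm_mul]
        gcongr
        simp [abs_of_pos Real.pi_pos]
    _ = ENNReal.ofReal ((1 / (2 * Real.pi)) ^ 2) * (ENNReal.ofReal (2 * Real.pi) *
          ∫⁻ x, ‖q x‖ₑ ^ 2) := by
        have : Measure.map (fun x : ℝ => -x) volume = volume := Measure.map_neg_eq_self volume
        have hm : Measurable fun v : ℝ => ‖𝓕 q ((0 - v) / (2 * Real.pi))‖ₑ ^ 2 :=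
          hFm.comp (g := fun x => ‖𝓕 q x‖ₑ ^ 2)
            (by fun_prop : Measurable fun v : ℝ => (0 - v) / (2 * Real.pi))
        rw [this, lintegral_const_mul _ hm,
          lintegral_comp_sub_div hFm 0 hpi0, lintegral_enorm_sq_fourier hq hq2]
    _ ≤ ∫⁻ x, ‖q x‖ₑ ^ 2 := by
        rw [← mul_assoc, ← ENNReal.ofReal_mul (by positivity)]
        refine (mul_le_mul_left (ENNReal.ofReal_le_ofReal (q := 1) ?_) _).trans (by simp)
        rw [one_div, inv_pow, pow_two, mul_inv, mul_assoc, inv_mul_cancel₀ hpi0.ne', mul_one]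
        exact inv_le_one_of_one_le₀ hpi
    _ ≤ ∫⁻ w, ENNReal.ofReal
          (4 * C ^ 2 * h ^ (-(2 * β)) * ((1 + |w| ^ β) * ‖kernelFT L w‖) ^ 2) := by
        refine lintegral_mono fun w => ?_
        rw [← ofReal_norm, ← ENNReal.ofReal_pow (norm_nonneg _)]
        exact ENNReal.ofReal_le_ofReal (hb w)
    _ = ENNReal.ofReal (4 * C ^ 2 * h ^ (-(2 * β)) * I) := by
        rw [← ofReal_integral_eq_lintegral_ofReal (hsq.const_mul _)
          (Eventually.of_forall fun w => by positivity), integral_const_mul]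
    _ ≤ _ := by
        refine ENNReal.ofReal_le_ofReal ?_
        have : 0 < h ^ (-(2 * β)) := by positivity
        nlinarith

end Kernel

end DeconvWeights

end

noncomputable section

namespace DeconvWeights

/-! ### Empirical processes indexed by a ball -/

theorem integrable_finset_sup' {α ι : Type*} [MeasurableSpace α] {μ : Measure α} {S : Finset ι}
    (hS : S.Nonempty) {G : ι → α → ℝ} (hG : ∀ i ∈ S, Integrable (G i) μ) :
    Integrable (fun a => S.sup' hS fun i => G i a) μ := by
  have : (fun a => S.sup' hS fun i => G i a) = S.sup' hS G := by
    ext a; rw [Finset.sup'_apply]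
  rw [this]
  exact Finset.sup'_induction (p := fun f => Integrable f μ) hS G
    (fun f hf g hg => Integrable.sup hf hg) hG

/-- The contraction principle for one random sign. -/
theorem sup'_add_sup'_sub_le {ι : Type*} {S : Finset ι} (hS : S.Nonempty) {A p q : ι → ℝ}
    (h : ∀ i ∈ S, ∀ j ∈ S, |p i - p j| ≤ |q i - q j|) :
    (S.sup' hS fun i => A i + p i) + (S.sup' hS fun i => A i - p i) ≤
      (S.sup' hS fun i => A i + q i) + (S.sup' hS fun i => A i - q i) := by
  obtain ⟨i, hi, hi'⟩ := S.exists_mem_eq_sup' hS fun i => A i + p i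
  obtain ⟨j, hj, hj'⟩ := S.exists_mem_eq_sup' hS fun i => A i - p i
  rw [hi', hj']
  -- With `i` and `j` the maximising indices on the left, the sign of `q i - q j` decides which of
  -- them is inserted in which supremum on the right.
  have h1 := (le_abs_self _).trans (h i hi j hj)
  have a1 := S.le_sup' (fun i => A i + q i) hi
  have a2 := S.le_sup' (fun i => A i - q i) hi
  have b1 := S.le_sup' (fun i => A i + q i) hj
  have b2 := S.le_sup' (fun i => A i - q i) hj
  rcases abs_cases (q i - q j) with ⟨h2, -⟩ | ⟨h2, -⟩ <;> linarith

/-! ### Symmetrisation, contraction and the maximal inequality -/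

section Suprema

variable {𝒴 : Type*} [MeasurableSpace 𝒴] {E : Type*} [NormedAddCommGroup E]
  [InnerProductSpace ℝ E] [MeasurableSpace E] [BorelSpace E] [SecondCountableTopology E]

omit [MeasurableSpace E] [BorelSpace E] [SecondCountableTopology E] in
/-- Symmetrisation and contraction in a single observation. -/
theorem integral_sup'_symmetrize_le {μ : Measure 𝒴} [IsProbabilityMeasure μ] {S : Finset E}
    (hS : S.Nonempty) {φ : 𝒴 → E → ℝ} (hφ : ∀ d, Integrable (fun y => φ y d) μ) {V : 𝒴 → E}
    (hV : Integrable V μ) (hL : ∀ y d d', |φ y d - φ y d'| ≤ |inner ℝ (d - d') (V y)|)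
    (A : E → ℝ) :
    ∫ y, S.sup' hS (fun d => A d + (φ y d - ∫ y', φ y' d ∂μ)) ∂μ ≤
      ∫ y, (1 / 2 : ℝ) * ((S.sup' hS fun d => A d + 2 * inner ℝ d (V y)) +
        S.sup' hS fun d => A d - 2 * inner ℝ d (V y)) ∂μ := by
  have hi : ∀ c : ℝ, ∀ d, Integrable (fun y => A d + c * φ y d) μ := fun c d =>
    (integrable_const _).add ((hφ d).const_mul c)
  have hiV : ∀ d, Integrable (fun y => (inner ℝ d (V y) : ℝ)) μ := fun d => hV.const_inner d
  have i1 : Integrable (fun y => S.sup' hS fun d => A d + 2 * φ y d) μ :=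
    integrable_finset_sup' hS fun d _ => hi 2 d
  have i2 : Integrable (fun y => S.sup' hS fun d => A d - 2 * φ y d) μ :=
    integrable_finset_sup' hS fun d _ => by simpa [sub_eq_add_neg] using hi (-2) d
  have i3 : Integrable (fun y => S.sup' hS fun d => A d + 2 * inner ℝ d (V y)) μ :=
    integrable_finset_sup' hS fun d _ => (integrable_const _).add ((hiV d).const_mul 2)
  have i4 : Integrable (fun y => S.sup' hS fun d => A d - 2 * inner ℝ d (V y)) μ :=
    integrable_finset_sup' hS fun d _ => (integrable_const _).sub ((hiV d).const_mul 2)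
  have i0 : Integrable (fun y => S.sup' hS fun d => A d + (φ y d - ∫ y', φ y' d ∂μ)) μ :=
    integrable_finset_sup' hS fun d _ =>
      (integrable_const _).add ((hφ d).sub (integrable_const _))
  set m : ℝ := ∫ y, (S.sup' hS fun d => A d - 2 * φ y d) ∂μ
  -- The centred term is split as `½(A d + 2 φ y d) + ½(A d - 2 ∫ φ)`. The second half is an
  -- integral of values below a supremum, hence at most `m / 2`; averaging over `y` then produces
  -- the two signs with weight one half each.
  have step1 : ∀ y, (S.sup' hS fun d => A d + (φ y d - ∫ y', φ y' d ∂μ)) ≤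
      (1 / 2) * (S.sup' hS fun d => A d + 2 * φ y d) + (1 / 2) * m := by
    intro y
    refine Finset.sup'_le _ _ fun d hd => ?_
    have h1 := S.le_sup' (fun d => A d + 2 * φ y d) hd
    have h2 : A d - 2 * ∫ y', φ y' d ∂μ ≤ m := by
      have : A d - 2 * ∫ y', φ y' d ∂μ = ∫ y', (A d - 2 * φ y' d) ∂μ := by
        rw [integral_sub (integrable_const _) ((hφ d).const_mul 2), integral_const_mul]
        simp
      rw [this]
      refine integral_mono ?_ i2 fun y' => S.le_sup' (fun d => A d - 2 * φ y' d) hd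
      exact (integrable_const _).sub ((hφ d).const_mul 2)
    linarith
  calc ∫ y, S.sup' hS (fun d => A d + (φ y d - ∫ y', φ y' d ∂μ)) ∂μ
      ≤ ∫ y, ((1 / 2) * (S.sup' hS fun d => A d + 2 * φ y d) + (1 / 2) * m) ∂μ :=
        integral_mono i0 ((i1.const_mul _).add (integrable_const _)) step1
    _ = ∫ y, (1 / 2 : ℝ) * ((S.sup' hS fun d => A d + 2 * φ y d) +
          S.sup' hS fun d => A d - 2 * φ y d) ∂μ := by
        rw [integral_add (i1.const_mul _) (integrable_const _), integral_const_mul,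
          integral_const, integral_const_mul,
          integral_add (f := fun y => S.sup' hS fun d => A d + 2 * φ y d) i1 i2]
        simp
        ring
    _ ≤ _ := by
        refine integral_mono ((i1.add i2).const_mul _) ((i3.add i4).const_mul _) fun y => ?_
        have := sup'_add_sup'_sub_le hS (A := A) (p := fun d => 2 * φ y d)
          (q := fun d => 2 * inner ℝ d (V y)) fun d _ d' _ => by
            rw [← mul_sub, ← mul_sub, abs_mul, abs_mul, ← inner_sub_left]
            exact mul_le_mul_of_nonneg_left (hL y d d') (abs_nonneg _)
        simp only
        linarith

omit [MeasurableSpace E] [BorelSpace E] [SecondCountableTopology E] in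
-- Averaging over a random sign of `v`: concavity of the square root and the parallelogram law. It
-- replaces explicit Rademacher variables in the induction below.
theorem half_sqrt_add_sqrt_le (x v : E) {c : ℝ} (hc : 0 ≤ c) :
    (1 / 2 : ℝ) * (√(‖x + v‖ ^ 2 + c) + √(‖x - v‖ ^ 2 + c)) ≤ √(‖x‖ ^ 2 + ‖v‖ ^ 2 + c) := by
  refine Real.le_sqrt_of_sq_le ?_
  have h1 := Real.sq_sqrt (show 0 ≤ ‖x + v‖ ^ 2 + c by positivity)
  have h2 := Real.sq_sqrt (show 0 ≤ ‖x - v‖ ^ 2 + c by positivity)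
  have h3 := parallelogram_law_with_norm ℝ x v
  nlinarith [sq_nonneg (√(‖x + v‖ ^ 2 + c) - √(‖x - v‖ ^ 2 + c))]

theorem integral_sqrt_le {μ : Measure 𝒴} [IsProbabilityMeasure μ] {g : 𝒴 → ℝ}
    (hg : Integrable g μ) (h0 : ∀ y, 0 ≤ g y) :
    Integrable (fun y => √(g y)) μ ∧ ∫ y, √(g y) ∂μ ≤ √(∫ y, g y ∂μ) := by
  have hi : Integrable (fun y => √(g y)) μ := by
    refine (hg.add (integrable_const 1)).mono'
      (Real.continuous_sqrt.comp_aestronglyMeasurable hg.1) (Eventually.of_forall fun y => ?_)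
    rw [Real.norm_of_nonneg (Real.sqrt_nonneg _)]
    simp only [Pi.add_apply]
    nlinarith [Real.sq_sqrt (h0 y), sq_nonneg (√(g y) - 1), Real.sqrt_nonneg (g y)]
  refine ⟨hi, ?_⟩
  have := (Real.strictConcaveOn_sqrt.concaveOn).le_map_integral (μ := μ) (f := g)
    Real.continuous_sqrt.continuousOn isClosed_Ici (Eventually.of_forall h0) hg hi
  exact this

variable {Ω : Type*} [MeasurableSpace Ω] {P : Measure Ω} [IsProbabilityMeasure P]

/-- The expected supremum of a centred empirical process over a finite subset of a ball. -/
theorem integral_sup'_process_le {μ : Measure 𝒴} [IsProbabilityMeasure μ] {Y : ℕ → Ω → 𝒴}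
    (hY : ∀ i, Measurable (Y i)) (hind : iIndepFun Y P) (hlaw : ∀ i, P.map (Y i) = μ)
    {S : Finset E} (hS : S.Nonempty) {R : ℝ} (hR : ∀ d ∈ S, ‖d‖ ≤ R)
    {φ : 𝒴 → E → ℝ} (hφm : ∀ d, Measurable fun y => φ y d)
    (hφ : ∀ d, Integrable (fun y => φ y d) μ) {V : 𝒴 → E}
    (hVm : Measurable V) (hV : Integrable (fun y => ‖V y‖ ^ 2) μ)
    (hL : ∀ y d d', |φ y d - φ y d'| ≤ |inner ℝ (d - d') (V y)|) (n : ℕ) :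
    ∀ x : E, ∫ ω, S.sup' hS (fun d => 2 * inner ℝ d x +
        ∑ i ∈ Finset.range n, (φ (Y i ω) d - ∫ y, φ y d ∂μ)) ∂P ≤
      2 * R * √(‖x‖ ^ 2 + n * ∫ y, ‖V y‖ ^ 2 ∂μ) := by
  have hR0 : 0 ≤ R := by
    obtain ⟨d, hd⟩ := hS
    exact (norm_nonneg d).trans (hR d hd)
  have hV1 : Integrable V μ := by
    refine (hV.add (integrable_const 1)).mono' hVm.aestronglyMeasurable
      (Eventually.of_forall fun y => ?_)
    simp only [Pi.add_apply]
    nlinarith [sq_nonneg (‖V y‖ - 1), norm_nonneg (V y)]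
  set s : ℝ := ∫ y, ‖V y‖ ^ 2 ∂μ with hs
  have hs0 : 0 ≤ s := integral_nonneg fun y => by positivity
  have hφY : ∀ i d, Integrable (fun ω => φ (Y i ω) d) P := fun i d => by
    have := hφ d
    rw [← hlaw i] at this
    exact this.comp_measurable (hY i)
  -- The shift `x` has to stay general: each removed observation is traded for a shift by `±V y`,
  -- and the induction hypothesis is used at `x + V y` and at `x - V y`.
  induction n with
  | zero =>
    intro x
    simp only [Finset.range_zero, Finset.sum_empty, add_zero, Nat.cast_zero, zero_mul,
      integral_const, probReal_univ, one_smul]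
    refine Finset.sup'_le _ _ fun d hd => ?_
    rw [Real.sqrt_sq (norm_nonneg x)]
    have := real_inner_le_norm d x
    nlinarith [hR d hd, norm_nonneg x]
  | succ n ih =>
    intro x
    let pre : Ω → (Finset.range n → 𝒴) := fun ω i => Y i ω
    have hpre : Measurable pre := measurable_pi_lambda _ fun i => hY i
    let z : (Finset.range n → 𝒴) → E → ℝ := fun a d => ∑ i, (φ (a i) d - ∫ y, φ y d ∂μ)
    have hz : ∀ ω d, z (pre ω) d = ∑ i ∈ Finset.range n, (φ (Y i ω) d - ∫ y, φ y d ∂μ) := by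
      intro ω d
      exact Finset.sum_coe_sort (Finset.range n) (fun i => φ (Y i ω) d - ∫ y, φ y d ∂μ)
    have hzm : ∀ d, Measurable fun a => z a d := fun d =>
      Finset.measurable_sum _ fun i _ => ((hφm d).comp (measurable_pi_apply i)).sub_const _
    have hzi : ∀ d, Integrable (fun a => z a d) (P.map pre) := fun d => by
      rw [integrable_map_measure (hzm d).aestronglyMeasurable hpre.aemeasurable]
      simp only [Function.comp_def, hz]
      exact integrable_finsetSum _ fun i _ => (hφY i d).sub (integrable_const _)
    -- The first `n` observations form a block independent of the last one, so the expectation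
    -- becomes an iterated integral.
    have hindep : IndepFun pre (Y n) P := by
      have h1 := hind.indepFun_finset (Finset.range n) {n} (by simp) hY
      exact h1.comp (φ := id) (ψ := fun a : (({n} : Finset ℕ) → 𝒴) => a ⟨n, by simp⟩)
        measurable_id (measurable_pi_apply _)
    have hprod : P.map (fun ω => (pre ω, Y n ω)) = (P.map pre).prod μ := by
      rw [(indepFun_iff_map_prod_eq_prod_map_map hpre.aemeasurable (hY n).aemeasurable).1 hindep,
        hlaw n]
    have : IsProbabilityMeasure (P.map pre) := Measure.isProbabilityMeasure_map hpre.aemeasurable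
    set ν := P.map pre with hν
    let H : (Finset.range n → 𝒴) × 𝒴 → ℝ := fun p =>
      S.sup' hS fun d => (2 * inner ℝ d x + z p.1 d) + (φ p.2 d - ∫ y, φ y d ∂μ)
    have hHi : Integrable H (ν.prod μ) := integrable_finset_sup' hS fun d _ =>
      ((integrable_const _).add ((hzi d).comp_fst μ)).add
        (((hφ d).comp_snd ν).sub (integrable_const _))
    have hJi : ∀ c : ℝ, Integrable (fun p : (Finset.range n → 𝒴) × 𝒴 =>
        S.sup' hS fun d => (2 * inner ℝ d x + z p.1 d) + c * inner ℝ d (V p.2)) (ν.prod μ) :=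
      fun c => integrable_finset_sup' hS fun d _ =>
        ((integrable_const _).add ((hzi d).comp_fst μ)).add
          (((hV1.const_inner (𝕜 := ℝ) d).comp_snd ν).const_mul c)
    let J : (Finset.range n → 𝒴) × 𝒴 → ℝ := fun p => (1 / 2 : ℝ) *
      ((S.sup' hS fun d => (2 * inner ℝ d x + z p.1 d) + 2 * inner ℝ d (V p.2)) +
        S.sup' hS fun d => (2 * inner ℝ d x + z p.1 d) - 2 * inner ℝ d (V p.2))
    have hJi2 : Integrable J (ν.prod μ) := by
      refine Integrable.const_mul ((hJi 2).add ?_) _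
      simpa [sub_eq_add_neg] using hJi (-2)
    have eB : ∀ x', ∫ a, S.sup' hS (fun d => 2 * inner ℝ d x' + z a d) ∂ν =
        ∫ ω, S.sup' hS (fun d => 2 * inner ℝ d x' +
          ∑ i ∈ Finset.range n, (φ (Y i ω) d - ∫ y, φ y d ∂μ)) ∂P := by
      intro x'
      rw [hν, integral_map hpre.aemeasurable]
      · simp only [hz]
      · have : Measurable (S.sup' hS fun d (a : Finset.range n → 𝒴) =>
            2 * inner ℝ d x' + z a d) :=
          Finset.measurable_sup' hS fun d _ => (hzm d).const_add _
        convert this.aestronglyMeasurable using 1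
        ext a
        rw [Finset.sup'_apply]
    -- For a fixed last observation the linear terms combine to `2⟨d, x ± V y⟩`. The induction
    -- hypothesis bounds both suprema, and `half_sqrt_add_sqrt_le` averages the bounds.
    have hJle : ∀ y, ∫ a, J (a, y) ∂ν ≤ 2 * R * √(‖x‖ ^ 2 + ‖V y‖ ^ 2 + n * s) := by
      intro y
      have e1 : ∀ a, J (a, y) = (1 / 2 : ℝ) *
          ((S.sup' hS fun d => 2 * inner ℝ d (x + V y) + z a d) +
            S.sup' hS fun d => 2 * inner ℝ d (x - V y) + z a d) := by
        intro a
        simp only [J]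
        congr 3 <;> ext d <;> simp only [inner_add_right, inner_sub_right] <;> ring
      have i5 : ∀ x' : E, Integrable (fun a => S.sup' hS fun d => 2 * inner ℝ d x' + z a d) ν :=
        fun x' => integrable_finset_sup' hS fun d _ => (integrable_const _).add (hzi d)
      simp only [e1]
      rw [integral_const_mul, integral_add (i5 _) (i5 _), eB, eB]
      have h1 := ih (x + V y)
      have h2 := ih (x - V y)
      have h3 := half_sqrt_add_sqrt_le x (V y) (c := n * s) (by positivity)
      nlinarith
    have hsq : Integrable (fun y => ‖x‖ ^ 2 + ‖V y‖ ^ 2 + n * s) μ :=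
      ((integrable_const _).add hV).add (integrable_const _)
    have hsqrt := integral_sqrt_le hsq fun y => by positivity
    have hHm : AEStronglyMeasurable H (P.map fun ω => (pre ω, Y n ω)) := by
      rw [hprod]; exact hHi.1
    calc ∫ ω, S.sup' hS (fun d => 2 * inner ℝ d x +
          ∑ i ∈ Finset.range (n + 1), (φ (Y i ω) d - ∫ y, φ y d ∂μ)) ∂P
        = ∫ ω, H (pre ω, Y n ω) ∂P := by
          congr 1 with ω
          simp only [H, hz, Finset.sum_range_succ, add_assoc]
      _ = ∫ p, H p ∂(ν.prod μ) := by
          rw [← hprod, integral_map (hpre.prodMk (hY n)).aemeasurable hHm]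
      _ = ∫ a, ∫ y, H (a, y) ∂μ ∂ν := integral_prod _ hHi
      _ ≤ ∫ a, ∫ y, J (a, y) ∂μ ∂ν :=
          integral_mono hHi.integral_prod_left hJi2.integral_prod_left fun a =>
            integral_sup'_symmetrize_le hS hφ hV1 hL fun d => 2 * inner ℝ d x + z a d
      _ = ∫ y, ∫ a, J (a, y) ∂ν ∂μ := integral_integral_swap hJi2
      _ ≤ ∫ y, 2 * R * √(‖x‖ ^ 2 + ‖V y‖ ^ 2 + n * s) ∂μ :=
          integral_mono hJi2.integral_prod_right (hsqrt.1.const_mul _) hJle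
      _ ≤ 2 * R * √(∫ y, (‖x‖ ^ 2 + ‖V y‖ ^ 2 + n * s) ∂μ) := by
          rw [integral_const_mul]
          gcongr
          exact hsqrt.2
      _ = _ := by
          rw [integral_add (f := fun y => ‖x‖ ^ 2 + ‖V y‖ ^ 2) ((integrable_const _).add hV)
            (integrable_const _), integral_add (integrable_const _) hV]
          simp only [integral_const, probReal_univ, one_smul, ← hs]
          congr 2
          push_cast
          ring

/-- A maximal inequality for a centred empirical process that is indexed by a ball. -/
theorem measure_process_gt_le {μ : Measure 𝒴} [IsProbabilityMeasure μ] {Y : ℕ → Ω → 𝒴}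
    (hY : ∀ i, Measurable (Y i)) (hind : iIndepFun Y P) (hlaw : ∀ i, P.map (Y i) = μ)
    {R : ℝ} (hR : 0 ≤ R) {φ : 𝒴 → E → ℝ} (hφm : ∀ d, Measurable fun y => φ y d)
    (hφ0 : ∀ y, φ y 0 = 0) {V : 𝒴 → E}
    (hVm : Measurable V) (hV : Integrable (fun y => ‖V y‖ ^ 2) μ)
    (hL : ∀ y d d', |φ y d - φ y d'| ≤ |inner ℝ (d - d') (V y)|) (n : ℕ) {τ : ℝ} (hτ : 0 < τ) :
    P {ω | ∃ d : E, ‖d‖ ≤ R ∧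
        τ < |∑ i ∈ Finset.range n, (φ (Y i ω) d - ∫ y, φ y d ∂μ)|} ≤
      ENNReal.ofReal (4 * R * √(n * ∫ y, ‖V y‖ ^ 2 ∂μ) / τ) := by
  have hV1 : Integrable V μ := by
    refine (hV.add (integrable_const 1)).mono' hVm.aestronglyMeasurable
      (Eventually.of_forall fun y => ?_)
    simp only [Pi.add_apply]
    nlinarith [sq_nonneg (‖V y‖ - 1), norm_nonneg (V y)]
  have hLip : ∀ y d d', |φ y d - φ y d'| ≤ ‖V y‖ * ‖d - d'‖ := fun y d d' =>
    (hL y d d').trans ((abs_real_inner_le_norm _ _).trans (mul_comm _ _).le)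
  have hφ : ∀ d, Integrable (fun y => φ y d) μ := fun d => by
    refine (hV1.norm.mul_const ‖d‖).mono' (hφm d).aestronglyMeasurable
      (Eventually.of_forall fun y => ?_)
    simpa [hφ0] using hLip y d 0
  set Z : Ω → E → ℝ := fun ω d => ∑ i ∈ Finset.range n, (φ (Y i ω) d - ∫ y, φ y d ∂μ) with hZ
  have hZm : ∀ d, Measurable fun ω => Z ω d := fun d =>
    Finset.measurable_sum _ fun i _ => ((hφm d).comp (hY i)).sub_const _
  have hφY : ∀ i d, Integrable (fun ω => φ (Y i ω) d) P := fun i d => by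
    have := hφ d
    rw [← hlaw i] at this
    exact this.comp_measurable (hY i)
  have hZi : ∀ d, Integrable (fun ω => Z ω d) P := fun d =>
    integrable_finsetSum _ fun i _ => (hφY i d).sub (integrable_const _)
  set b : ℝ := 2 * R * √(n * ∫ y, ‖V y‖ ^ 2 ∂μ) with hb
  have hb0 : 0 ≤ b := by positivity
  have finite_bound : ∀ S : Finset E, (∀ d ∈ S, ‖d‖ ≤ R) →
      P {ω | ∃ d ∈ S, τ < |Z ω d|} ≤ ENNReal.ofReal (2 * b / τ) := by
    classical
    intro S' hS'
    set S := insert 0 S' with hSdef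
    have hS : S.Nonempty := ⟨0, by simp [hSdef]⟩
    have hSR : ∀ d ∈ S, ‖d‖ ≤ R := by
      intro d hd
      rcases Finset.mem_insert.1 hd with rfl | hd
      · simpa using hR
      · exact hS' d hd
    have hZ0 : ∀ ω, Z ω 0 = 0 := fun ω => by simp [hZ, hφ0]
    -- Since `0` was inserted in `S` and the process vanishes there, both suprema are nonnegative,
    -- so their sum dominates `|Z ω d|` for every `d`. Each has mean at most `b`, whence the `2 *
    -- b`.
    let g : Ω → ℝ := fun ω => S.sup' hS (fun d => Z ω d) + S.sup' hS (fun d => -Z ω d)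
    have ig1 : Integrable (fun ω => S.sup' hS fun d => Z ω d) P :=
      integrable_finset_sup' hS fun d _ => hZi d
    have ig2 : Integrable (fun ω => S.sup' hS fun d => -Z ω d) P :=
      integrable_finset_sup' hS fun d _ => (hZi d).neg
    have p1 : ∀ ω, 0 ≤ S.sup' hS fun d => Z ω d := fun ω => by
      have := S.le_sup' (fun d => Z ω d) (b := 0) (by simp [hSdef])
      simp only [hZ0] at this
      exact this
    have p2 : ∀ ω, 0 ≤ S.sup' hS fun d => -Z ω d := fun ω => by
      have := S.le_sup' (fun d => -Z ω d) (b := 0) (by simp [hSdef])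
      simp only [hZ0, neg_zero] at this
      exact this
    have hg : ∫ ω, g ω ∂P ≤ 2 * b := by
      have h1 := integral_sup'_process_le hY hind hlaw hS hSR hφm hφ hVm hV hL n 0
      have h2 := integral_sup'_process_le hY hind hlaw hS hSR (φ := fun y d => -φ y d)
        (fun d => (hφm d).neg) (fun d => (hφ d).neg) hVm hV
        (fun y d d' => by
          rw [neg_sub_neg, abs_sub_comm]; exact hL y d d') n 0
      simp only [inner_zero_right, mul_zero, zero_add, norm_zero, ne_eq, OfNat.ofNat_ne_zero,
        not_false_eq_true, zero_pow] at h1 h2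
      rw [integral_add ig1 ig2]
      have e2 : ∀ ω, (S.sup' hS fun d => -Z ω d) = S.sup' hS fun d =>
          ∑ i ∈ Finset.range n, (-φ (Y i ω) d - ∫ y, -φ y d ∂μ) := by
        intro ω
        congr 1 with d
        rw [hZ, ← Finset.sum_neg_distrib]
        refine Finset.sum_congr rfl fun i _ => ?_
        rw [integral_neg]; ring
      simp only [e2]
      linarith
    have hsub : {ω | ∃ d ∈ S', τ < |Z ω d|} ⊆ {ω | τ ≤ g ω} := by
      rintro ω ⟨d, hd, hlt⟩
      have hd' : d ∈ S := Finset.mem_insert_of_mem hd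
      have h1 := S.le_sup' (fun d => Z ω d) hd'
      have h2 := S.le_sup' (fun d => -Z ω d) hd'
      change τ ≤ (S.sup' hS fun d => Z ω d) + S.sup' hS fun d => -Z ω d
      rcases abs_cases (Z ω d) with ⟨h3, -⟩ | ⟨h3, -⟩ <;> linarith [p1 ω, p2 ω]
    refine (measure_mono hsub).trans ?_
    have hmk := mul_meas_ge_le_integral_of_nonneg
      (Eventually.of_forall fun ω => add_nonneg (p1 ω) (p2 ω)) (ig1.add ig2) τ
    rw [← ofReal_measureReal]
    refine ENNReal.ofReal_le_ofReal ?_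
    rw [le_div_iff₀ hτ, mul_comm]
    exact hmk.trans hg
  have hcont : ∀ ω, Continuous (Z ω) := by
    intro ω
    refine continuous_finsetSum _ fun i _ => ?_
    refine Continuous.sub ?_ ?_
    · refine (LipschitzWith.of_dist_le_mul (K := ⟨‖V (Y i ω)‖, norm_nonneg _⟩)
        fun d d' => ?_).continuous
      rw [Real.dist_eq, dist_eq_norm]
      exact hLip _ d d'
    · refine (LipschitzWith.of_dist_le_mul
        (K := ⟨∫ y, ‖V y‖ ∂μ, integral_nonneg fun _ => norm_nonneg _⟩) fun d d' => ?_).continuous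
      rw [Real.dist_eq, dist_eq_norm, ← integral_sub (hφ d) (hφ d')]
      refine (abs_integral_le_integral_abs).trans ?_
      change _ ≤ (∫ y, ‖V y‖ ∂μ) * ‖d - d'‖
      rw [← integral_mul_const]
      exact integral_mono ((hφ d).sub (hφ d')).abs (hV1.norm.mul_const _) fun y => hLip y d d'
  -- Paths are continuous, so a strict exceedance somewhere in the ball already occurs at a point of
  -- a countable dense sequence. The events for its initial segments increase, so the bound for
  -- finite sets passes to the limit.
  have : Nonempty (Metric.closedBall (0 : E) R) := ⟨⟨0, by simpa using hR⟩⟩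
  let q : ℕ → Metric.closedBall (0 : E) R := TopologicalSpace.denseSeq _
  have hq : DenseRange q := TopologicalSpace.denseRange_denseSeq _
  classical
  let S : ℕ → Finset E := fun m => (Finset.range m).image fun i => (q i : E)
  have hsub : {ω | ∃ d : E, ‖d‖ ≤ R ∧ τ < |Z ω d|} ⊆ ⋃ m, {ω | ∃ d ∈ S m, τ < |Z ω d|} := by
    rintro ω ⟨d, hd, hlt⟩
    have ho : IsOpen {x : Metric.closedBall (0 : E) R | τ < |Z ω x|} :=
      isOpen_lt continuous_const ((hcont ω).comp continuous_subtype_val).abs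
    obtain ⟨i, hi⟩ := hq.exists_mem_open ho ⟨⟨d, by simpa using hd⟩, hlt⟩
    refine Set.mem_iUnion.2 ⟨i + 1, q i, ?_, hi⟩
    exact Finset.mem_image.2 ⟨i, by simp, rfl⟩
  have hmono : Monotone fun m => {ω | ∃ d ∈ S m, τ < |Z ω d|} := by
    rintro m m' hm ω ⟨d, hd, hlt⟩
    refine ⟨d, ?_, hlt⟩
    exact Finset.image_subset_image (Finset.range_mono hm) hd
  refine (measure_mono hsub).trans ?_
  rw [hmono.measure_iUnion]
  refine iSup_le fun m => (finite_bound (S m) ?_).trans (le_of_eq ?_)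
  · intro d hd
    obtain ⟨i, -, rfl⟩ := Finset.mem_image.1 hd
    exact mem_closedBall_zero_iff.1 (q i).2
  · rw [hb]; congr 1; ring

/-- Chebyshev's inequality for finitely many averages at once. -/
theorem measure_sum_sq_gt_le {μ : Measure 𝒴} [IsProbabilityMeasure μ] {Y : ℕ → Ω → 𝒴}
    (hY : ∀ i, Measurable (Y i)) (hind : iIndepFun Y P) (hlaw : ∀ i, P.map (Y i) = μ)
    {ι : Type*} [Fintype ι] {g : ι → 𝒴 → ℝ} (hgm : ∀ j, Measurable (g j))
    (hg : ∀ j, Integrable (fun y => g j y ^ 2) μ) (n : ℕ) {τ : ℝ} (hτ : 0 < τ) :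
    P {ω | τ < ∑ j, (∑ i ∈ Finset.range n, (g j (Y i ω) - ∫ y, g j y ∂μ)) ^ 2} ≤
      ENNReal.ofReal (n * (∫ y, ∑ j, g j y ^ 2 ∂μ) / τ) := by
  have hmem : ∀ i j, MemLp (fun ω => g j (Y i ω)) 2 P := fun i j => by
    rw [memLp_two_iff_integrable_sq (f := fun ω => g j (Y i ω))
      ((hgm j).comp (hY i)).aestronglyMeasurable]
    have := hg j
    rw [← hlaw i] at this
    exact this.comp_measurable (hY i)
  have hmean : ∀ i j, ∫ ω, g j (Y i ω) ∂P = ∫ y, g j y ∂μ := fun i j => by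
    rw [← hlaw i, integral_map (hY i).aemeasurable (hgm j).aestronglyMeasurable]
  have hsq : ∀ i j, ∫ ω, g j (Y i ω) ^ 2 ∂P = ∫ y, g j y ^ 2 ∂μ := fun i j => by
    rw [← hlaw i, integral_map (hY i).aemeasurable ((hgm j).pow_const 2).aestronglyMeasurable]
  have hsum : ∀ j, MemLp (∑ i ∈ Finset.range n, fun ω => g j (Y i ω)) 2 P := fun j =>
    memLp_finsetSum' _ fun i _ => hmem i j
  have eq1 : ∀ j ω, ∑ i ∈ Finset.range n, (g j (Y i ω) - ∫ y, g j y ∂μ) =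
      (∑ i ∈ Finset.range n, fun ω => g j (Y i ω)) ω -
        ∫ ω, (∑ i ∈ Finset.range n, fun ω => g j (Y i ω)) ω ∂P := by
    intro j ω
    simp only [Finset.sum_apply]
    rw [integral_finsetSum _ fun i _ => (hmem i j).integrable (by norm_num), 
      Finset.sum_sub_distrib]
    simp only [hmean]
  have hvar : ∀ j, Integrable (fun ω =>
      (∑ i ∈ Finset.range n, (g j (Y i ω) - ∫ y, g j y ∂μ)) ^ 2) P ∧
      ∫ ω, (∑ i ∈ Finset.range n, (g j (Y i ω) - ∫ y, g j y ∂μ)) ^ 2 ∂P ≤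
        n * ∫ y, g j y ^ 2 ∂μ := by
    intro j
    simp only [eq1]
    refine ⟨((hsum j).sub (memLp_const _)).integrable_sq, ?_⟩
    rw [← variance_eq_integral (hsum j).aemeasurable]
    rw [IndepFun.variance_sum (fun i _ => hmem i j) fun i _ i' _ hne =>
      (hind.indepFun hne).comp (hgm j) (hgm j)]
    calc ∑ i ∈ Finset.range n, variance (fun ω => g j (Y i ω)) P
        ≤ ∑ i ∈ Finset.range n, ∫ y, g j y ^ 2 ∂μ := by
          refine Finset.sum_le_sum fun i _ => ?_
          rw [← hsq i j]
          exact variance_le_expectation_sq (hmem i j).1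
      _ = _ := by simp
  have hint : Integrable (fun ω =>
      ∑ j, (∑ i ∈ Finset.range n, (g j (Y i ω) - ∫ y, g j y ∂μ)) ^ 2) P :=
    integrable_finsetSum _ fun j _ => (hvar j).1
  have hmk := mul_meas_ge_le_integral_of_nonneg
    (Eventually.of_forall fun ω => Finset.sum_nonneg fun j _ => sq_nonneg _) hint τ
  refine (measure_mono (t := {ω | τ ≤
    ∑ j, (∑ i ∈ Finset.range n, (g j (Y i ω) - ∫ y, g j y ∂μ)) ^ 2}) fun ω hω => ?_).trans ?_
  · exact (show τ < _ from hω).le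
  rw [← ofReal_measureReal]
  refine ENNReal.ofReal_le_ofReal ?_
  rw [le_div_iff₀ hτ, mul_comm]
  refine hmk.trans ?_
  rw [integral_finsetSum _ fun j _ => (hvar j).1, integral_finsetSum _ fun j _ => hg j,
    Finset.mul_sum]
  exact Finset.sum_le_sum fun j _ => (hvar j).2

end Suprema

end DeconvWeights

end

noncomputable section

namespace DeconvWeights

/-! ### Bias and second moment of the kernel weights -/

/-- The conditional density at `t`, smoothed by the kernel `L` with bandwidth `h`. -/
def smoothDensity {r : ℕ} (L : ℝ → ℝ) (f : ℝ → Vec r → ℝ) (t h : ℝ) (x : Vec r) : ℝ :=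
  ∫ v, L v * f (t - h * v) x

/-- The kernel weight of an observed treatment `s`. -/
def kernelWeight (L : ℝ → ℝ) (φU : ℝ → ℂ) (t h s : ℝ) : ℝ :=
  h⁻¹ * deconvKernel L φU h ((t - s) / h)

/-- The mean value inequality is applied twice, the second time on the closed ball of radius `|y -
t|`; the factor `1/2` of Taylor's formula is not needed. -/
theorem abs_sub_sub_deriv_mul_le {g : ℝ → ℝ} {t d B y : ℝ}
    (hg : ContDiffOn ℝ 3 g (Metric.ball t d))
    (hB : ∀ z ∈ Metric.ball t d, |deriv (deriv g) z| ≤ B) (hy : y ∈ Metric.ball t d) :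
    |g y - g t - (y - t) * deriv g t| ≤ B * (y - t) ^ 2 := by
  have hd : 0 < d := dist_nonneg.trans_lt hy
  have ho : IsOpen (Metric.ball t d) := Metric.isOpen_ball
  have h1 : ∀ z ∈ Metric.ball t d, DifferentiableAt ℝ g z := fun z hz =>
    (hg.differentiableOn (by norm_num)).differentiableAt (ho.mem_nhds hz)
  have h2 : ∀ z ∈ Metric.ball t d, DifferentiableAt ℝ (deriv g) z := fun z hz =>
    (((contDiffOn_succ_iff_deriv_of_isOpen (n := 2) ho).1 hg).2.2.differentiableOn
      (by norm_num)).differentiableAt (ho.mem_nhds hz)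
  have ht : t ∈ Metric.ball t d := Metric.mem_ball_self hd
  have hB0 : 0 ≤ B := (abs_nonneg _).trans (hB t ht)
  have h3 : ∀ z ∈ Metric.ball t d, |deriv g z - deriv g t| ≤ B * |z - t| := fun z hz =>
    (convex_ball t d).norm_image_sub_le_of_norm_deriv_le h2 hB ht hz
  set G : ℝ → ℝ := fun z => g z - g t - (z - t) * deriv g t with hG
  have hsub : Metric.closedBall t |y - t| ⊆ Metric.ball t d :=
    Metric.closedBall_subset_ball (by rwa [Metric.mem_ball, Real.dist_eq] at hy)
  have h4 : ∀ z ∈ Metric.ball t d, HasDerivAt G (deriv g z - deriv g t) z := fun z hz => by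
    have := ((h1 z hz).hasDerivAt.sub_const (g t)).sub
      (((hasDerivAt_id z).sub_const t).mul_const (deriv g t))
    simpa using! this
  have h5 := (convex_closedBall t |y - t|).norm_image_sub_le_of_norm_deriv_le (f := G)
    (C := B * |y - t|) (x := t) (y := y) (fun z hz => (h4 z (hsub hz)).differentiableAt)
    (fun z hz => by
      rw [(h4 z (hsub hz)).deriv]
      have hz' : |z - t| ≤ |y - t| := by simpa [Real.dist_eq] using hz
      exact (h3 z (hsub hz)).trans (mul_le_mul_of_nonneg_left hz' hB0))
    (Metric.mem_closedBall_self (abs_nonneg _)) (by simp [Real.dist_eq])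
  have h6 : G t = 0 := by simp [hG]
  rw [h6, sub_zero, Real.norm_eq_abs, Real.norm_eq_abs, mul_assoc, abs_mul_abs_self] at h5
  rw [pow_two]
  exact h5

/-- The bias of kernel smoothing is of second order in the bandwidth. -/
theorem abs_smoothDensity_sub_le {r : ℕ} {L : ℝ → ℝ} {f : ℝ → Vec r → ℝ} {x : Vec r}
    (hL_even : ∀ v, L (-v) = L v) (hL_int : Integrable L) (hL_one : ∫ v, L v = 1)
    (hL_mom : Integrable (fun v : ℝ => v ^ 2 * L v)) (hfm : Measurable fun s => f s x)
    {t d B h : ℝ} (hd : 0 < d) (hh : 0 < h)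
    (hg : ContDiffOn ℝ 3 (fun s => f s x) (Metric.ball t d))
    (hB : ∀ k ∈ Finset.range 3, ∀ z ∈ Metric.ball t d, |iteratedDeriv k (fun s => f s x) z| ≤ B)
    (hae : ∀ᵐ s, |f s x| ≤ B) :
    |smoothDensity L f t h x - f t x| ≤
      (B + 2 * B / d ^ 2 + B / d) * (∫ v, |v ^ 2 * L v|) * h ^ 2 := by
  have ht : t ∈ Metric.ball t d := Metric.mem_ball_self hd
  have hB0 : 0 ≤ B := (abs_nonneg _).trans (hB 0 (by simp) t ht)
  have b0 : |f t x| ≤ B := by simpa using hB 0 (by simp) t ht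
  have b1 : |deriv (fun s => f s x) t| ≤ B := by simpa using hB 1 (by simp) t ht
  set D := deriv (fun s => f s x) t
  have haev : ∀ᵐ v : ℝ, |f (t - h * v) x| ≤ B := by
    have hq : Measure.QuasiMeasurePreserving (fun v : ℝ => t - h * v) volume volume := by
      have h1 : Measure.QuasiMeasurePreserving (fun v : ℝ => h * v) volume volume := by
        refine ⟨by fun_prop, ?_⟩
        rw [Real.map_volume_mul_left hh.ne']
        exact Measure.smul_absolutelyContinuous
      exact (quasiMeasurePreserving_sub_left volume t).comp h1
    exact hq.ae hae
  set C := B + 2 * B / d ^ 2 + B / d with hC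
  have key : ∀ᵐ v : ℝ, |L v * (f (t - h * v) x - f t x + h * v * D)| ≤
      C * h ^ 2 * |v ^ 2 * L v| := by
    filter_upwards [haev] with v hv
    -- Within distance `d` of `t` this is Taylor's bound. Farther away `|hv| ≥ d`, so the crude
    -- bound `2B + |hv| B` is absorbed by `(2B/d² + B/d)(hv)²`; no smoothness across the boundary of
    -- the support is required.
    have h1 : |f (t - h * v) x - f t x + h * v * D| ≤ C * (h * v) ^ 2 := by
      by_cases hm : t - h * v ∈ Metric.ball t d
      · have h2 := abs_sub_sub_deriv_mul_le hg (fun z hz => by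
          have := hB 2 (by simp) z hz
          rwa [iteratedDeriv_succ, iteratedDeriv_one] at this) hm
        have e1 : f (t - h * v) x - f t x + h * v * D =
            f (t - h * v) x - f t x - (t - h * v - t) * D := by ring
        have e2 : (t - h * v - t) ^ 2 = (h * v) ^ 2 := by ring
        rw [e1]
        rw [e2] at h2
        refine h2.trans ?_
        gcongr
        have : 0 ≤ 2 * B / d ^ 2 := by positivity
        have : 0 ≤ B / d := by positivity
        linarith
      · have hlt : d ≤ |h * v| := by
          rw [Metric.mem_ball, Real.dist_eq, not_lt] at hm
          have e : t - h * v - t = -(h * v) := by ring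
          rwa [e, abs_neg] at hm
        have h3 : |f (t - h * v) x - f t x + h * v * D| ≤ 2 * B + |h * v| * B := by
          calc _ ≤ |f (t - h * v) x| + |f t x| + |h * v * D| :=
                (abs_add_le _ _).trans (add_le_add_left (abs_sub _ _) _)
            _ ≤ B + B + |h * v| * B := by
                rw [abs_mul]; gcongr
            _ = _ := by ring
        refine h3.trans ?_
        rw [← sq_abs (h * v)]
        set a := |h * v|
        have h4 : 1 ≤ a / d := (one_le_div hd).2 hlt
        have ha : 0 < a := hd.trans_le hlt
        have e1 : 2 * B / d ^ 2 * a ^ 2 = 2 * B * (a / d) ^ 2 := by field_simp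
        have e2 : B / d * a ^ 2 = a * B * (a / d) := by field_simp
        have h5 : 2 * B * 1 ≤ 2 * B * (a / d) ^ 2 := by
          gcongr
          exact one_le_pow₀ h4
        have h6 : a * B * 1 ≤ a * B * (a / d) := by gcongr
        have h7 : 0 ≤ B * a ^ 2 := by positivity
        rw [hC, add_mul, add_mul, e1, e2]
        linarith
    rw [abs_mul]
    calc |L v| * |f (t - h * v) x - f t x + h * v * D| ≤ |L v| * (C * (h * v) ^ 2) := by gcongr
      _ = C * h ^ 2 * |v ^ 2 * L v| := by
        rw [abs_mul, abs_of_nonneg (sq_nonneg v)]; ring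
  have iv : Integrable fun v => v * L v := by
    refine (hL_int.abs.add hL_mom.abs).mono' ?_ (Eventually.of_forall fun v => ?_)
    · exact continuous_id.aestronglyMeasurable.mul hL_int.1
    · simp only [Pi.add_apply, Real.norm_eq_abs, abs_mul, abs_of_nonneg (sq_nonneg v)]
      have : |v| ≤ 1 + v ^ 2 := by nlinarith [sq_abs v, sq_nonneg (|v| - 1)]
      nlinarith [abs_nonneg (L v)]
  -- Evenness of the kernel removes the first order term, which leaves a bias of order `h²`.
  have ev : ∫ v, v * L v = 0 := by
    have := integral_neg_eq_self (fun v => v * L v) volume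
    simp only [hL_even, neg_mul, integral_neg] at this
    linarith
  have i1 : Integrable fun v => L v * f (t - h * v) x := by
    refine hL_int.mul_bdd (c := B) ?_ haev
    exact (hfm.comp (by fun_prop : Measurable fun v : ℝ => t - h * v)).aestronglyMeasurable
  have e : smoothDensity L f t h x - f t x =
      ∫ v, L v * (f (t - h * v) x - f t x + h * v * D) := by
    have e1 : ∀ v, L v * (f (t - h * v) x - f t x + h * v * D) =
        L v * f (t - h * v) x - L v * f t x + (h * D) * (v * L v) := fun v => by ring
    simp only [e1]
    rw [integral_add (f := fun v => L v * f (t - h * v) x - L v * f t x)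
      (i1.sub (hL_int.mul_const _)) (iv.const_mul _),
      integral_sub i1 (hL_int.mul_const _), integral_const_mul, ev, integral_mul_const, hL_one,
      smoothDensity]
    ring
  rw [e]
  calc _ ≤ ∫ v, |L v * (f (t - h * v) x - f t x + h * v * D)| := abs_integral_le_integral_abs
    _ ≤ ∫ v, C * h ^ 2 * |v ^ 2 * L v| :=
        integral_mono_of_nonneg (Eventually.of_forall fun v => abs_nonneg _)
          (hL_mom.abs.const_mul _) key
    _ = _ := by rw [integral_const_mul]; ring

/-! ### Joint law of covariates, treatment and error; moments of the weights -/

section Sample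

variable {Ω : Type*} [MeasurableSpace Ω] {P : Measure Ω} [IsProbabilityMeasure P] {r : ℕ}
  {T U : Ω → ℝ} {X : Ω → Vec r} {PX : Measure (Vec r)} {f : ℝ → Vec r → ℝ}

theorem map_sample_eq (hT : Measurable T) (hU : Measurable U) (hX : Measurable X)
    (herr : IndepFun (fun ω => (T ω, X ω)) U P)
    (hf : P.map (fun ω => (X ω, T ω)) =
      (PX.prod volume).withDensity (fun p => ENNReal.ofReal (f p.2 p.1))) :
    P.map (fun ω => ((X ω, T ω), U ω)) =
      ((PX.prod volume).withDensity (fun p => ENNReal.ofReal (f p.2 p.1))).prod (P.map U) := by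
  rw [← hf]
  exact (indepFun_iff_map_prod_eq_prod_map_map (hX.prodMk hT).aemeasurable hU.aemeasurable).1
    (herr.comp (φ := Prod.swap) (ψ := id) measurable_swap measurable_id)

theorem lintegral_sample_eq [IsProbabilityMeasure PX] (hT : Measurable T) (hU : Measurable U)
    (hX : Measurable X)
    (hfm : Measurable (fun p : Vec r × ℝ => f p.2 p.1))
    (hlaw : P.map (fun ω => ((X ω, T ω), U ω)) =
      ((PX.prod volume).withDensity (fun p => ENNReal.ofReal (f p.2 p.1))).prod (P.map U))
    {F : Vec r → ℝ → ℝ → ℝ≥0∞} (hF : Measurable fun p : (Vec r × ℝ) × ℝ => F p.1.1 p.1.2 p.2) :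
    ∫⁻ ω, F (X ω) (T ω) (U ω) ∂P =
      ∫⁻ x, ∫⁻ e, (∫⁻ s, ENNReal.ofReal (f s x) * F x s e) ∂(P.map U) ∂PX := by
  have hPU : IsProbabilityMeasure (P.map U) := Measure.isProbabilityMeasure_map hU.aemeasurable
  have hF2 : Measurable fun p : Vec r × ℝ => ∫⁻ e, F p.1 p.2 e ∂(P.map U) :=
    hF.lintegral_prod_right'
  have hfo : Measurable fun p : Vec r × ℝ => ENNReal.ofReal (f p.2 p.1) := hfm.ennreal_ofReal
  calc ∫⁻ ω, F (X ω) (T ω) (U ω) ∂P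
      = ∫⁻ p, F p.1.1 p.1.2 p.2 ∂(P.map (fun ω => ((X ω, T ω), U ω))) := by
        rw [lintegral_map hF ((hX.prodMk hT).prodMk hU)]
    _ = ∫⁻ x, (∫⁻ s, ∫⁻ e, ENNReal.ofReal (f s x) * F x s e ∂(P.map U)) ∂PX := by
        rw [hlaw, lintegral_prod _ hF.aemeasurable,
          lintegral_withDensity_eq_lintegral_mul _ hfo hF2,
          lintegral_prod _ (hfo.mul hF2).aemeasurable]
        refine lintegral_congr fun x => lintegral_congr fun s => ?_
        rw [lintegral_const_mul]
        · rfl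
        · exact hF.comp (measurable_prodMk_left (x := (x, s)))
    _ = _ := by
        refine lintegral_congr fun x => ?_
        refine lintegral_lintegral_swap (Measurable.aemeasurable ?_)
        have h1 : Measurable fun q : ℝ × ℝ => (((x, q.1), q.2) : (Vec r × ℝ) × ℝ) := by fun_prop
        exact (hfo.comp (measurable_fst.comp h1)).mul (hF.comp h1)

omit [IsProbabilityMeasure P] in
/-- Outside the support of the treatment the conditional density vanishes. -/
theorem ae_ae_density_eq_zero [IsProbabilityMeasure PX] (hT : Measurable T)
    (hX : Measurable X) (hfm : Measurable (fun p : Vec r × ℝ => f p.2 p.1))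
    (hf_nonneg : ∀ t x, 0 ≤ f t x)
    (hf : P.map (fun ω => (X ω, T ω)) =
      (PX.prod volume).withDensity (fun p => ENNReal.ofReal (f p.2 p.1))) :
    ∀ᵐ x ∂PX, ∀ᵐ s, s ∉ (P.map T).support → f s x = 0 := by
  have hA : MeasurableSet ((P.map T).supportᶜ) := Measure.isOpen_compl_support.measurableSet
  have hA' : MeasurableSet {p : Vec r × ℝ | p.2 ∈ (P.map T).supportᶜ} := measurable_snd hA
  have h0 : P.map (fun ω => (X ω, T ω)) {p : Vec r × ℝ | p.2 ∈ (P.map T).supportᶜ} = 0 := by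
    rw [Measure.map_apply (hX.prodMk hT) hA']
    have := Measure.measure_compl_support (μ := P.map T)
    rw [Measure.map_apply hT hA] at this
    exact this
  rw [hf, withDensity_apply _ hA', setLIntegral_eq_zero_iff hA' hfm.ennreal_ofReal] at h0
  filter_upwards [Measure.ae_ae_of_ae_prod h0] with x hx
  filter_upwards [hx] with s hs hs'
  exact le_antisymm (ENNReal.ofReal_eq_zero.1 (hs hs')) (hf_nonneg s x)

/-- The second moment of the kernel weights. -/
theorem lintegral_kernelWeight_sq_le [IsProbabilityMeasure PX] (hT : Measurable T)
    (hU : Measurable U) (hX : Measurable X)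
    (hfm : Measurable (fun p : Vec r × ℝ => f p.2 p.1))
    (hlaw : P.map (fun ω => ((X ω, T ω), U ω)) =
      ((PX.prod volume).withDensity (fun p => ENNReal.ofReal (f p.2 p.1))).prod (P.map U))
    {B : ℝ} (hB0 : 0 ≤ B) (hB : ∀ᵐ x ∂PX, ∀ᵐ s, |f s x| ≤ B)
    {L : ℝ → ℝ} {φU : ℝ → ℂ} {h : ℝ} (hh : 0 < h)
    (hc : Continuous (deconvKernel L φU h)) {V : ℝ}
    (hV : ∫⁻ v, ENNReal.ofReal (deconvKernel L φU h v ^ 2) ≤ ENNReal.ofReal V)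
    (t : ℝ) {g : Vec r → ℝ≥0∞} (hg : Measurable g) :
    ∫⁻ ω, ENNReal.ofReal (kernelWeight L φU t h (T ω + U ω) ^ 2) * g (X ω) ∂P ≤
      ENNReal.ofReal (B * h⁻¹ * V) * ∫⁻ x, g x ∂PX := by
  have hPU : IsProbabilityMeasure (P.map U) := Measure.isProbabilityMeasure_map hU.aemeasurable
  have hw : Continuous (kernelWeight L φU t h) := by
    unfold kernelWeight
    fun_prop
  have hF : Measurable fun p : (Vec r × ℝ) × ℝ =>
      ENNReal.ofReal (kernelWeight L φU t h (p.1.2 + p.2) ^ 2) * g p.1.1 := by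
    refine Measurable.mul ?_ (hg.comp (measurable_fst.comp measurable_fst))
    exact ((hw.measurable.comp (by fun_prop)).pow_const 2).ennreal_ofReal
  rw [lintegral_sample_eq hT hU hX hfm hlaw
    (F := fun x s e => ENNReal.ofReal (kernelWeight L φU t h (s + e) ^ 2) * g x) hF,
    ← lintegral_const_mul _ hg]
  refine lintegral_mono_ae ?_
  filter_upwards [hB] with x hx
  have key : ∀ e, ∫⁻ s, ENNReal.ofReal (f s x) *
      (ENNReal.ofReal (kernelWeight L φU t h (s + e) ^ 2) * g x) ≤
      ENNReal.ofReal (B * h⁻¹ * V) * g x := by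
    intro e
    have hm : Measurable fun v => ENNReal.ofReal (deconvKernel L φU h v ^ 2) :=
      (hc.measurable.pow_const 2).ennreal_ofReal
    -- With the error `e` fixed, the density is bounded by `B` and `v = (t - e - s)/h` is
    -- substituted. The factor `h⁻²` of the squared weight against the Jacobian `h` leaves `h⁻¹`.
    calc ∫⁻ s, ENNReal.ofReal (f s x) *
          (ENNReal.ofReal (kernelWeight L φU t h (s + e) ^ 2) * g x)
        ≤ ∫⁻ s, (ENNReal.ofReal B * ENNReal.ofReal (h⁻¹ ^ 2)) *
            ENNReal.ofReal (deconvKernel L φU h (((t - e) - s) / h) ^ 2) * g x := by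
          refine lintegral_mono_ae ?_
          filter_upwards [hx] with s hs
          have e1 : ENNReal.ofReal (kernelWeight L φU t h (s + e) ^ 2) = ENNReal.ofReal (h⁻¹ ^ 2) *
              ENNReal.ofReal (deconvKernel L φU h (((t - e) - s) / h) ^ 2) := by
            rw [← ENNReal.ofReal_mul (by positivity), ← mul_pow, kernelWeight]
            congr 5
            ring
          rw [e1, mul_assoc (ENNReal.ofReal B), mul_assoc (ENNReal.ofReal B)]
          gcongr
          exact (le_abs_self _).trans hs
      _ = (ENNReal.ofReal B * ENNReal.ofReal (h⁻¹ ^ 2)) * (ENNReal.ofReal h *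
            ∫⁻ v, ENNReal.ofReal (deconvKernel L φU h v ^ 2)) * g x := by
          have hm' : Measurable fun s =>
              ENNReal.ofReal (deconvKernel L φU h (((t - e) - s) / h) ^ 2) :=
            hm.comp (by fun_prop : Measurable fun s : ℝ => ((t - e) - s) / h)
          rw [lintegral_mul_const _ (hm'.const_mul _), lintegral_const_mul _ hm',
            lintegral_comp_sub_div hm _ hh]
      _ ≤ (ENNReal.ofReal B * ENNReal.ofReal (h⁻¹ ^ 2)) * (ENNReal.ofReal h *
            ENNReal.ofReal V) * g x := by gcongr
      _ = _ := by
          rw [← mul_assoc (ENNReal.ofReal B * _), ← ENNReal.ofReal_mul hB0,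
            ← ENNReal.ofReal_mul (by positivity), ← ENNReal.ofReal_mul (by positivity)]
          congr 2
          field_simp
  calc _ ≤ ∫⁻ e, ENNReal.ofReal (B * h⁻¹ * V) * g x ∂(P.map U) := lintegral_mono key
    _ = _ := by simp

/-- The mean of the kernel weights. -/
theorem integral_kernelWeight_mul [IsProbabilityMeasure PX] (hT : Measurable T)
    (hU : Measurable U) (hX : Measurable X) (hPX : P.map X = PX)
    (hfm : Measurable (fun p : Vec r × ℝ => f p.2 p.1)) (hf_nonneg : ∀ t x, 0 ≤ f t x)
    (hlaw : P.map (fun ω => ((X ω, T ω), U ω)) =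
      ((PX.prod volume).withDensity (fun p => ENNReal.ofReal (f p.2 p.1))).prod (P.map U))
    {L : ℝ → ℝ} {φU : ℝ → ℂ} {h : ℝ} (hh : 0 < h)
    (hc : Continuous (deconvKernel L φU h)) {M : ℝ} (hM : ∀ v, |deconvKernel L φU h v| ≤ M)
    (hmean : ∀ᵐ v, ∫ e, deconvKernel L φU h (v - e / h) ∂(P.map U) = L v)
    (t : ℝ) {g : Vec r → ℝ} (hgm : Measurable g) (hg : Integrable g PX) :
    Integrable (fun ω => kernelWeight L φU t h (T ω + U ω) * g (X ω)) P ∧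
    ∫ ω, kernelWeight L φU t h (T ω + U ω) * g (X ω) ∂P =
      ∫ x, g x * smoothDensity L f t h x ∂PX := by
  have hPU : IsProbabilityMeasure (P.map U) := Measure.isProbabilityMeasure_map hU.aemeasurable
  have hw : Continuous (kernelWeight L φU t h) := by
    unfold kernelWeight
    fun_prop
  have hgX : Integrable (fun ω => g (X ω)) P := by
    rw [← hPX] at hg
    exact hg.comp_measurable hX
  have hwb : ∀ s, |kernelWeight L φU t h s| ≤ h⁻¹ * M := fun s => by
    rw [kernelWeight, abs_mul, abs_of_pos (inv_pos.2 hh)]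
    gcongr
    exact hM _
  have hint : Integrable (fun ω => kernelWeight L φU t h (T ω + U ω) * g (X ω)) P :=
    hgX.bdd_mul (c := h⁻¹ * M) (hw.measurable.comp (hT.add hU)).aestronglyMeasurable
      (Eventually.of_forall fun ω => hwb _)
  refine ⟨hint, ?_⟩
  set F : (Vec r × ℝ) × ℝ → ℝ := fun p => kernelWeight L φU t h (p.1.2 + p.2) * g p.1.1 with hF
  have hFm : Measurable F := (hw.measurable.comp (by fun_prop)).mul (hgm.comp (by fun_prop))
  have hm : Measurable fun ω => ((X ω, T ω), U ω) := (hX.prodMk hT).prodMk hU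
  have hFi : Integrable F (P.map fun ω => ((X ω, T ω), U ω)) := by
    rw [integrable_map_measure hFm.aestronglyMeasurable hm.aemeasurable]
    exact hint
  have e0 : ∫ ω, kernelWeight L φU t h (T ω + U ω) * g (X ω) ∂P =
      ∫ p, F p ∂(P.map fun ω => ((X ω, T ω), U ω)) := by
    rw [integral_map hm.aemeasurable hFm.aestronglyMeasurable]
  rw [e0]
  rw [hlaw] at hFi ⊢
  have hfo : Measurable fun p : Vec r × ℝ => ENNReal.ofReal (f p.2 p.1) := hfm.ennreal_ofReal
  have hI1 := hFi.integral_prod_left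
  rw [integral_prod _ hFi, integral_withDensity_eq_integral_toReal_smul hfo
    (Eventually.of_forall fun _ => ENNReal.ofReal_lt_top)]
  rw [integrable_withDensity_iff_integrable_smul' hfo
    (Eventually.of_forall fun _ => ENNReal.ofReal_lt_top)] at hI1
  rw [integral_prod _ hI1]
  refine integral_congr_ae (Eventually.of_forall fun x => ?_)
  simp only [hF]
  -- The identity `hmean` holds for almost every `v` only; quasi-measure-preservation allows `v = (t
  -- - s)/h` for almost every `s`.
  have hq : Measure.QuasiMeasurePreserving (fun s : ℝ => (t - s) / h) volume volume := by
    have h1 : Measure.QuasiMeasurePreserving (fun v : ℝ => h⁻¹ * v) volume volume := by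
      refine ⟨by fun_prop, ?_⟩
      rw [Real.map_volume_mul_left (inv_pos.2 hh).ne']
      exact Measure.smul_absolutelyContinuous
    have h2 := h1.comp (quasiMeasurePreserving_sub_left volume t)
    convert h2 using 1
    ext s
    simp [div_eq_inv_mul]
  have e1 : ∀ᵐ s, (ENNReal.ofReal (f s x)).toReal •
      ∫ e, kernelWeight L φU t h (s + e) * g x ∂(P.map U) =
      h⁻¹ * (g x * (L ((t - s) / h) * f s x)) := by
    filter_upwards [hq.ae hmean] with s hs
    rw [ENNReal.toReal_ofReal (hf_nonneg s x), integral_mul_const, smul_eq_mul]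
    have : ∀ e, kernelWeight L φU t h (s + e) =
        h⁻¹ * deconvKernel L φU h ((t - s) / h - e / h) := fun e => by
      rw [kernelWeight]; congr 2; ring
    simp only [this]
    rw [integral_const_mul, hs]
    ring
  rw [integral_congr_ae e1, integral_const_mul, integral_const_mul, smoothDensity]
  have e2 := integral_sub_left_eq_self
    (fun s => L (s / h) * f (t - s) x) volume t
  have e3 := Measure.integral_comp_mul_left (fun s => L (s / h) * f (t - s) x) h
  simp only [sub_sub_cancel] at e2
  simp only [mul_div_cancel_left₀ _ hh.ne', abs_of_pos (inv_pos.2 hh), smul_eq_mul] at e3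
  rw [e2, e3]
  ring

end Sample

end DeconvWeights

end

noncomputable section

namespace DeconvWeights

/-! ### Strictly concave criterion functions on compact intervals -/

/-- The constants of a strictly concave criterion function on a compact interval `[a, b]`. -/
structure CriterionBounds (ρ : ℝ → ℝ) (a b c₀ C₁ C₂ : ℝ) : Prop where
  c₀_pos : 0 < c₀
  C₁_pos : 0 < C₁
  C₂_pos : 0 < C₂
  hasDerivAt : ∀ v ∈ Set.Icc a b, HasDerivAt ρ (deriv ρ v) v
  abs_deriv_le : ∀ v ∈ Set.Icc a b, |deriv ρ v| ≤ C₁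
  abs_deriv_sub_le : ∀ v ∈ Set.Icc a b, ∀ w ∈ Set.Icc a b,
    |deriv ρ w - deriv ρ v| ≤ C₂ * |w - v|
  sub_le : ∀ v ∈ Set.Icc a b, ∀ w ∈ Set.Icc a b,
    ρ w - ρ v - deriv ρ v * (w - v) ≤ -c₀ * (w - v) ^ 2

/-- The derivative of the remainder is `ρ'(x) - ρ'(v)`, at most `C₂ κ` within distance `κ` of `v`.
This small Lipschitz constant makes the fluctuation of the remainder negligible later. -/
theorem CriterionBounds.abs_remainder_sub_le {ρ : ℝ → ℝ} {a b c₀ C₁ C₂ : ℝ}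
    (hb : CriterionBounds ρ a b c₀ C₁ C₂) {v w w' κ : ℝ} (hv : v ∈ Set.Icc a b)
    (hw : w ∈ Set.Icc a b) (hw' : w' ∈ Set.Icc a b) (h : |w - v| ≤ κ) (h' : |w' - v| ≤ κ) :
    |(ρ w - ρ v - deriv ρ v * (w - v)) - (ρ w' - ρ v - deriv ρ v * (w' - v))| ≤
      C₂ * κ * |w - w'| := by
  set s : Set ℝ := Set.Icc a b ∩ Metric.closedBall v κ
  have hconv : Convex ℝ s := (convex_Icc a b).inter (convex_closedBall v κ)
  have hd : ∀ x ∈ s, HasDerivAt (fun x => ρ x - ρ v - deriv ρ v * (x - v))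
      (deriv ρ x - deriv ρ v) x := fun x hx => by
    have := ((hb.hasDerivAt x hx.1).sub_const (ρ v)).sub
      (((hasDerivAt_id x).sub_const v).const_mul (deriv ρ v))
    simpa using! this
  have := hconv.norm_image_sub_le_of_norm_deriv_le
    (f := fun x => ρ x - ρ v - deriv ρ v * (x - v)) (C := C₂ * κ) (x := w') (y := w)
    (fun x hx => (hd x hx).differentiableAt)
    (fun x hx => by
      rw [(hd x hx).deriv]
      refine (hb.abs_deriv_sub_le v hv x hx.1).trans ?_
      have h1 : |x - v| ≤ κ := by simpa [Real.dist_eq] using hx.2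
      exact mul_le_mul_of_nonneg_left h1 hb.C₂_pos.le)
    ⟨hw', by simpa [Real.dist_eq] using h'⟩ ⟨hw, by simpa [Real.dist_eq] using h⟩
  exact this

/-- Infimum and supremum of `Z` lie in its closure, hence in the open set `D` with some room;
convexity of `D` fills the interval between them. -/
theorem exists_Icc_subset_of_closure_subset {D Z : Set ℝ} (hD_open : IsOpen D)
    (hD_conv : Convex ℝ D) (hZ : Z.Nonempty) (hZb : Bornology.IsBounded Z)
    (hZD : closure Z ⊆ D) :
    ∃ a b ε : ℝ, 0 < ε ∧ Set.Icc a b ⊆ D ∧ ∀ z ∈ Z, z ∈ Set.Icc (a + ε) (b - ε) := by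
  have h1 : sInf Z ∈ D := hZD (csInf_mem_closure hZ hZb.bddBelow)
  have h2 : sSup Z ∈ D := hZD (csSup_mem_closure hZ hZb.bddAbove)
  obtain ⟨e1, he1, hb1⟩ := Metric.isOpen_iff.1 hD_open _ h1
  obtain ⟨e2, he2, hb2⟩ := Metric.isOpen_iff.1 hD_open _ h2
  set ε := min e1 e2 / 2 with hε
  have hε0 : 0 < ε := by positivity
  have l1 : ε < e1 := by have := min_le_left e1 e2; linarith
  have l2 : ε < e2 := by have := min_le_right e1 e2; linarith
  refine ⟨sInf Z - ε, sSup Z + ε, ε, hε0, ?_, fun z hz => ?_⟩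
  · refine hD_conv.ordConnected.out (hb1 ?_) (hb2 ?_)
    · rw [Metric.mem_ball, Real.dist_eq]; simpa [abs_of_pos hε0] using l1
    · rw [Metric.mem_ball, Real.dist_eq]; simpa [abs_of_pos hε0] using l2
  · have := csInf_le hZb.bddBelow hz
    have := le_csSup hZb.bddAbove hz
    constructor <;> linarith

theorem exists_criterionBounds {ρ : ℝ → ℝ} {D : Set ℝ} (hD_open : IsOpen D)
    (hρ_smooth : ContDiffOn ℝ 2 ρ D) (hρ_conc : ∀ v ∈ D, deriv (deriv ρ) v < 0) {a b : ℝ}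
    (hab : Set.Icc a b ⊆ D) : ∃ c₀ C₁ C₂ : ℝ, CriterionBounds ρ a b c₀ C₁ C₂ := by
  have hd1 : ∀ v ∈ Set.Icc a b, HasDerivAt ρ (deriv ρ v) v := fun v hv =>
    ((hρ_smooth.differentiableOn (by norm_num)).differentiableAt
      (hD_open.mem_nhds (hab hv))).hasDerivAt
  have hs1 : ContDiffOn ℝ 1 (deriv ρ) D :=
    ((contDiffOn_succ_iff_deriv_of_isOpen (n := 1) hD_open).1 hρ_smooth).2.2
  have hs2 : ContinuousOn (deriv (deriv ρ)) D :=
    ((contDiffOn_succ_iff_deriv_of_isOpen (n := 0) hD_open).1 hs1).2.2.continuousOn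
  have hd2 : ∀ v ∈ Set.Icc a b, DifferentiableAt ℝ (deriv ρ) v := fun v hv =>
    (hs1.differentiableOn (by norm_num)).differentiableAt (hD_open.mem_nhds (hab hv))
  obtain ⟨C₁, hC₁⟩ := (isCompact_Icc (a := a) (b := b)).exists_bound_of_continuousOn
    (hs1.continuousOn.mono hab)
  obtain ⟨C₂, hC₂⟩ := (isCompact_Icc (a := a) (b := b)).exists_bound_of_continuousOn
    (hs2.mono hab)
  obtain ⟨c, hc, hcb⟩ : ∃ c : ℝ, 0 < c ∧ ∀ v ∈ Set.Icc a b, deriv (deriv ρ) v ≤ -(2 * c) := by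
    rcases (Set.Icc a b).eq_empty_or_nonempty with he | hne
    · exact ⟨1, one_pos, by simp [he]⟩
    · obtain ⟨v, hv, hmax⟩ := isCompact_Icc.exists_isMaxOn hne (hs2.mono hab)
      refine ⟨-deriv (deriv ρ) v / 2, by linarith [hρ_conc v (hab hv)], fun w hw => ?_⟩
      have := hmax hw
      simp only [Set.mem_ofPred_eq] at this
      linarith
  have hslope : ∀ v ∈ Set.Icc a b, ∀ w ∈ Set.Icc a b, v ≤ w →
      deriv ρ w - deriv ρ v ≤ -(2 * c) * (w - v) := fun v hv w hw hvw =>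
    (convex_Icc a b).image_sub_le_mul_sub_of_deriv_le
      (fun x hx => (hd2 x hx).continuousAt.continuousWithinAt)
      (fun x hx => (hd2 x (interior_subset hx)).differentiableWithinAt)
      (fun x hx => hcb x (interior_subset hx)) v hv w hw hvw
  refine ⟨c, |C₁| + 1, |C₂| + 1, hc, by positivity, by positivity, hd1, fun v hv => ?_,
    fun v hv w hw => ?_, fun v hv w hw => ?_⟩
  · have := hC₁ v hv
    rw [Real.norm_eq_abs] at this
    linarith [le_abs_self C₁]
  · refine (convex_Icc a b).norm_image_sub_le_of_norm_deriv_le hd2 (fun x hx => ?_) hv hw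
    linarith [hC₂ x hx, le_abs_self C₂]
  -- Adding `c(x - v)²` to the remainder uses up only the curvature bound `ρ'' ≤ -2c`. The sum still
  -- increases on the left of `v` and decreases on the right, so its maximum is its value `0` at
  -- `v`.
  · set k : ℝ → ℝ := fun x => ρ x - ρ v - deriv ρ v * (x - v) + c * (x - v) ^ 2 with hk
    have hkd : ∀ x ∈ Set.Icc a b,
        HasDerivAt k (deriv ρ x - deriv ρ v + 2 * c * (x - v)) x := fun x hx => by
      have h1 := ((hd1 x hx).sub_const (ρ v)).sub
        (((hasDerivAt_id x).sub_const v).const_mul (deriv ρ v))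
      have h2 := (((hasDerivAt_id x).sub_const v).pow 2).const_mul c
      have := h1.add h2
      refine this.congr_deriv ?_
      simp
      ring
    have hkv : k v = 0 := by simp [hk]
    suffices k w ≤ 0 by
      simp only [hk] at this
      linarith
    rw [← hkv]
    rcases le_total v w with hvw | hwv
    · have hsub : Set.Icc v w ⊆ Set.Icc a b := Set.Icc_subset_Icc hv.1 hw.2
      refine antitoneOn_of_deriv_nonpos (convex_Icc v w)
        (fun x hx => (hkd x (hsub hx)).continuousAt.continuousWithinAt)
        (fun x hx => (hkd x (hsub (interior_subset hx))).differentiableAt.differentiableWithinAt)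
        (fun x hx => ?_) (Set.left_mem_Icc.2 hvw) (Set.right_mem_Icc.2 hvw) hvw
      have hx' := interior_subset hx
      rw [(hkd x (hsub hx')).deriv]
      linarith [hslope v hv x (hsub hx') hx'.1]
    · have hsub : Set.Icc w v ⊆ Set.Icc a b := Set.Icc_subset_Icc hw.1 hv.2
      refine monotoneOn_of_deriv_nonneg (convex_Icc w v)
        (fun x hx => (hkd x (hsub hx)).continuousAt.continuousWithinAt)
        (fun x hx => (hkd x (hsub (interior_subset hx))).differentiableAt.differentiableWithinAt)
        (fun x hx => ?_) (Set.left_mem_Icc.2 hwv) (Set.right_mem_Icc.2 hwv) hwv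
      have hx' := interior_subset hx
      rw [(hkd x (hsub hx')).deriv]
      linarith [hslope x (hsub hx') v hv hx'.2]

/-! ### Quadratic forms of conditional second moment matrices -/

section Gram

variable {r k : ℕ} {PX : Measure (Vec r)} {f : ℝ → Vec r → ℝ} {b : Vec r → Vec k} {t : ℝ}

theorem real_inner_eq_sum (d x : Vec k) : inner ℝ d x = ∑ i, d i * x i := by
  rw [PiLp.inner_apply]
  exact Finset.sum_congr rfl fun i _ => by simp [mul_comm]

theorem dotProduct_condGram_mulVec
    (hint : ∀ i j, Integrable (fun x => b x i * b x j * f t x) PX) (d : Vec k) :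
    dotProduct d.ofLp ((condGram PX f b t).mulVec d.ofLp) =
      (∫ x, inner ℝ d (b x) ^ 2 * f t x ∂PX) / margDensity PX f t := by
  have e : ∀ x, inner ℝ d (b x) ^ 2 * f t x =
      ∑ i, ∑ j, d i * d j * (b x i * b x j * f t x) := by
    intro x
    rw [real_inner_eq_sum, pow_two, Finset.sum_mul_sum, Finset.sum_mul]
    refine Finset.sum_congr rfl fun i _ => ?_
    rw [Finset.sum_mul]
    exact Finset.sum_congr rfl fun j _ => by ring
  simp only [e]
  rw [integral_finsetSum _ fun i _ => integrable_finsetSum _ fun j _ => (hint i j).const_mul _,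
    Finset.sum_div]
  refine Finset.sum_congr rfl fun i _ => ?_
  rw [integral_finsetSum _ fun j _ => (hint i j).const_mul _, Finset.sum_div, Matrix.mulVec,
    dotProduct, Finset.mul_sum]
  refine Finset.sum_congr rfl fun j _ => ?_
  rw [integral_const_mul, condGram, Matrix.of_apply, condMean]
  ring

theorem condGram_isHermitian : (condGram PX f b t).IsHermitian := by
  ext i j
  simp only [condGram, Matrix.conjTranspose_apply, Matrix.of_apply, star_trivial]
  congr 1
  ext x
  ring

/-- Spectral bounds say that `G - c` and `C - G` are positive semidefinite. The quadratic form of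
`G` is the weighted integral divided by the marginal density. -/
theorem condGram_bounds {c C : ℝ} (hspec : spectrum ℝ (condGram PX f b t) ⊆ Set.Icc c C)
    (hint : ∀ i j, Integrable (fun x => b x i * b x j * f t x) PX)
    (hm : 0 < margDensity PX f t) (d : Vec k) :
    c * margDensity PX f t * ‖d‖ ^ 2 ≤ ∫ x, inner ℝ d (b x) ^ 2 * f t x ∂PX ∧
    ∫ x, inner ℝ d (b x) ^ 2 * f t x ∂PX ≤ C * margDensity PX f t * ‖d‖ ^ 2 := by
  set G := condGram PX f b t with hG
  have hH : G.IsHermitian := condGram_isHermitian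
  have hone : ∀ z : ℝ, (algebraMap ℝ (Matrix (Fin k) (Fin k) ℝ) z).IsHermitian := fun z => by
    rw [Algebra.algebraMap_eq_smul_one]
    exact Matrix.isHermitian_one.smul (IsSelfAdjoint.all z)
  have hn : dotProduct d.ofLp d.ofLp = ‖d‖ ^ 2 := by
    rw [EuclideanSpace.norm_sq_eq]
    simp [dotProduct, pow_two]
  have hq := dotProduct_condGram_mulVec hint d
  rw [← hG] at hq
  have p1 : (G - algebraMap ℝ _ c).PosSemidef := by
    rw [Matrix.posSemidef_iff_isHermitian_and_spectrum_nonneg]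
    refine ⟨hH.sub (hone c), ?_⟩
    rw [← spectrum.sub_singleton_eq]
    rintro _ ⟨s, hs, _, rfl, rfl⟩
    exact sub_nonneg.2 (hspec hs).1
  have p2 : (algebraMap ℝ _ C - G).PosSemidef := by
    rw [Matrix.posSemidef_iff_isHermitian_and_spectrum_nonneg]
    refine ⟨(hone C).sub hH, ?_⟩
    rw [← spectrum.singleton_sub_eq]
    rintro _ ⟨_, rfl, s, hs, rfl⟩
    exact sub_nonneg.2 (hspec hs).2
  have n1 := p1.dotProduct_mulVec_nonneg d.ofLp
  have n2 := p2.dotProduct_mulVec_nonneg d.ofLp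
  simp only [star_trivial, Matrix.sub_mulVec, dotProduct_sub, Algebra.algebraMap_eq_smul_one,
    Matrix.smul_mulVec, Matrix.one_mulVec, dotProduct_smul, hn, hq, smul_eq_mul] at n1 n2
  constructor
  · have := (le_div_iff₀ hm).1 (sub_nonneg.1 n1)
    linarith
  · have := (div_le_iff₀ hm).1 (sub_nonneg.1 n2)
    linarith

theorem inner_single_one (i : Fin k) (x : Vec k) :
    inner ℝ (EuclideanSpace.single i (1 : ℝ) : Vec k) x = x i := by
  have := EuclideanSpace.inner_single_left i (1 : ℝ) x
  rw [this]
  simp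

theorem norm_sq_eq_sum_inner_sq (x : Vec k) :
    ‖x‖ ^ 2 = ∑ i, inner ℝ (EuclideanSpace.single i (1 : ℝ) : Vec k) x ^ 2 := by
  rw [EuclideanSpace.norm_sq_eq]
  simp [inner_single_one]

theorem integral_norm_sq_bounds {c C : ℝ} (hspec : spectrum ℝ (condGram PX f b t) ⊆ Set.Icc c C)
    (hint : ∀ i j, Integrable (fun x => b x i * b x j * f t x) PX)
    (hm : 0 < margDensity PX f t) :
    c * margDensity PX f t * k ≤ ∫ x, ‖b x‖ ^ 2 * f t x ∂PX ∧
    ∫ x, ‖b x‖ ^ 2 * f t x ∂PX ≤ C * margDensity PX f t * k := by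
  have e : ∫ x, ‖b x‖ ^ 2 * f t x ∂PX = ∑ i, ∫ x,
      inner ℝ (EuclideanSpace.single i (1 : ℝ) : Vec k) (b x) ^ 2 * f t x ∂PX := by
    rw [← integral_finsetSum]
    · simp only [norm_sq_eq_sum_inner_sq, Finset.sum_mul]
    · intro i _
      refine (hint i i).congr (Eventually.of_forall fun x => ?_)
      simp only [inner_single_one, pow_two]
  have hb := fun i => condGram_bounds hspec hint hm (EuclideanSpace.single i (1 : ℝ) : Vec k)
  rw [e]
  constructor
  · calc c * margDensity PX f t * k = ∑ i : Fin k, c * margDensity PX f t *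
          ‖(EuclideanSpace.single i (1 : ℝ) : Vec k)‖ ^ 2 := by simp [mul_comm]
      _ ≤ _ := Finset.sum_le_sum fun i _ => (hb i).1
  · calc _ ≤ ∑ i : Fin k, C * margDensity PX f t *
          ‖(EuclideanSpace.single i (1 : ℝ) : Vec k)‖ ^ 2 := Finset.sum_le_sum fun i _ => (hb i).2
      _ = _ := by simp [mul_comm]

end Gram

end DeconvWeights

end

noncomputable section

namespace DeconvWeights

/-! ### Maximisers and values on a sphere -/

/-- The maximum over the compact ball cannot be attained on its boundary. Continuity is asked on the
ball only, since `ρ` is controlled only on part of the line. -/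
theorem exists_isLocalMax_of_lt_on_sphere {E : Type*} [NormedAddCommGroup E] [NormedSpace ℝ E]
    [FiniteDimensional ℝ E] {G : E → ℝ} {c : E} {R : ℝ} (hR : 0 < R)
    (hG : ContinuousOn G (Metric.closedBall c R))
    (hs : ∀ y ∈ Metric.sphere c R, G y < G c) :
    ∃ l ∈ Metric.ball c R, IsLocalMax G l := by
  have := FiniteDimensional.proper ℝ E
  obtain ⟨l, hl, hmax⟩ := (isCompact_closedBall c R).exists_isMaxOn
    ⟨c, Metric.mem_closedBall_self hR.le⟩ hG
  have hlb : l ∈ Metric.ball c R := by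
    rcases (Metric.mem_closedBall.1 hl).lt_or_eq with h | h
    · exact h
    · exact absurd (hmax (Metric.mem_closedBall_self hR.le)) (not_le.2 (hs l h))
  exact ⟨l, hlb, hmax.isLocalMax (mem_of_superset (Metric.isOpen_ball.mem_nhds hlb)
    Metric.ball_subset_closedBall)⟩

/-- If the maximiser were outside, the segment from the centre to it would cross the sphere, and
concavity would make the value there at least `G c`. -/
theorem norm_sub_le_of_concaveOn {E : Type*} [NormedAddCommGroup E] [NormedSpace ℝ E]
    {G : E → ℝ} {F : Set E} {c l : E} {R : ℝ} (hR : 0 < R) (hG : ConcaveOn ℝ F G)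
    (hc : c ∈ F) (hl : l ∈ F) (hmax : IsMaxOn G F l)
    (hs : ∀ y ∈ Metric.sphere c R, G y < G c) : ‖l - c‖ ≤ R := by
  by_contra hlt
  push Not at hlt
  have hpos : 0 < ‖l - c‖ := hR.trans hlt
  set θ := R / ‖l - c‖ with hθ
  have hθ0 : 0 < θ := by positivity
  have hθ1 : θ ≤ 1 := (div_le_one hpos).2 hlt.le
  have hy : (1 - θ) • c + θ • l ∈ Metric.sphere c R := by
    have e : (1 - θ) • c + θ • l - c = θ • (l - c) := by
      rw [sub_smul, smul_sub, one_smul]; abel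
    rw [mem_sphere_iff_norm, e, norm_smul, Real.norm_of_nonneg hθ0.le, hθ,
      div_mul_cancel₀ _ hpos.ne']
  have h1 := hG.2 hc hl (sub_nonneg.2 hθ1) hθ0.le (by ring)
  have h2 := hs _ hy
  have h3 : G c ≤ G l := hmax hc
  simp only [smul_eq_mul] at h1
  nlinarith

/-! ### The remainder of the criterion function, extended by clamping -/

/-- The projection of a real number to the interval `[p, q]`. -/
def clamp (p q z : ℝ) : ℝ := max p (min q z)

theorem clamp_mem {p q : ℝ} (h : p ≤ q) (z : ℝ) : clamp p q z ∈ Set.Icc p q :=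
  ⟨le_max_left _ _, max_le h (min_le_left _ _)⟩

theorem clamp_of_mem {p q z : ℝ} (h : z ∈ Set.Icc p q) : clamp p q z = z := by
  rw [clamp, min_eq_right h.2, max_eq_right h.1]

theorem abs_clamp_sub_le (p q z z' : ℝ) : |clamp p q z - clamp p q z'| ≤ |z - z'| := by
  simp only [clamp, max_comm p, min_comm q]
  exact (abs_max_sub_max_le_abs _ _ _).trans (abs_inf_sub_inf_le_abs z z' q)

theorem continuous_clamp (p q : ℝ) : Continuous (clamp p q) :=
  continuous_const.max (continuous_const.min continuous_id)

/-- The second order remainder of `ρ` at `v`, with both arguments clamped. -/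
def clampedRemainder (ρ : ℝ → ℝ) (p q κ v s : ℝ) : ℝ :=
  ρ (clamp p q v + clamp (-κ) κ s) - ρ (clamp p q v) -
    deriv ρ (clamp p q v) * clamp (-κ) κ s

section Clamped

variable {ρ : ℝ → ℝ} {lo hi c₀ C₁ C₂ ε κ : ℝ} (hb : CriterionBounds ρ lo hi c₀ C₁ C₂)
  (hκ : 0 ≤ κ) (hκε : κ ≤ ε / 2) (hlohi : lo + ε ≤ hi - ε)

include hb hκ hκε hlohi

omit hb in
-- The margin `ε` is shared: the base point keeps distance `ε/2` from the ends of `[lo, hi]`, and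
-- the increment is at most `κ ≤ ε/2`. With clamping the remainder is Lipschitz in `s` on the whole
-- line, as the contraction principle requires.
theorem clamped_args_mem (v s : ℝ) : clamp (lo + ε / 2) (hi - ε / 2) v ∈ Set.Icc lo hi ∧
    clamp (lo + ε / 2) (hi - ε / 2) v + clamp (-κ) κ s ∈ Set.Icc lo hi ∧
    |clamp (-κ) κ s| ≤ κ := by
  have h1 := clamp_mem (show lo + ε / 2 ≤ hi - ε / 2 by linarith) v
  have h2 := clamp_mem (show -κ ≤ κ by linarith) s
  exact ⟨⟨by linarith [h1.1], by linarith [h1.2]⟩,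
    ⟨by linarith [h1.1, h2.1], by linarith [h1.2, h2.2]⟩, abs_le.2 h2⟩

theorem abs_clampedRemainder_sub_le (v s s' : ℝ) :
    |clampedRemainder ρ (lo + ε / 2) (hi - ε / 2) κ v s -
      clampedRemainder ρ (lo + ε / 2) (hi - ε / 2) κ v s'| ≤ C₂ * κ * |s - s'| := by
  obtain ⟨h1, h2, h3⟩ := clamped_args_mem hκ hκε hlohi v s
  obtain ⟨-, h2', h3'⟩ := clamped_args_mem hκ hκε hlohi v s'
  have := hb.abs_remainder_sub_le (κ := κ) h1 h2 h2' (by simpa using h3) (by simpa using h3')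
  simp only [add_sub_cancel_left, add_sub_add_left_eq_sub] at this
  refine this.trans ?_
  exact mul_le_mul_of_nonneg_left (abs_clamp_sub_le _ _ _ _) (mul_nonneg hb.C₂_pos.le hκ)

omit hb hκε hlohi in
theorem clampedRemainder_zero (v : ℝ) :
    clampedRemainder ρ (lo + ε / 2) (hi - ε / 2) κ v 0 = 0 := by
  have : clamp (-κ) κ 0 = 0 := clamp_of_mem ⟨by linarith, hκ⟩
  simp [clampedRemainder, this]

theorem continuous_clampedRemainder :
    Continuous fun p : ℝ × ℝ => clampedRemainder ρ (lo + ε / 2) (hi - ε / 2) κ p.1 p.2 := by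
  have hρ : ContinuousOn ρ (Set.Icc lo hi) := fun v hv =>
    (hb.hasDerivAt v hv).continuousAt.continuousWithinAt
  have hρ' : ContinuousOn (deriv ρ) (Set.Icc lo hi) := by
    have : LipschitzOnWith ⟨C₂, hb.C₂_pos.le⟩ (deriv ρ) (Set.Icc lo hi) :=
      LipschitzOnWith.of_dist_le_mul fun v hv w hw => by
        rw [Real.dist_eq, Real.dist_eq]
        exact hb.abs_deriv_sub_le w hw v hv
    exact this.continuousOn
  have c1 : Continuous fun p : ℝ × ℝ => clamp (lo + ε / 2) (hi - ε / 2) p.1 :=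
    (continuous_clamp _ _).comp continuous_fst
  have c2 : Continuous fun p : ℝ × ℝ => clamp (-κ) κ p.2 :=
    (continuous_clamp _ _).comp continuous_snd
  have hm := fun p : ℝ × ℝ => clamped_args_mem hκ hκε hlohi p.1 p.2
  exact ((hρ.comp_continuous (c1.add c2) fun p => (hm p).2.1).sub
    (hρ.comp_continuous c1 fun p => (hm p).1)).sub
    ((hρ'.comp_continuous c1 fun p => (hm p).1).mul c2)

theorem clampedRemainder_le (v s : ℝ) :
    clampedRemainder ρ (lo + ε / 2) (hi - ε / 2) κ v s ≤ -c₀ * clamp (-κ) κ s ^ 2 := by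
  obtain ⟨h1, h2, -⟩ := clamped_args_mem hκ hκε hlohi v s
  have := hb.sub_le _ h1 _ h2
  simpa [clampedRemainder] using this

end Clamped

/-! ### Chebyshev's inequality for averages of vectors -/

theorem measure_norm_average_sub_gt_le {Ω 𝒴 : Type*} [MeasurableSpace Ω] [MeasurableSpace 𝒴]
    {P : Measure Ω} [IsProbabilityMeasure P]
    {μ : Measure 𝒴} [IsProbabilityMeasure μ] {Y : ℕ → Ω → 𝒴}
    (hY : ∀ i, Measurable (Y i)) (hind : iIndepFun Y P) (hlaw : ∀ i, P.map (Y i) = μ)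
    {k : ℕ} {g : 𝒴 → Vec k} (hgm : Measurable g)
    (hg : Integrable (fun y => ‖g y‖ ^ 2) μ) {Q : ℝ} (hQ : ∫ y, ‖g y‖ ^ 2 ∂μ ≤ Q)
    {e : Vec k} (he : ∀ j, e j = ∫ y, g y j ∂μ) {n : ℕ} (hn : 1 ≤ n) {τ : ℝ} (hτ : 0 < τ) :
    P {ω | τ < ‖(n : ℝ)⁻¹ • ∑ i ∈ Finset.range n, g (Y i ω) - e‖} ≤
      ENNReal.ofReal (Q / (n * τ ^ 2)) := by
  have hn0 : (0 : ℝ) < n := by exact_mod_cast hn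
  have hgj : ∀ j, Measurable fun y => g y j := fun j => by fun_prop
  have hsq : ∀ y, ‖g y‖ ^ 2 = ∑ j, g y j ^ 2 := fun y => by
    rw [EuclideanSpace.norm_sq_eq]; simp
  have hgj2 : ∀ j, Integrable (fun y => g y j ^ 2) μ := fun j => by
    refine hg.mono' ((hgj j).pow_const 2).aestronglyMeasurable (Eventually.of_forall fun y => ?_)
    rw [Real.norm_of_nonneg (sq_nonneg _), hsq]
    exact Finset.single_le_sum (f := fun j => g y j ^ 2) (fun j _ => sq_nonneg _)
      (Finset.mem_univ j)
  have key := measure_sum_sq_gt_le hY hind hlaw hgj hgj2 n (τ := (n * τ) ^ 2) (by positivity)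
  refine (measure_mono fun ω hω => ?_).trans (key.trans (ENNReal.ofReal_le_ofReal ?_))
  · have hω' : τ < ‖(n : ℝ)⁻¹ • ∑ i ∈ Finset.range n, g (Y i ω) - e‖ := hω
    have e1 : ∑ j, (∑ i ∈ Finset.range n, (g (Y i ω) j - ∫ y, g y j ∂μ)) ^ 2 =
        (n * ‖(n : ℝ)⁻¹ • ∑ i ∈ Finset.range n, g (Y i ω) - e‖) ^ 2 := by
      rw [mul_pow, EuclideanSpace.norm_sq_eq, Finset.mul_sum]
      refine Finset.sum_congr rfl fun j _ => ?_
      rw [Real.norm_eq_abs, sq_abs, ← mul_pow]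
      congr 1
      rw [Finset.sum_sub_distrib]
      simp only [PiLp.sub_apply, PiLp.smul_apply, WithLp.ofLp_sum, Finset.sum_apply, he,
        smul_eq_mul, Finset.sum_const, Finset.card_range, nsmul_eq_mul]
      rw [mul_sub, mul_inv_cancel_left₀ hn0.ne']
    change (n * τ) ^ 2 < ∑ j, (∑ i ∈ Finset.range n, (g (Y i ω) j - ∫ y, g y j ∂μ)) ^ 2
    rw [e1]
    gcongr
  · simp only [← hsq]
    rw [mul_pow, div_le_div_iff₀ (by positivity) (by positivity)]
    calc _ ≤ n * Q * (n * τ ^ 2) := by gcongr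
      _ = _ := by ring

end DeconvWeights

end

noncomputable section

namespace DeconvWeights

/-! ### The estimation problem at a fixed sample size -/

/-- The constants of the estimation problem that do not depend on the sample size: the marginal
density `m`, bounds `η`, `B` of the conditional density, bounds `cl`, `Cg` of the second moment
matrix of the basis, the range `[lo + ε, hi - ε]` of the population index, and the constants of the
criterion function on `[lo, hi]`. -/
structure StageConstants where
  m : ℝ
  η : ℝ
  B : ℝ
  cl : ℝ
  Cg : ℝ
  lo : ℝ
  hi : ℝ
  ε : ℝ
  c₀ : ℝ
  C₁ : ℝ
  C₂ : ℝ

/-- The estimation problem at sample size `n`, with `k` basis functions `b` of size `ζ`, kernel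
weights `w` of conditional mean `q` and variance factor `V`, and an approximation `l₀` of the
population index `z` with error `da`. -/
structure Stage {Ω : Type*} [MeasurableSpace Ω] (P : Measure Ω) {r : ℕ} (X : ℕ → Ω → Vec r)
    (S : ℕ → Ω → ℝ) (PX : Measure (Vec r)) (𝒳 : Set (Vec r)) (ρ : ℝ → ℝ) (p z : Vec r → ℝ)
    (c : StageConstants) {k : ℕ} (n : ℕ) (b : Vec r → Vec k) (w : ℝ → ℝ) (q : Vec r → ℝ)
    (l₀ : Vec k) (ζ bb V da : ℝ) : Prop where
  X_meas : ∀ i, Measurable (X i)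
  S_meas : ∀ i, Measurable (S i)
  indep : iIndepFun (fun i ω => (X i ω, S i ω)) P
  law : ∀ i, P.map (fun ω => (X i ω, S i ω)) = P.map (fun ω => (X 0 ω, S 0 ω))
  map_X : P.map (X 0) = PX
  ae_mem : ∀ᵐ x ∂PX, x ∈ 𝒳
  η_pos : 0 < c.η
  η_le_m : c.η ≤ c.m
  η_le : ∀ᵐ x ∂PX, c.η ≤ p x
  le_B : ∀ᵐ x ∂PX, p x ≤ c.B
  weight_eq : ∀ x ∈ 𝒳, deriv ρ (z x) * p x = c.m
  w_meas : Measurable w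
  w_mean : ∀ g : Vec r → ℝ, Measurable g → Integrable g PX →
    Integrable (fun ω => w (S 0 ω) * g (X 0 ω)) P ∧
      ∫ ω, w (S 0 ω) * g (X 0 ω) ∂P = ∫ x, g x * q x ∂PX
  w_sq : ∀ g : Vec r → ℝ≥0∞, Measurable g →
    ∫⁻ ω, ENNReal.ofReal (w (S 0 ω) ^ 2) * g (X 0 ω) ∂P ≤ ENNReal.ofReal V * ∫⁻ x, g x ∂PX
  q_meas : AEStronglyMeasurable q PX
  q_bias : ∀ᵐ x ∂PX, |q x - p x| ≤ bb
  bb_le : bb ≤ c.η / 2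
  b_meas : Measurable b
  b_bound : ∀ x ∈ 𝒳, ‖b x‖ ≤ ζ
  ζ_pos : 0 < ζ
  cl_pos : 0 < c.cl
  Cg_pos : 0 < c.Cg
  quad_lower : ∀ d : Vec k, c.cl * ‖d‖ ^ 2 ≤ ∫ x, inner ℝ d (b x) ^ 2 ∂PX
  quad_upper : ∀ d : Vec k, ∫ x, inner ℝ d (b x) ^ 2 ∂PX ≤ c.Cg * ‖d‖ ^ 2
  norm_sq : ∫ x, ‖b x‖ ^ 2 ∂PX ≤ c.Cg * k
  crit : CriterionBounds ρ c.lo c.hi c.c₀ c.C₁ c.C₂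
  ε_pos : 0 < c.ε
  z_mem : ∀ x ∈ 𝒳, z x ∈ Set.Icc (c.lo + c.ε) (c.hi - c.ε)
  approx : ∀ x ∈ 𝒳, |z x - inner ℝ l₀ (b x)| ≤ da
  da_nonneg : 0 ≤ da
  da_le : da ≤ c.ε / 2
  one_le_n : 1 ≤ n
  one_le_k : 1 ≤ k
  one_le_V : 1 ≤ V

/-- The stochastic order of averages of `k` dimensional vectors. -/
def noise (V : ℝ) (k n : ℕ) : ℝ := √(V * k / n)

/-! ### Deviation bounds for the sample averages -/

namespace Stage

variable {Ω : Type*} [MeasurableSpace Ω] {P : Measure Ω} [IsProbabilityMeasure P] {r : ℕ}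
  {X : ℕ → Ω → Vec r} {S : ℕ → Ω → ℝ} {PX : Measure (Vec r)} [IsProbabilityMeasure PX]
  {𝒳 : Set (Vec r)} {ρ : ℝ → ℝ} {p z : Vec r → ℝ} {c : StageConstants} {k n : ℕ}
  {b : Vec r → Vec k} {w : ℝ → ℝ} {q : Vec r → ℝ} {l₀ : Vec k} {ζ bb V da : ℝ}
  (st : Stage P X S PX 𝒳 ρ p z c n b w q l₀ ζ bb V da)

include st

omit [IsProbabilityMeasure P] [IsProbabilityMeasure PX] in
theorem noise_pos : 0 < noise V k n := by
  have h1 : (0 : ℝ) < n := by exact_mod_cast st.one_le_n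
  have h2 : (0 : ℝ) < k := by exact_mod_cast st.one_le_k
  have h3 := st.one_le_V
  exact Real.sqrt_pos.2 (by positivity)

omit [IsProbabilityMeasure P] [IsProbabilityMeasure PX] in
theorem mul_noise_sq : n * noise V k n ^ 2 = V * k := by
  have h1 : (0 : ℝ) < n := by exact_mod_cast st.one_le_n
  have h3 := st.one_le_V
  rw [noise, Real.sq_sqrt (by positivity)]
  field_simp

omit [IsProbabilityMeasure P] [IsProbabilityMeasure PX] in
theorem pair_meas (i : ℕ) : Measurable fun ω => (X i ω, S i ω) :=
  (st.X_meas i).prodMk (st.S_meas i)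

omit [IsProbabilityMeasure P] in
theorem integrable_of_bound {g : Vec r → ℝ} (hg : Measurable g) {M : ℝ}
    (hM : ∀ x ∈ 𝒳, |g x| ≤ M) : Integrable g PX :=
  Integrable.of_bound hg.aestronglyMeasurable M (st.ae_mem.mono fun x hx => hM x hx)

omit [IsProbabilityMeasure P] [IsProbabilityMeasure PX] in
theorem index_mem {x : Vec r} (hx : x ∈ 𝒳) :
    inner ℝ l₀ (b x) ∈ Set.Icc (c.lo + c.ε / 2) (c.hi - c.ε / 2) := by
  have h1 := st.z_mem x hx
  have h2 := abs_le.1 ((st.approx x hx).trans st.da_le)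
  constructor <;> linarith [h1.1, h1.2, h2.1, h2.2]

omit [IsProbabilityMeasure P] [IsProbabilityMeasure PX] in
theorem index_mem' {x : Vec r} (hx : x ∈ 𝒳) : inner ℝ l₀ (b x) ∈ Set.Icc c.lo c.hi := by
  have h1 := st.index_mem hx
  have h2 := st.ε_pos
  constructor <;> linarith [h1.1, h1.2]

omit [IsProbabilityMeasure P] in
theorem lo_add_le : c.lo + c.ε ≤ c.hi - c.ε := by
  obtain ⟨x, hx⟩ := st.ae_mem.exists
  exact (st.z_mem x hx).1.trans (st.z_mem x hx).2

omit [IsProbabilityMeasure P] [IsProbabilityMeasure PX] in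
theorem abs_inner_le (d : Vec k) {x : Vec r} (hx : x ∈ 𝒳) : |inner ℝ d (b x)| ≤ ‖d‖ * ζ :=
  (abs_real_inner_le_norm _ _).trans (mul_le_mul_of_nonneg_left (st.b_bound x hx) (norm_nonneg _))

omit [IsProbabilityMeasure P] [IsProbabilityMeasure PX] in
theorem mean_weight {g : Vec r → ℝ} (hg : Measurable g) (hi : Integrable g PX) :
    Integrable (fun y : Vec r × ℝ => w y.2 * g y.1) (P.map fun ω => (X 0 ω, S 0 ω)) ∧
      ∫ y, w y.2 * g y.1 ∂(P.map fun ω => (X 0 ω, S 0 ω)) = ∫ x, g x * q x ∂PX := by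
  have hm : Measurable fun y : Vec r × ℝ => w y.2 * g y.1 :=
    (st.w_meas.comp measurable_snd).mul (hg.comp measurable_fst)
  obtain ⟨h1, h2⟩ := st.w_mean g hg hi
  refine ⟨?_, ?_⟩
  · rw [integrable_map_measure hm.aestronglyMeasurable (st.pair_meas 0).aemeasurable]
    exact h1
  · rw [integral_map (st.pair_meas 0).aemeasurable hm.aestronglyMeasurable, ← h2]

omit [IsProbabilityMeasure P] [IsProbabilityMeasure PX] in
theorem sq_weight {g : Vec r → ℝ} (hg : Measurable g) (h0 : ∀ x, 0 ≤ g x)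
    (hi : Integrable g PX) :
    Integrable (fun y : Vec r × ℝ => w y.2 ^ 2 * g y.1) (P.map fun ω => (X 0 ω, S 0 ω)) ∧
      ∫ y, w y.2 ^ 2 * g y.1 ∂(P.map fun ω => (X 0 ω, S 0 ω)) ≤ V * ∫ x, g x ∂PX := by
  have hm : Measurable fun y : Vec r × ℝ => w y.2 ^ 2 * g y.1 :=
    ((st.w_meas.comp measurable_snd).pow_const 2).mul (hg.comp measurable_fst)
  have hV : 0 ≤ V := zero_le_one.trans st.one_le_V
  have hI : 0 ≤ ∫ x, g x ∂PX := integral_nonneg h0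
  have hle : ∫⁻ y, ENNReal.ofReal (w y.2 ^ 2 * g y.1) ∂(P.map fun ω => (X 0 ω, S 0 ω)) ≤
      ENNReal.ofReal (V * ∫ x, g x ∂PX) := by
    rw [lintegral_map hm.ennreal_ofReal (st.pair_meas 0), ENNReal.ofReal_mul hV,
      ofReal_integral_eq_lintegral_ofReal hi (Eventually.of_forall h0)]
    simp only [ENNReal.ofReal_mul (sq_nonneg _)]
    exact st.w_sq (fun x => ENNReal.ofReal (g x)) hg.ennreal_ofReal
  have hnn : ∀ y : Vec r × ℝ, 0 ≤ w y.2 ^ 2 * g y.1 := fun y => mul_nonneg (sq_nonneg _) (h0 _)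
  refine ⟨⟨hm.aestronglyMeasurable, ?_⟩, ?_⟩
  · rw [hasFiniteIntegral_iff_ofReal (Eventually.of_forall hnn)]
    exact hle.trans_lt ENNReal.ofReal_lt_top
  · rw [integral_eq_lintegral_of_nonneg_ae (Eventually.of_forall hnn) hm.aestronglyMeasurable]
    exact ENNReal.toReal_le_of_le_ofReal (by positivity) hle

omit [IsProbabilityMeasure P] [IsProbabilityMeasure PX] in
theorem integral_fst {g : Vec r → ℝ} (hg : Measurable g) :
    ∫ y, g y.1 ∂(P.map fun ω => (X 0 ω, S 0 ω)) = ∫ x, g x ∂PX := by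
  have hg' : Measurable fun y : Vec r × ℝ => g y.1 := hg.comp measurable_fst
  rw [integral_map (st.pair_meas 0).aemeasurable hg'.aestronglyMeasurable, ← st.map_X,
    integral_map (st.X_meas 0).aemeasurable hg.aestronglyMeasurable]

omit [IsProbabilityMeasure P] [IsProbabilityMeasure PX] in
theorem integrable_fst {g : Vec r → ℝ} (hg : Measurable g) (hi : Integrable g PX) :
    Integrable (fun y : Vec r × ℝ => g y.1) (P.map fun ω => (X 0 ω, S 0 ω)) := by
  have hg' : Measurable fun y : Vec r × ℝ => g y.1 := hg.comp measurable_fst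
  rw [integrable_map_measure hg'.aestronglyMeasurable (st.pair_meas 0).aemeasurable]
  rw [← st.map_X] at hi
  exact hi.comp_measurable (st.X_meas 0)

omit [IsProbabilityMeasure P] in
theorem integrable_norm_sq : Integrable (fun x => ‖b x‖ ^ 2) PX :=
  st.integrable_of_bound (st.b_meas.norm.pow_const 2) (M := ζ ^ 2) fun x hx => by
    rw [abs_of_nonneg (sq_nonneg _)]
    exact pow_le_pow_left₀ (norm_nonneg _) (st.b_bound x hx) 2

omit [IsProbabilityMeasure P] in
theorem integrable_inner_sq (d : Vec k) : Integrable (fun x => inner ℝ d (b x) ^ 2) PX :=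
  st.integrable_of_bound ((measurable_const.inner st.b_meas).pow_const 2)
    (M := (‖d‖ * ζ) ^ 2) fun x hx => by
    rw [abs_of_nonneg (sq_nonneg _), ← sq_abs]
    exact pow_le_pow_left₀ (abs_nonneg _) (st.abs_inner_le d hx) 2

omit [IsProbabilityMeasure P] in
/-- A vector of integrals of the basis against a bounded function is bounded in norm. -/
theorem norm_le_of_forall_eq_integral {a : Vec k} {g : Vec r → ℝ}
    (hg : AEStronglyMeasurable g PX) {M : ℝ} (hM : ∀ᵐ x ∂PX, |g x| ≤ M)
    (ha : ∀ j, a j = ∫ x, b x j * g x ∂PX) : ‖a‖ ≤ M * √c.Cg := by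
  have hM0 : 0 ≤ M := by
    obtain ⟨x, hx⟩ := hM.exists
    exact (abs_nonneg _).trans hx
  have hbj : ∀ j, Integrable (fun x => b x j * g x) PX := fun j => by
    have hm : Measurable fun x => b x j := by
      have := st.b_meas
      fun_prop
    refine Integrable.mul_bdd (c := M) ?_ hg hM
    refine st.integrable_of_bound hm (M := ζ) fun x hx => ?_
    exact (PiLp.norm_apply_le (b x) j).trans (st.b_bound x hx)
  -- Testing `a` against itself gives `‖a‖² = ∫ ⟨a, b⟩ g`, at most `M` times the `L²` norm of `⟨a,
  -- b⟩`. The second moment matrix bounds that norm by `√Cg ‖a‖`, so neither the dimension nor `ζ`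
  -- enters.
  have e1 : ‖a‖ ^ 2 = ∫ x, inner ℝ a (b x) * g x ∂PX := by
    have : ∀ x, inner ℝ a (b x) * g x = ∑ j, a j * (b x j * g x) := fun x => by
      rw [real_inner_eq_sum, Finset.sum_mul]
      exact Finset.sum_congr rfl fun j _ => by ring
    simp only [this]
    rw [integral_finsetSum _ fun j _ => (hbj j).const_mul _, EuclideanSpace.norm_sq_eq]
    refine Finset.sum_congr rfl fun j _ => ?_
    rw [integral_const_mul, ← ha, Real.norm_eq_abs, sq_abs, pow_two]
  have hsq := integral_sqrt_le (st.integrable_inner_sq a) fun x => sq_nonneg _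
  simp only [Real.sqrt_sq_eq_abs] at hsq
  have h2 : √(∫ x, inner ℝ a (b x) ^ 2 ∂PX) ≤ √c.Cg * ‖a‖ := by
    rw [← Real.sqrt_sq (norm_nonneg a), ← Real.sqrt_mul st.Cg_pos.le]
    refine Real.sqrt_le_sqrt ?_
    exact st.quad_upper a
  have h3 : ‖a‖ ^ 2 ≤ M * (√c.Cg * ‖a‖) := by
    rw [e1]
    calc _ ≤ ∫ x, M * |inner ℝ a (b x)| ∂PX := by
          refine (le_abs_self _).trans ((abs_integral_le_integral_abs).trans ?_)
          refine integral_mono_of_nonneg (Eventually.of_forall fun x => abs_nonneg _)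
            (hsq.1.const_mul M) ?_
          filter_upwards [hM] with x hx
          rw [abs_mul, mul_comm]
          gcongr
      _ ≤ _ := by
          rw [integral_const_mul]
          gcongr
          exact hsq.2.trans h2
  rcases (norm_nonneg a).eq_or_lt with h | h
  · rw [← h]; positivity
  · have : ‖a‖ * ‖a‖ ≤ (M * √c.Cg) * ‖a‖ := by nlinarith
    exact le_of_mul_le_mul_right this h

omit [IsProbabilityMeasure P] [IsProbabilityMeasure PX] st in
/-- The Taylor remainder of the criterion at the approximate index, weighted by the kernel. -/
def weightedRemainder (ρ : ℝ → ℝ) (c : StageConstants) (b : Vec r → Vec k) (w : ℝ → ℝ)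
    (l₀ : Vec k) (κ : ℝ) (y : Vec r × ℝ) (d : Vec k) : ℝ :=
  w y.2 * clampedRemainder ρ (c.lo + c.ε / 2) (c.hi - c.ε / 2) κ
    (inner ℝ l₀ (b y.1)) (inner ℝ d (b y.1))

omit [IsProbabilityMeasure P] in
theorem measurable_clampedRemainder {κ : ℝ} (hκ : 0 ≤ κ) (hκε : κ ≤ c.ε / 2) (d : Vec k) :
    Measurable fun x => clampedRemainder ρ (c.lo + c.ε / 2) (c.hi - c.ε / 2) κ
      (inner ℝ l₀ (b x)) (inner ℝ d (b x)) :=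
  (continuous_clampedRemainder st.crit hκ hκε st.lo_add_le).measurable.comp
    ((measurable_const.inner st.b_meas).prodMk (measurable_const.inner st.b_meas))

theorem measure_weight_le {A : ℝ} (hA : 0 < A) :
    P {ω | A * noise V k n < |(n : ℝ)⁻¹ * ∑ i ∈ Finset.range n, w (S i ω) - ∫ x, q x ∂PX|} ≤
      ENNReal.ofReal (1 / A ^ 2) := by
  have hσ := st.noise_pos
  have hn0 : (0 : ℝ) < n := by exact_mod_cast st.one_le_n
  have hk : (1 : ℝ) ≤ k := by exact_mod_cast st.one_le_k
  have : IsProbabilityMeasure (P.map fun ω => (X 0 ω, S 0 ω)) :=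
    Measure.isProbabilityMeasure_map (st.pair_meas 0).aemeasurable
  have h1 := st.mean_weight (g := fun _ => 1) measurable_const (integrable_const _)
  have h2 := st.sq_weight (g := fun _ => 1) measurable_const (fun _ => zero_le_one)
    (integrable_const _)
  simp only [mul_one, one_mul, integral_const, probReal_univ, one_smul] at h1 h2
  have key := measure_sum_sq_gt_le (ι := Unit) st.pair_meas st.indep st.law
    (g := fun _ y => w y.2) (fun _ => st.w_meas.comp measurable_snd) (fun _ => h2.1) n
    (τ := (n * (A * noise V k n)) ^ 2) (by positivity)
  refine (measure_mono fun ω hω => ?_).trans (key.trans (ENNReal.ofReal_le_ofReal ?_))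
  · have hω' : A * noise V k n <
        |(n : ℝ)⁻¹ * ∑ i ∈ Finset.range n, w (S i ω) - ∫ x, q x ∂PX| := hω
    change (n * (A * noise V k n)) ^ 2 < ∑ _ : Unit, (∑ i ∈ Finset.range n,
      (w (S i ω) - ∫ y, w y.2 ∂(P.map fun ω => (X 0 ω, S 0 ω)))) ^ 2
    have e : ∑ i ∈ Finset.range n, (w (S i ω) - ∫ y, w y.2 ∂(P.map fun ω => (X 0 ω, S 0 ω))) =
        n * ((n : ℝ)⁻¹ * ∑ i ∈ Finset.range n, w (S i ω) - ∫ x, q x ∂PX) := by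
      rw [Finset.sum_sub_distrib, mul_sub, mul_inv_cancel_left₀ hn0.ne', h1.2]
      simp
    rw [Fintype.sum_unique, e, ← sq_abs (n * ((n : ℝ)⁻¹ * _ - _)), abs_mul, abs_of_pos hn0]
    gcongr
  · simp only [Fintype.sum_unique]
    rw [mul_pow, mul_pow, div_le_div_iff₀ (by positivity) (by positivity),
      one_mul]
    have h3 := st.mul_noise_sq
    have hV := st.one_le_V
    calc n * (∫ y, w y.2 ^ 2 ∂(P.map fun ω => (X 0 ω, S 0 ω))) * A ^ 2
        ≤ n * (V * k) * A ^ 2 := by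
          gcongr
          exact h2.2.trans (by nlinarith)
      _ = _ := by rw [← h3]; ring

/-- The population counterpart of the weighted average of the basis. -/
def meanScore (PX : Measure (Vec r)) (ρ : ℝ → ℝ) (b : Vec r → Vec k) (q : Vec r → ℝ)
    (l₀ : Vec k) : Vec k :=
  WithLp.toLp 2 fun j => ∫ x, (deriv ρ (inner ℝ l₀ (b x)) * b x j) * q x ∂PX

/-- The mean of the basis. -/
def meanBasis (PX : Measure (Vec r)) (b : Vec r → Vec k) : Vec k :=
  WithLp.toLp 2 fun j => ∫ x, b x j ∂PX

/-- The summands have second moment at most `V C₁² Cg k`, and `V k = n σ²` with `σ` the noise level,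
so Chebyshev's bound depends on `A` alone. -/
theorem measure_score_le {A : ℝ} (hA : 0 < A) :
    P {ω | A * noise V k n < ‖(n : ℝ)⁻¹ • ∑ i ∈ Finset.range n,
        (w (S i ω) * deriv ρ (inner ℝ l₀ (b (X i ω)))) • b (X i ω) - meanScore PX ρ b q l₀‖} ≤
      ENNReal.ofReal (c.C₁ ^ 2 * c.Cg / A ^ 2) := by
  have hσ := st.noise_pos
  have hn0 : (0 : ℝ) < n := by exact_mod_cast st.one_le_n
  have hV := zero_le_one.trans st.one_le_V
  have : IsProbabilityMeasure (P.map fun ω => (X 0 ω, S 0 ω)) :=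
    Measure.isProbabilityMeasure_map (st.pair_meas 0).aemeasurable
  have hbm := st.b_meas
  have hdm : Measurable fun x => deriv ρ (inner ℝ l₀ (b x)) :=
    (measurable_deriv ρ).comp (measurable_const.inner hbm)
  have hG : ∀ x ∈ 𝒳, (deriv ρ (inner ℝ l₀ (b x))) ^ 2 * ‖b x‖ ^ 2 ≤ c.C₁ ^ 2 * ‖b x‖ ^ 2 := by
    intro x hx
    refine mul_le_mul_of_nonneg_right ?_ (sq_nonneg _)
    rw [← sq_abs]
    exact pow_le_pow_left₀ (abs_nonneg _) (st.crit.abs_deriv_le _ (st.index_mem' hx)) 2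
  have hGm : Measurable fun x => (deriv ρ (inner ℝ l₀ (b x))) ^ 2 * ‖b x‖ ^ 2 :=
    (hdm.pow_const 2).mul (hbm.norm.pow_const 2)
  have hGi : Integrable (fun x => (deriv ρ (inner ℝ l₀ (b x))) ^ 2 * ‖b x‖ ^ 2) PX := by
    refine (st.integrable_norm_sq.const_mul (c.C₁ ^ 2)).mono' hGm.aestronglyMeasurable ?_
    filter_upwards [st.ae_mem] with x hx
    rw [Real.norm_of_nonneg (by positivity)]
    exact hG x hx
  have hsq := st.sq_weight hGm (fun x => by positivity) hGi
  have hns : ∀ y : Vec r × ℝ, ‖(w y.2 * deriv ρ (inner ℝ l₀ (b y.1))) • b y.1‖ ^ 2 =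
      w y.2 ^ 2 * ((deriv ρ (inner ℝ l₀ (b y.1))) ^ 2 * ‖b y.1‖ ^ 2) := fun y => by
    rw [norm_smul, mul_pow, Real.norm_eq_abs, sq_abs]; ring
  have hI : ∫ x, (deriv ρ (inner ℝ l₀ (b x))) ^ 2 * ‖b x‖ ^ 2 ∂PX ≤ c.C₁ ^ 2 * (c.Cg * k) := by
    calc _ ≤ ∫ x, c.C₁ ^ 2 * ‖b x‖ ^ 2 ∂PX :=
          integral_mono_ae hGi (st.integrable_norm_sq.const_mul _) (st.ae_mem.mono hG)
      _ ≤ _ := by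
          rw [integral_const_mul]
          gcongr
          exact st.norm_sq
  refine (measure_norm_average_sub_gt_le st.pair_meas st.indep st.law
    (g := fun y => (w y.2 * deriv ρ (inner ℝ l₀ (b y.1))) • b y.1)
    (Q := V * (c.C₁ ^ 2 * (c.Cg * k))) ?_ ?_ ?_ ?_ st.one_le_n (by positivity)).trans
    (ENNReal.ofReal_le_ofReal ?_)
  · exact ((st.w_meas.comp measurable_snd).mul (hdm.comp measurable_fst)).smul
      (hbm.comp measurable_fst)
  · simp only [hns]
    exact hsq.1
  · simp only [hns]
    exact hsq.2.trans (by gcongr)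
  · intro j
    have hj : Measurable fun x => deriv ρ (inner ℝ l₀ (b x)) * b x j := hdm.mul (by fun_prop)
    have hji : Integrable (fun x => deriv ρ (inner ℝ l₀ (b x)) * b x j) PX := by
      refine st.integrable_of_bound hj (M := c.C₁ * ζ) fun x hx => ?_
      rw [abs_mul]
      have h1 := st.crit.abs_deriv_le _ (st.index_mem' hx)
      have h2 : |b x j| ≤ ζ := (PiLp.norm_apply_le (b x) j).trans (st.b_bound x hx)
      have := st.crit.C₁_pos
      gcongr
    change ∫ x, (deriv ρ (inner ℝ l₀ (b x)) * b x j) * q x ∂PX = _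
    rw [← (st.mean_weight hj hji).2]
    refine integral_congr_ae (Eventually.of_forall fun y => ?_)
    simp [mul_assoc]
  · have h3 := st.mul_noise_sq
    rw [div_le_div_iff₀ (by positivity) (by positivity), mul_pow]
    refine le_of_eq ?_
    calc _ = c.C₁ ^ 2 * c.Cg * A ^ 2 * (V * k) := by ring
      _ = _ := by rw [← h3]; ring

theorem measure_basis_le {A : ℝ} (hA : 0 < A) :
    P {ω | A * noise V k n < ‖(n : ℝ)⁻¹ • ∑ i ∈ Finset.range n, b (X i ω) - meanBasis PX b‖} ≤
      ENNReal.ofReal (c.Cg / A ^ 2) := by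
  have hσ := st.noise_pos
  have hn0 : (0 : ℝ) < n := by exact_mod_cast st.one_le_n
  have hV := st.one_le_V
  have : IsProbabilityMeasure (P.map fun ω => (X 0 ω, S 0 ω)) :=
    Measure.isProbabilityMeasure_map (st.pair_meas 0).aemeasurable
  have hbm := st.b_meas
  refine (measure_norm_average_sub_gt_le st.pair_meas st.indep st.law
    (g := fun y => b y.1) (Q := c.Cg * k) (hbm.comp measurable_fst) ?_ ?_ ?_ st.one_le_n
    (by positivity)).trans (ENNReal.ofReal_le_ofReal ?_)
  · exact st.integrable_fst (hbm.norm.pow_const 2) st.integrable_norm_sq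
  · rw [st.integral_fst (g := fun x => ‖b x‖ ^ 2) (hbm.norm.pow_const 2)]
    exact st.norm_sq
  · intro j
    rw [st.integral_fst (g := fun x => b x j) (by fun_prop)]
    rfl
  · have h3 := st.mul_noise_sq
    rw [div_le_div_iff₀ (by positivity) (by positivity), mul_pow]
    have hCg := st.Cg_pos
    calc c.Cg * k * A ^ 2 ≤ c.Cg * (V * k) * A ^ 2 := by
          gcongr
          exact le_mul_of_one_le_left (by positivity) hV
      _ = _ := by rw [← h3]; ring

/-- The maximal inequality is applied with `V y = C₂ κ w b` and `κ = Rζ`. The bound gains the factor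
`κ` over that of a linear process on the same ball, owing to the Lipschitz constant of the
remainder. -/
theorem measure_remainder_le {A R : ℝ} (hA : 0 < A) (hR : 0 < R) (hRζ : R * ζ ≤ c.ε / 2) :
    P {ω | ∃ d : Vec k, ‖d‖ ≤ R ∧ A * R * (R * ζ) * noise V k n <
        |(n : ℝ)⁻¹ * ∑ i ∈ Finset.range n, weightedRemainder ρ c b w l₀ (R * ζ) (X i ω, S i ω) d -
          ∫ y, weightedRemainder ρ c b w l₀ (R * ζ) y d ∂(P.map fun ω => (X 0 ω, S 0 ω))|} ≤
      ENNReal.ofReal (4 * c.C₂ * √c.Cg / A) := by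
  have hσ := st.noise_pos
  have hn0 : (0 : ℝ) < n := by exact_mod_cast st.one_le_n
  have hV := st.one_le_V
  have hκ : 0 < R * ζ := mul_pos hR st.ζ_pos
  have : IsProbabilityMeasure (P.map fun ω => (X 0 ω, S 0 ω)) :=
    Measure.isProbabilityMeasure_map (st.pair_meas 0).aemeasurable
  have hbm := st.b_meas
  set κ := R * ζ with hκdef
  set μ := P.map fun ω => (X 0 ω, S 0 ω)
  have hsq := st.sq_weight (hbm.norm.pow_const 2) (fun x => sq_nonneg _) st.integrable_norm_sq
  have hns : ∀ y : Vec r × ℝ, ‖(c.C₂ * κ * w y.2) • b y.1‖ ^ 2 =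
      (c.C₂ * κ) ^ 2 * (w y.2 ^ 2 * ‖b y.1‖ ^ 2) := fun y => by
    rw [norm_smul, mul_pow, Real.norm_eq_abs, sq_abs]; ring
  have hVint : ∫ y, ‖(c.C₂ * κ * w y.2) • b y.1‖ ^ 2 ∂μ ≤ (c.C₂ * κ) ^ 2 * (V * (c.Cg * k)) := by
    simp only [hns]
    rw [integral_const_mul]
    gcongr
    refine hsq.2.trans ?_
    gcongr
    exact st.norm_sq
  have hτ : 0 < n * (A * R * κ * noise V k n) := by positivity
  have key := measure_process_gt_le st.pair_meas st.indep st.law hR.le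
    (φ := weightedRemainder ρ c b w l₀ κ) (V := fun y => (c.C₂ * κ * w y.2) • b y.1)
    (fun d => (st.w_meas.comp measurable_snd).mul
      ((st.measurable_clampedRemainder hκ.le hRζ d).comp measurable_fst))
    (fun y => by
      rw [weightedRemainder, inner_zero_left, clampedRemainder_zero hκ.le, mul_zero])
    (((st.w_meas.comp measurable_snd).const_mul _).smul (hbm.comp measurable_fst))
    (by simp only [hns]; exact hsq.1.const_mul _)
    (fun y d d' => by
      rw [weightedRemainder, weightedRemainder, ← mul_sub, abs_mul, inner_smul_right, abs_mul,
        abs_mul, abs_of_pos (mul_pos st.crit.C₂_pos hκ), inner_sub_left]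
      have := abs_clampedRemainder_sub_le st.crit hκ.le hRζ st.lo_add_le (inner ℝ l₀ (b y.1))
        (inner ℝ d (b y.1)) (inner ℝ d' (b y.1))
      calc _ ≤ |w y.2| * (c.C₂ * κ * |inner ℝ d (b y.1) - inner ℝ d' (b y.1)|) := by gcongr
        _ = _ := by ring) n hτ
  refine (measure_mono ?_).trans (key.trans (ENNReal.ofReal_le_ofReal ?_))
  · rintro ω ⟨d, hd, hlt⟩
    refine ⟨d, hd, ?_⟩
    have e : ∑ i ∈ Finset.range n, (weightedRemainder ρ c b w l₀ κ (X i ω, S i ω) d -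
        ∫ y, weightedRemainder ρ c b w l₀ κ y d ∂μ) =
        n * ((n : ℝ)⁻¹ * ∑ i ∈ Finset.range n, weightedRemainder ρ c b w l₀ κ (X i ω, S i ω) d -
          ∫ y, weightedRemainder ρ c b w l₀ κ y d ∂μ) := by
      rw [Finset.sum_sub_distrib, mul_sub, mul_inv_cancel_left₀ hn0.ne']
      simp
    rw [e, abs_mul, abs_of_pos hn0]
    gcongr
  · have hC₂ := st.crit.C₂_pos
    have h1 : √(n * ∫ y, ‖(c.C₂ * κ * w y.2) • b y.1‖ ^ 2 ∂μ) ≤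
        c.C₂ * κ * √c.Cg * (n * noise V k n) := by
      refine Real.sqrt_le_iff.2 ⟨by positivity, ?_⟩
      have h3 := st.mul_noise_sq
      calc _ ≤ n * ((c.C₂ * κ) ^ 2 * (V * (c.Cg * k))) := by gcongr
        _ = n * (c.C₂ * κ) ^ 2 * c.Cg * (V * k) := by ring
        _ = (c.C₂ * κ) ^ 2 * c.Cg * (n * noise V k n) ^ 2 := by rw [← h3]; ring
        _ = _ := by
          rw [mul_pow (c.C₂ * κ * √c.Cg), mul_pow (c.C₂ * κ) (√c.Cg),
            Real.sq_sqrt st.Cg_pos.le]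
    rw [div_le_div_iff₀ hτ hA]
    calc _ ≤ 4 * R * (c.C₂ * κ * √c.Cg * (n * noise V k n)) * A := by gcongr
      _ = _ := by ring

/-- The Frobenius norm is controlled entrywise by Chebyshev: the squared entries of `b bᵀ` sum to
`‖b‖⁴ ≤ ζ² ‖b‖²`, whose mean is at most `ζ² Cg k`. -/
theorem measure_gram_le :
    P {ω | 1 < ∑ ij : Fin k × Fin k, ((n : ℝ)⁻¹ * ∑ i ∈ Finset.range n,
        b (X i ω) ij.1 * b (X i ω) ij.2 - ∫ x, b x ij.1 * b x ij.2 ∂PX) ^ 2} ≤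
      ENNReal.ofReal (c.Cg * (ζ * noise V k n) ^ 2) := by
  have hn0 : (0 : ℝ) < n := by exact_mod_cast st.one_le_n
  have hV := st.one_le_V
  have : IsProbabilityMeasure (P.map fun ω => (X 0 ω, S 0 ω)) :=
    Measure.isProbabilityMeasure_map (st.pair_meas 0).aemeasurable
  have hbm := st.b_meas
  have hm : ∀ ij : Fin k × Fin k, Measurable fun x => b x ij.1 * b x ij.2 := fun ij => by
    fun_prop
  have hbd : ∀ x ∈ 𝒳, ∀ j, |b x j| ≤ ζ := fun x hx j =>
    (PiLp.norm_apply_le (b x) j).trans (st.b_bound x hx)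
  have hi2 : ∀ ij : Fin k × Fin k, Integrable (fun x => (b x ij.1 * b x ij.2) ^ 2) PX :=
    fun ij => st.integrable_of_bound ((hm ij).pow_const 2) (M := (ζ * ζ) ^ 2) fun x hx => by
      rw [abs_of_nonneg (sq_nonneg _), ← sq_abs, abs_mul]
      have := hbd x hx ij.1
      have := hbd x hx ij.2
      have := st.ζ_pos
      gcongr
  have key := measure_sum_sq_gt_le st.pair_meas st.indep st.law
    (g := fun (ij : Fin k × Fin k) y => b y.1 ij.1 * b y.1 ij.2)
    (fun ij => (hm ij).comp measurable_fst)
    (fun ij => st.integrable_fst ((hm ij).pow_const 2) (hi2 ij)) n (τ := (n : ℝ) ^ 2)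
    (by positivity)
  refine (measure_mono fun ω hω => ?_).trans (key.trans (ENNReal.ofReal_le_ofReal ?_))
  · have hω' : 1 < ∑ ij : Fin k × Fin k, ((n : ℝ)⁻¹ * ∑ i ∈ Finset.range n,
        b (X i ω) ij.1 * b (X i ω) ij.2 - ∫ x, b x ij.1 * b x ij.2 ∂PX) ^ 2 := hω
    change (n : ℝ) ^ 2 < ∑ ij : Fin k × Fin k, (∑ i ∈ Finset.range n,
      (b (X i ω) ij.1 * b (X i ω) ij.2 -
        ∫ y, b y.1 ij.1 * b y.1 ij.2 ∂(P.map fun ω => (X 0 ω, S 0 ω)))) ^ 2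
    have e : ∀ ij : Fin k × Fin k, (∑ i ∈ Finset.range n, (b (X i ω) ij.1 * b (X i ω) ij.2 -
        ∫ y, b y.1 ij.1 * b y.1 ij.2 ∂(P.map fun ω => (X 0 ω, S 0 ω)))) ^ 2 =
        (n : ℝ) ^ 2 * ((n : ℝ)⁻¹ * ∑ i ∈ Finset.range n,
          b (X i ω) ij.1 * b (X i ω) ij.2 - ∫ x, b x ij.1 * b x ij.2 ∂PX) ^ 2 := fun ij => by
      rw [st.integral_fst (g := fun x => b x ij.1 * b x ij.2) (hm ij), Finset.sum_sub_distrib,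
        ← mul_pow, mul_sub, mul_inv_cancel_left₀ hn0.ne']
      simp
    simp only [e]
    rw [← Finset.mul_sum]
    exact lt_mul_of_one_lt_right (by positivity) hω'
  · have e : ∀ x, ∑ ij : Fin k × Fin k, (b x ij.1 * b x ij.2) ^ 2 = ‖b x‖ ^ 2 * ‖b x‖ ^ 2 := by
      intro x
      rw [EuclideanSpace.norm_sq_eq, Finset.sum_mul_sum, ← Finset.univ_product_univ,
        Finset.sum_product]
      simp [mul_pow]
    have hI : ∫ y, ∑ ij : Fin k × Fin k, (b y.1 ij.1 * b y.1 ij.2) ^ 2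
        ∂(P.map fun ω => (X 0 ω, S 0 ω)) ≤ ζ ^ 2 * (c.Cg * k) := by
      simp only [e]
      rw [st.integral_fst (g := fun x => ‖b x‖ ^ 2 * ‖b x‖ ^ 2)
        ((hbm.norm.pow_const 2).mul (hbm.norm.pow_const 2))]
      calc _ ≤ ∫ x, ζ ^ 2 * ‖b x‖ ^ 2 ∂PX := by
            refine integral_mono_of_nonneg (Eventually.of_forall fun x => by positivity)
              (st.integrable_norm_sq.const_mul _) ?_
            filter_upwards [st.ae_mem] with x hx
            have := st.b_bound x hx
            gcongr
        _ ≤ _ := by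
            rw [integral_const_mul]
            gcongr
            exact st.norm_sq
    have h3 := st.mul_noise_sq
    have hCg := st.Cg_pos
    rw [div_le_iff₀ (by positivity)]
    calc _ ≤ n * (ζ ^ 2 * (c.Cg * k)) := by gcongr
      _ ≤ n * (ζ ^ 2 * (c.Cg * (V * k))) := by
          gcongr
          exact le_mul_of_one_le_left (by positivity) hV
      _ = _ := by rw [← h3]; ring

end Stage

end DeconvWeights

end

noncomputable section

namespace DeconvWeights

/-! ### Samples on which the averages are close to their means -/

theorem objective_const_mul_weight {r k : ℕ} (ρ : ℝ → ℝ) (b : Vec r → Vec k) (W : ℝ → ℝ) (n : ℕ)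
    (S : ℕ → ℝ) (X : ℕ → Vec r) {a : ℝ} (ha : a ≠ 0) :
    objective ρ b (fun s => a * W s) n S X = objective ρ b W n S X := by
  ext l
  rw [objective, objective, ← Finset.mul_sum]
  congr 1
  have : ∀ i, ρ (inner ℝ l (b (X i))) * (a * W (S i)) =
      a * (ρ (inner ℝ l (b (X i))) * W (S i)) := fun i => by ring
  simp only [this]
  rw [← Finset.mul_sum, mul_div_mul_left _ _ ha]

/-- The sample averages are close to their means. -/
structure GoodSample {Ω : Type*} [MeasurableSpace Ω] (P : Measure Ω) {r : ℕ} (X : ℕ → Ω → Vec r)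
    (S : ℕ → Ω → ℝ) (PX : Measure (Vec r)) (𝒳 : Set (Vec r)) (ρ : ℝ → ℝ)
    (c : StageConstants) {k : ℕ} (n : ℕ) (b : Vec r → Vec k) (w : ℝ → ℝ) (q : Vec r → ℝ)
    (l₀ : Vec k) (ζ V A R : ℝ) (ω : Ω) : Prop where
  mem : ∀ i, X i ω ∈ 𝒳
  weight : |(n : ℝ)⁻¹ * ∑ i ∈ Finset.range n, w (S i ω) - ∫ x, q x ∂PX| ≤ A * noise V k n
  score : ‖(n : ℝ)⁻¹ • ∑ i ∈ Finset.range n,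
    (w (S i ω) * deriv ρ (inner ℝ l₀ (b (X i ω)))) • b (X i ω) -
      Stage.meanScore PX ρ b q l₀‖ ≤ A * noise V k n
  basis : ‖(n : ℝ)⁻¹ • ∑ i ∈ Finset.range n, b (X i ω) - Stage.meanBasis PX b‖ ≤ A * noise V k n
  remainder : ∀ d : Vec k, ‖d‖ ≤ R → |(n : ℝ)⁻¹ * ∑ i ∈ Finset.range n,
    Stage.weightedRemainder ρ c b w l₀ (R * ζ) (X i ω, S i ω) d -
      ∫ y, Stage.weightedRemainder ρ c b w l₀ (R * ζ) y d ∂(P.map fun ω => (X 0 ω, S 0 ω))| ≤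
        A * R * (R * ζ) * noise V k n
  gram : ∑ ij : Fin k × Fin k, ((n : ℝ)⁻¹ * ∑ i ∈ Finset.range n,
    b (X i ω) ij.1 * b (X i ω) ij.2 - ∫ x, b x ij.1 * b x ij.2 ∂PX) ^ 2 ≤ 1

/-! ### Good samples and comparison of the objective function on a sphere -/

namespace Stage

variable {Ω : Type*} [MeasurableSpace Ω] {P : Measure Ω} [IsProbabilityMeasure P] {r : ℕ}
  {X : ℕ → Ω → Vec r} {S : ℕ → Ω → ℝ} {PX : Measure (Vec r)} [IsProbabilityMeasure PX]
  {𝒳 : Set (Vec r)} {ρ : ℝ → ℝ} {p z : Vec r → ℝ} {c : StageConstants} {k n : ℕ}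
  {b : Vec r → Vec k} {w : ℝ → ℝ} {q : Vec r → ℝ} {l₀ : Vec k} {ζ bb V da : ℝ}
  (st : Stage P X S PX 𝒳 ρ p z c n b w q l₀ ζ bb V da)

include st

theorem measure_not_goodSample_le {A R : ℝ} (hA : 1 ≤ A) (hR : 0 < R) (hRζ : R * ζ ≤ c.ε / 2) :
    P {ω | ¬ GoodSample P X S PX 𝒳 ρ c n b w q l₀ ζ V A R ω} ≤
      ENNReal.ofReal ((1 + c.C₁ ^ 2 * c.Cg + c.Cg + 4 * c.C₂ * √c.Cg) / A +
        c.Cg * (ζ * noise V k n) ^ 2) := by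
  have hA0 : 0 < A := one_pos.trans_le hA
  have hCg := st.Cg_pos
  have hC₂ := st.crit.C₂_pos
  have h0 : P {ω | ¬ ∀ i, X i ω ∈ 𝒳} = 0 := by
    refine ae_iff.1 (ae_all_iff.2 fun i => ?_)
    have hi : P.map (X i) = PX := by
      have h1 := congrArg (Measure.map Prod.fst) (st.law i)
      rw [Measure.map_map measurable_fst (st.pair_meas i),
        Measure.map_map measurable_fst (st.pair_meas 0)] at h1
      exact h1.trans st.map_X
    have := st.ae_mem
    rw [← hi] at this
    exact ae_of_ae_map (st.X_meas i).aemeasurable this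
  have h1 := st.measure_weight_le hA0
  have h2 := st.measure_score_le hA0
  have h3 := st.measure_basis_le hA0
  have h4 := st.measure_remainder_le hA0 hR hRζ
  have h5 := st.measure_gram_le
  set E0 := {ω | ¬ ∀ i, X i ω ∈ 𝒳}
  set E1 := {ω | A * noise V k n <
    |(n : ℝ)⁻¹ * ∑ i ∈ Finset.range n, w (S i ω) - ∫ x, q x ∂PX|}
  set E2 := {ω | A * noise V k n < ‖(n : ℝ)⁻¹ • ∑ i ∈ Finset.range n,
        (w (S i ω) * deriv ρ (inner ℝ l₀ (b (X i ω)))) • b (X i ω) - meanScore PX ρ b q l₀‖}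
  set E3 := {ω | A * noise V k n <
    ‖(n : ℝ)⁻¹ • ∑ i ∈ Finset.range n, b (X i ω) - meanBasis PX b‖}
  set E4 := {ω | ∃ d : Vec k, ‖d‖ ≤ R ∧ A * R * (R * ζ) * noise V k n <
        |(n : ℝ)⁻¹ * ∑ i ∈ Finset.range n, weightedRemainder ρ c b w l₀ (R * ζ) (X i ω, S i ω) d -
          ∫ y, weightedRemainder ρ c b w l₀ (R * ζ) y d ∂(P.map fun ω => (X 0 ω, S 0 ω))|}
  set E5 := {ω | 1 < ∑ ij : Fin k × Fin k, ((n : ℝ)⁻¹ * ∑ i ∈ Finset.range n,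
        b (X i ω) ij.1 * b (X i ω) ij.2 - ∫ x, b x ij.1 * b x ij.2 ∂PX) ^ 2}
  have hsub : {ω | ¬ GoodSample P X S PX 𝒳 ρ c n b w q l₀ ζ V A R ω} ⊆
      E0 ∪ (E1 ∪ (E2 ∪ (E3 ∪ (E4 ∪ E5)))) := by
    intro ω hω
    by_contra hnot
    simp only [Set.mem_union, not_or] at hnot
    obtain ⟨g0, g1, g2, g3, g4, g5⟩ := hnot
    refine hω ⟨not_not.1 g0, not_lt.1 g1, not_lt.1 g2, not_lt.1 g3, fun d hd => ?_, not_lt.1 g5⟩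
    by_contra hlt
    exact g4 ⟨d, hd, not_le.1 hlt⟩
  -- For `A ≥ 1` the Chebyshev bounds of order `A⁻²` are weakened to `A⁻¹`, the order of the maximal
  -- inequality.
  have hdiv : ∀ a : ℝ, 0 ≤ a → a / A ^ 2 ≤ a / A := fun a ha => by
    gcongr
    exact le_self_pow₀ hA two_ne_zero
  calc _ ≤ P (E0 ∪ (E1 ∪ (E2 ∪ (E3 ∪ (E4 ∪ E5))))) := measure_mono hsub
    _ ≤ P E0 + (P E1 + (P E2 + (P E3 + (P E4 + P E5)))) :=
        (measure_union_le _ _).trans <| add_le_add le_rfl <|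
        (measure_union_le _ _).trans <| add_le_add le_rfl <|
        (measure_union_le _ _).trans <| add_le_add le_rfl <|
        (measure_union_le _ _).trans <| add_le_add le_rfl <| measure_union_le _ _
    _ ≤ 0 + (ENNReal.ofReal (1 / A ^ 2) + (ENNReal.ofReal (c.C₁ ^ 2 * c.Cg / A ^ 2) +
          (ENNReal.ofReal (c.Cg / A ^ 2) + (ENNReal.ofReal (4 * c.C₂ * √c.Cg / A) +
            ENNReal.ofReal (c.Cg * (ζ * noise V k n) ^ 2))))) := by
        gcongr
        exact h0.le
    _ = ENNReal.ofReal (1 / A ^ 2 + (c.C₁ ^ 2 * c.Cg / A ^ 2 + (c.Cg / A ^ 2 +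
          (4 * c.C₂ * √c.Cg / A + c.Cg * (ζ * noise V k n) ^ 2)))) := by
        rw [zero_add, ← ENNReal.ofReal_add (by positivity) (by positivity),
          ← ENNReal.ofReal_add (by positivity) (by positivity),
          ← ENNReal.ofReal_add (by positivity) (by positivity),
          ← ENNReal.ofReal_add (by positivity) (by positivity)]
    _ ≤ _ := by
        refine ENNReal.ofReal_le_ofReal ?_
        have a1 := hdiv 1 zero_le_one
        have a2 := hdiv (c.C₁ ^ 2 * c.Cg) (by positivity)
        have a3 := hdiv c.Cg hCg.le
        rw [add_div, add_div, add_div]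
        linarith

omit [IsProbabilityMeasure P] in
theorem norm_meanBasis_le : ‖meanBasis PX b‖ ≤ √c.Cg := by
  have := st.norm_le_of_forall_eq_integral (a := meanBasis PX b) (g := fun _ => 1) (M := 1)
    aestronglyMeasurable_const (by simp) (fun j => by simp [meanBasis])
  simpa using this

omit [IsProbabilityMeasure P] in
-- The identity `ρ'(z) p = m` is the population first order condition. Subtracting it leaves the
-- smoothing bias `q - p` and the approximation error `ρ'(⟨l₀, b⟩) - ρ'(z)`, both uniformly small
-- functions integrated against the basis.
theorem norm_meanScore_sub_le : ‖meanScore PX ρ b q l₀ - c.m • meanBasis PX b‖ ≤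
    (c.C₁ * bb + c.C₂ * da * c.B) * √c.Cg := by
  have hbm := st.b_meas
  have hdm : Measurable fun x => deriv ρ (inner ℝ l₀ (b x)) :=
    (measurable_deriv ρ).comp (measurable_const.inner hbm)
  have hbd : ∀ x ∈ 𝒳, ∀ j, |b x j| ≤ ζ := fun x hx j =>
    (PiLp.norm_apply_le (b x) j).trans (st.b_bound x hx)
  refine st.norm_le_of_forall_eq_integral (g := fun x => deriv ρ (inner ℝ l₀ (b x)) * q x - c.m)
    ((hdm.aestronglyMeasurable.mul st.q_meas).sub aestronglyMeasurable_const) ?_ ?_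
  · filter_upwards [st.ae_mem, st.q_bias, st.η_le, st.le_B] with x hx hq hη hB
    have h1 := st.crit.abs_deriv_le _ (st.index_mem' hx)
    have h2 : |deriv ρ (inner ℝ l₀ (b x)) - deriv ρ (z x)| ≤ c.C₂ * da := by
      have hzm : z x ∈ Set.Icc c.lo c.hi := by
        have h3 := st.z_mem x hx
        have h4 := st.ε_pos
        constructor <;> linarith [h3.1, h3.2]
      refine (st.crit.abs_deriv_sub_le _ hzm _ (st.index_mem' hx)).trans ?_
      rw [abs_sub_comm]
      exact mul_le_mul_of_nonneg_left (st.approx x hx) st.crit.C₂_pos.le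
    have hp : 0 ≤ p x := st.η_pos.le.trans hη
    have e : deriv ρ (inner ℝ l₀ (b x)) * q x - c.m = deriv ρ (inner ℝ l₀ (b x)) * (q x - p x) +
        (deriv ρ (inner ℝ l₀ (b x)) - deriv ρ (z x)) * p x := by
      rw [← st.weight_eq x hx]; ring
    rw [e]
    refine (abs_add_le _ _).trans ?_
    rw [abs_mul, abs_mul, abs_of_nonneg hp]
    have := st.crit.C₁_pos
    have := st.crit.C₂_pos
    have := st.da_nonneg
    gcongr
  · intro j
    have hj : Measurable fun x => b x j := by fun_prop
    have i1 : Integrable (fun x => b x j) PX := st.integrable_of_bound hj fun x hx => hbd x hx j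
    have hj2 : Measurable fun x => deriv ρ (inner ℝ l₀ (b x)) * b x j := hdm.mul hj
    have hi2 : Integrable (fun x => deriv ρ (inner ℝ l₀ (b x)) * b x j) PX := by
      refine st.integrable_of_bound hj2 (M := c.C₁ * ζ) fun x hx => ?_
      rw [abs_mul]
      have h1 := st.crit.abs_deriv_le _ (st.index_mem' hx)
      have h2 := hbd x hx j
      have := st.crit.C₁_pos
      gcongr
    have hq : ∀ᵐ x ∂PX, ‖q x‖ ≤ bb + c.B := by
      filter_upwards [st.q_bias, st.η_le, st.le_B] with x h1 h2 h3
      have hp : |p x| ≤ c.B := by rwa [abs_of_nonneg (st.η_pos.le.trans h2)]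
      rw [Real.norm_eq_abs]
      calc |q x| = |(q x - p x) + p x| := by ring_nf
        _ ≤ _ := (abs_add_le _ _).trans (add_le_add h1 hp)
    have i3 := hi2.mul_bdd st.q_meas hq
    change (∫ x, (deriv ρ (inner ℝ l₀ (b x)) * b x j) * q x ∂PX) - c.m * (∫ x, b x j ∂PX) = _
    rw [← integral_const_mul, ← integral_sub i3 (i1.const_mul _)]
    congr 1 with x
    ring

omit [IsProbabilityMeasure P] in
theorem abs_integral_q_sub_le (hm : c.m = ∫ x, p x ∂PX) (hp : Measurable p) :
    |∫ x, q x ∂PX - c.m| ≤ bb := by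
  have ip : Integrable p PX := by
    refine Integrable.of_bound hp.aestronglyMeasurable c.B ?_
    filter_upwards [st.η_le, st.le_B] with x h2 h3
    rwa [Real.norm_of_nonneg (st.η_pos.le.trans h2)]
  have iq : Integrable (fun x => q x - p x) PX :=
    Integrable.of_bound (st.q_meas.sub hp.aestronglyMeasurable) bb st.q_bias
  have iq' : Integrable q PX := by
    refine (iq.add ip).congr (Eventually.of_forall fun x => ?_)
    simp
  rw [hm, ← integral_sub iq' ip]
  have := norm_integral_le_of_norm_le_const (f := fun x => q x - p x) st.q_bias
  simpa using this

omit [IsProbabilityMeasure P] in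
-- Individual weights may be negative, but their conditional mean satisfies `q ≥ p - bb ≥ η/2`. The
-- strict concavity of `ρ` therefore survives in expectation, and the lower bound of the second
-- moment matrix makes it quadratic in `‖d‖`.
theorem integral_weightedRemainder_le {κ : ℝ} (hκ : 0 ≤ κ) (hκε : κ ≤ c.ε / 2) {d : Vec k}
    (hd : ‖d‖ * ζ ≤ κ) :
    ∫ y, weightedRemainder ρ c b w l₀ κ y d ∂(P.map fun ω => (X 0 ω, S 0 ω)) ≤
      -(c.c₀ * (c.η / 2) * c.cl * ‖d‖ ^ 2) := by
  have hc₀ := st.crit.c₀_pos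
  have hη := st.η_pos
  have hmeas := st.measurable_clampedRemainder hκ hκε d
  set Ψ : Vec r → ℝ := fun x => clampedRemainder ρ (c.lo + c.ε / 2) (c.hi - c.ε / 2) κ
      (inner ℝ l₀ (b x)) (inner ℝ d (b x))
  have hcl : ∀ x ∈ 𝒳, clamp (-κ) κ (inner ℝ d (b x)) = inner ℝ d (b x) := fun x hx =>
    clamp_of_mem (abs_le.1 ((st.abs_inner_le d hx).trans hd))
  have hle : ∀ x ∈ 𝒳, Ψ x ≤ -c.c₀ * inner ℝ d (b x) ^ 2 := fun x hx => by
    have := clampedRemainder_le st.crit hκ hκε st.lo_add_le (inner ℝ l₀ (b x)) (inner ℝ d (b x))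
    rwa [hcl x hx] at this
  have hΨi : Integrable Ψ PX := by
    refine st.integrable_of_bound hmeas (M := c.C₂ * κ * κ) fun x hx => ?_
    have := abs_clampedRemainder_sub_le st.crit hκ hκε st.lo_add_le (inner ℝ l₀ (b x))
      (inner ℝ d (b x)) 0
    rw [clampedRemainder_zero hκ, sub_zero, sub_zero] at this
    refine this.trans ?_
    have h1 := (st.abs_inner_le d hx).trans hd
    exact mul_le_mul_of_nonneg_left h1 (mul_nonneg st.crit.C₂_pos.le hκ)
  have e : ∫ y, weightedRemainder ρ c b w l₀ κ y d ∂(P.map fun ω => (X 0 ω, S 0 ω)) =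
      ∫ x, Ψ x * q x ∂PX := (st.mean_weight hmeas hΨi).2
  have hqb : ∀ᵐ x ∂PX, ‖q x‖ ≤ bb + c.B := by
    filter_upwards [st.q_bias, st.η_le, st.le_B] with x h1 h2 h3
    have hp : |p x| ≤ c.B := by rwa [abs_of_nonneg (st.η_pos.le.trans h2)]
    rw [Real.norm_eq_abs]
    calc |q x| = |(q x - p x) + p x| := by ring_nf
      _ ≤ _ := (abs_add_le _ _).trans (add_le_add h1 hp)
  rw [e]
  calc _ ≤ ∫ x, -(c.c₀ * (c.η / 2)) * inner ℝ d (b x) ^ 2 ∂PX := by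
        refine integral_mono_ae (hΨi.mul_bdd st.q_meas hqb)
          ((st.integrable_inner_sq d).const_mul _) ?_
        filter_upwards [st.ae_mem, st.q_bias, st.η_le] with x hx h1 h2
        have h3 : c.η / 2 ≤ q x := by linarith [(abs_le.1 h1).1, st.bb_le]
        have h4 := hle x hx
        have h5 : 0 ≤ inner ℝ d (b x) ^ 2 := sq_nonneg (inner ℝ d (b x) : ℝ)
        calc Ψ x * q x ≤ (-c.c₀ * inner ℝ d (b x) ^ 2) * q x :=
              mul_le_mul_of_nonneg_right h4 (by linarith)
          _ ≤ _ := by nlinarith [mul_nonneg (mul_nonneg hc₀.le h5) (sub_nonneg.2 h3)]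
    _ = -(c.c₀ * (c.η / 2)) * ∫ x, inner ℝ d (b x) ^ 2 ∂PX := integral_const_mul _ _
    _ ≤ _ := by
        have h1 := st.quad_lower d
        have h2 : 0 ≤ c.c₀ * (c.η / 2) := by positivity
        nlinarith

omit [IsProbabilityMeasure P] [IsProbabilityMeasure PX] in
theorem index_mem_of_norm_sub_le {R : ℝ} (hRζ : R * ζ ≤ c.ε / 2) {l : Vec k}
    (hl : ‖l - l₀‖ ≤ R) {x : Vec r} (hx : x ∈ 𝒳) : inner ℝ l (b x) ∈ Set.Icc c.lo c.hi := by
  have h1 := st.index_mem hx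
  have h2 := st.abs_inner_le (l - l₀) hx
  have h3 : ‖l - l₀‖ * ζ ≤ c.ε / 2 :=
    (mul_le_mul_of_nonneg_right hl st.ζ_pos.le).trans hRζ
  rw [inner_sub_left] at h2
  have h4 := abs_le.1 (h2.trans h3)
  constructor <;> linarith [h1.1, h1.2, h4.1, h4.2]

omit [IsProbabilityMeasure P] in
/-- A bound of the score at the approximate index. -/
theorem norm_score_le (hm : c.m = ∫ x, p x ∂PX) (hp : Measurable p) {A R : ℝ} {ω : Ω}
    (hω : GoodSample P X S PX 𝒳 ρ c n b w q l₀ ζ V A R ω) (hAσ : A * noise V k n ≤ 1) :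
    ‖(n : ℝ)⁻¹ • ∑ i ∈ Finset.range n,
      (w (S i ω) * deriv ρ (inner ℝ l₀ (b (X i ω)))) • b (X i ω) -
      ((n : ℝ)⁻¹ * ∑ i ∈ Finset.range n, w (S i ω)) •
        ((n : ℝ)⁻¹ • ∑ i ∈ Finset.range n, b (X i ω))‖ ≤
    A * noise V k n + (c.C₁ * bb + c.C₂ * da * c.B) * √c.Cg + c.m * (A * noise V k n) +
      (bb + A * noise V k n) * (√c.Cg + 1) := by
  set a := (n : ℝ)⁻¹ • ∑ i ∈ Finset.range n,
      (w (S i ω) * deriv ρ (inner ℝ l₀ (b (X i ω)))) • b (X i ω)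
  set g := (n : ℝ)⁻¹ * ∑ i ∈ Finset.range n, w (S i ω)
  set v := (n : ℝ)⁻¹ • ∑ i ∈ Finset.range n, b (X i ω)
  have hm0 : 0 ≤ c.m := st.η_pos.le.trans st.η_le_m
  have h1 : ‖a - meanScore PX ρ b q l₀‖ ≤ A * noise V k n := hω.score
  have h2 := st.norm_meanScore_sub_le
  have h3 : ‖v - meanBasis PX b‖ ≤ A * noise V k n := hω.basis
  have h4 := st.norm_meanBasis_le
  have h5 : |g - c.m| ≤ bb + A * noise V k n := by
    have e : g - c.m = (∫ x, q x ∂PX - c.m) + (g - ∫ x, q x ∂PX) := by ring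
    rw [e]
    exact (abs_add_le _ _).trans (add_le_add (st.abs_integral_q_sub_le hm hp) hω.weight)
  have h6 : ‖v‖ ≤ √c.Cg + 1 := by
    have e : v = meanBasis PX b + (v - meanBasis PX b) := by abel
    rw [e]
    exact (norm_add_le _ _).trans (add_le_add h4 (h3.trans hAσ))
  -- The four terms are the fluctuation of the weighted average, the population bias, the
  -- fluctuation of the plain average of the basis, and the error of the mean weight.
  have e : a - g • v = (a - meanScore PX ρ b q l₀) +
      (meanScore PX ρ b q l₀ - c.m • meanBasis PX b) + (-c.m) • (v - meanBasis PX b) +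
      (-(g - c.m)) • v := by
    rw [smul_sub, neg_smul, neg_smul, neg_smul, sub_smul]; abel
  rw [e]
  refine (norm_add₄_le).trans ?_
  rw [norm_smul, norm_smul, norm_neg, norm_neg, Real.norm_of_nonneg hm0, Real.norm_eq_abs]
  gcongr
  · exact (abs_nonneg _).trans h5

omit [IsProbabilityMeasure P] in
/-- On good samples, the objective function is smaller on the sphere around the approximate index
than in its centre. -/
theorem objective_lt (hm : c.m = ∫ x, p x ∂PX) (hp : Measurable p) {A R : ℝ} {ω : Ω}
    (hR : 0 < R) (hRζ : R * ζ ≤ c.ε / 2)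
    (hω : GoodSample P X S PX 𝒳 ρ c n b w q l₀ ζ V A R ω) (hAσ : A * noise V k n ≤ 1)
    (hlt : bb + A * noise V k n < c.η)
    (hnum : R * (A * noise V k n + (c.C₁ * bb + c.C₂ * da * c.B) * √c.Cg +
      c.m * (A * noise V k n) + (bb + A * noise V k n) * (√c.Cg + 1)) +
      A * R * (R * ζ) * noise V k n < c.c₀ * (c.η / 2) * c.cl * R ^ 2)
    {y : Vec k} (hy : y ∈ Metric.sphere l₀ R) :
    objective ρ b w n (fun i => S i ω) (fun i => X i ω) y <
      objective ρ b w n (fun i => S i ω) (fun i => X i ω) l₀ := by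
  have hn0 : (0 : ℝ) < n := by exact_mod_cast st.one_le_n
  obtain ⟨d, rfl⟩ : ∃ d, y = l₀ + d := ⟨y - l₀, by abel⟩
  have hd : ‖d‖ = R := by simpa using hy
  have hκ : 0 ≤ R * ζ := mul_nonneg hR.le st.ζ_pos.le
  set W := ∑ i ∈ Finset.range n, w (S i ω) with hW
  -- The mean weight differs from `m ≥ η` by at most `bb + Aσ < η`; its positivity lets the sign of
  -- the objective difference be read off after multiplication.
  have hg : 0 < (n : ℝ)⁻¹ * W := by
    have h1 := abs_le.1 (st.abs_integral_q_sub_le hm hp)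
    have h2 := abs_le.1 hω.weight
    have h3 := st.η_le_m
    linarith [h1.1, h2.1]
  have hW0 : W ≠ 0 := fun h => by simp [h] at hg
  have hrem := hω.remainder d hd.le
  have hmean := st.integral_weightedRemainder_le hκ hRζ (d := d) (by rw [hd])
  rw [hd] at hmean
  have hsc := st.norm_score_le hm hp hω hAσ
  set a := (n : ℝ)⁻¹ • ∑ i ∈ Finset.range n,
      (w (S i ω) * deriv ρ (inner ℝ l₀ (b (X i ω)))) • b (X i ω) with ha
  set v := (n : ℝ)⁻¹ • ∑ i ∈ Finset.range n, b (X i ω) with hv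
  clear_value a v W
  rw [← hW] at hsc
  have hdot : inner ℝ d (a - ((n : ℝ)⁻¹ * W) • v) ≤ R * ‖a - ((n : ℝ)⁻¹ * W) • v‖ := by
    rw [← hd]; exact real_inner_le_norm _ _
  -- At sample points in `𝒳` and for `‖d‖ = R` neither clamp is active, so this is the genuine
  -- Taylor expansion.
  have hterm : ∀ i ∈ Finset.range n,
      ρ (inner ℝ (l₀ + d) (b (X i ω))) * w (S i ω) - ρ (inner ℝ l₀ (b (X i ω))) * w (S i ω) =
      weightedRemainder ρ c b w l₀ (R * ζ) (X i ω, S i ω) d +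
        w (S i ω) * deriv ρ (inner ℝ l₀ (b (X i ω))) * inner ℝ d (b (X i ω)) := by
    intro i _
    have hx := hω.mem i
    have c1 := clamp_of_mem (st.index_mem hx)
    have c2 : clamp (-(R * ζ)) (R * ζ) (inner ℝ d (b (X i ω))) = inner ℝ d (b (X i ω)) :=
      clamp_of_mem (abs_le.1 (by simpa [hd] using st.abs_inner_le d hx))
    rw [weightedRemainder, clampedRemainder, c1, c2, inner_add_left]
    ring
  -- Times the mean weight, the objective difference is the average remainder plus the score in
  -- direction `d`. The former is negative of order `R²` up to its fluctuation, the latter at most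
  -- `R` times the score bound.
  have key : ((n : ℝ)⁻¹ * W) *
      (objective ρ b w n (fun i => S i ω) (fun i => X i ω) (l₀ + d) -
        objective ρ b w n (fun i => S i ω) (fun i => X i ω) l₀) =
      (n : ℝ)⁻¹ * ∑ i ∈ Finset.range n, weightedRemainder ρ c b w l₀ (R * ζ) (X i ω, S i ω) d +
        inner ℝ d (a - ((n : ℝ)⁻¹ * W) • v) := by
    have e1 : objective ρ b w n (fun i => S i ω) (fun i => X i ω) (l₀ + d) -
        objective ρ b w n (fun i => S i ω) (fun i => X i ω) l₀ =
        (∑ i ∈ Finset.range n, (weightedRemainder ρ c b w l₀ (R * ζ) (X i ω, S i ω) d +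
          w (S i ω) * deriv ρ (inner ℝ l₀ (b (X i ω))) * inner ℝ d (b (X i ω)))) / W -
        inner ℝ d v := by
      rw [← Finset.sum_congr rfl hterm, Finset.sum_sub_distrib, objective, objective, ← hv, ← hW,
        inner_add_left]
      ring
    have e2 : inner ℝ d a = (n : ℝ)⁻¹ * ∑ i ∈ Finset.range n,
        w (S i ω) * deriv ρ (inner ℝ l₀ (b (X i ω))) * inner ℝ d (b (X i ω)) := by
      rw [ha, inner_smul_right, inner_sum]
      simp only [inner_smul_right]
    rw [e1, inner_sub_right, e2, inner_smul_right, Finset.sum_add_distrib]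
    field_simp
    ring
  have habs := abs_le.1 hrem
  have hfin : ((n : ℝ)⁻¹ * W) *
      (objective ρ b w n (fun i => S i ω) (fun i => X i ω) (l₀ + d) -
        objective ρ b w n (fun i => S i ω) (fun i => X i ω) l₀) < 0 := by
    rw [key]
    have h1 := mul_le_mul_of_nonneg_left hsc hR.le
    linarith [habs.2]
  have := neg_of_mul_neg_right hfin hg.le
  linarith

omit [IsProbabilityMeasure P] [IsProbabilityMeasure PX] in
theorem exists_isLocalMax {D : Set ℝ} (hD : Set.Icc c.lo c.hi ⊆ D) {R : ℝ} {ω : Ω}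
    (hR : 0 < R) (hRζ : R * ζ ≤ c.ε / 2) (hmem : ∀ i, X i ω ∈ 𝒳)
    (hs : ∀ y ∈ Metric.sphere l₀ R, objective ρ b w n (fun i => S i ω) (fun i => X i ω) y <
      objective ρ b w n (fun i => S i ω) (fun i => X i ω) l₀) :
    ∃ l : Vec k, ‖l - l₀‖ ≤ R ∧ l ∈ feasible D b n (fun i => X i ω) ∧
      IsLocalMax (objective ρ b w n (fun i => S i ω) (fun i => X i ω)) l ∧
      ∀ x ∈ 𝒳, inner ℝ l (b x) ∈ D := by
  have hcont : ContinuousOn (objective ρ b w n (fun i => S i ω) (fun i => X i ω))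
      (Metric.closedBall l₀ R) := by
    unfold objective
    refine ContinuousOn.sub (ContinuousOn.div_const ?_ _)
      (Continuous.continuousOn (by fun_prop))
    refine continuousOn_finsetSum _ fun i _ => ContinuousOn.mul ?_ continuousOn_const
    intro l hl
    have hli := st.index_mem_of_norm_sub_le hRζ (mem_closedBall_iff_norm.1 hl) (hmem i)
    exact ContinuousAt.continuousWithinAt (ContinuousAt.comp (f := fun l : Vec k =>
      (inner ℝ l (b (X i ω)) : ℝ)) (st.crit.hasDerivAt _ hli).continuousAt (by fun_prop))
  obtain ⟨l, hl, hmax⟩ := exists_isLocalMax_of_lt_on_sphere hR hcont hs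
  have hl' : ‖l - l₀‖ ≤ R := (mem_ball_iff_norm.1 hl).le
  have hall : ∀ x ∈ 𝒳, inner ℝ l (b x) ∈ D := fun x hx =>
    hD (st.index_mem_of_norm_sub_le hRζ hl' hx)
  exact ⟨l, hl', fun i _ => hall _ (hmem i), hmax, hall⟩

/-! ### Errors of the estimated weights near the approximate index -/

omit [IsProbabilityMeasure P] [IsProbabilityMeasure PX] in
theorem abs_weightEst_sub_le {R : ℝ} (hRζ : R * ζ ≤ c.ε / 2) {l : Vec k} (hl : ‖l - l₀‖ ≤ R)
    {x : Vec r} (hx : x ∈ 𝒳) :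
    |weightEst ρ b l x - deriv ρ (z x)| ≤ c.C₂ * (|inner ℝ (l - l₀) (b x)| + da) := by
  have hzm : z x ∈ Set.Icc c.lo c.hi := by
    have h3 := st.z_mem x hx
    have h4 := st.ε_pos
    constructor <;> linarith [h3.1, h3.2]
  refine (st.crit.abs_deriv_sub_le _ hzm _ (st.index_mem_of_norm_sub_le hRζ hl hx)).trans ?_
  refine mul_le_mul_of_nonneg_left ?_ st.crit.C₂_pos.le
  have e : inner ℝ l (b x) - z x = inner ℝ (l - l₀) (b x) - (z x - inner ℝ l₀ (b x)) := by
    rw [inner_sub_left]; ring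
  rw [e]
  exact (abs_sub _ _).trans (add_le_add le_rfl (st.approx x hx))

omit [IsProbabilityMeasure P] [IsProbabilityMeasure PX] in
theorem sq_weightEst_sub_le {R : ℝ} (hRζ : R * ζ ≤ c.ε / 2) {l : Vec k} (hl : ‖l - l₀‖ ≤ R)
    {x : Vec r} (hx : x ∈ 𝒳) :
    |weightEst ρ b l x - deriv ρ (z x)| ^ 2 ≤
      2 * c.C₂ ^ 2 * (inner ℝ (l - l₀) (b x) ^ 2 + da ^ 2) := by
  have h := pow_le_pow_left₀ (abs_nonneg _) (st.abs_weightEst_sub_le hRζ hl hx) 2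
  refine h.trans ?_
  rw [← sq_abs (inner ℝ (l - l₀) (b x))]
  rw [mul_pow]
  have h1 : (|inner ℝ (l - l₀) (b x)| + da) ^ 2 ≤ 2 * (|inner ℝ (l - l₀) (b x)| ^ 2 + da ^ 2) := by
    nlinarith [sq_nonneg (|inner ℝ (l - l₀) (b x)| - da)]
  nlinarith [sq_nonneg c.C₂]

omit [IsProbabilityMeasure P] [IsProbabilityMeasure PX] in
theorem supErr_le {R : ℝ} (hRζ : R * ζ ≤ c.ε / 2) {l : Vec k} (hl : ‖l - l₀‖ ≤ R) :
    supErr 𝒳 (weightEst ρ b l) (fun x => deriv ρ (z x)) ≤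
      ENNReal.ofReal (c.C₂ * (R * ζ + da)) := by
  refine iSup₂_le fun x hx => ENNReal.ofReal_le_ofReal ?_
  refine (st.abs_weightEst_sub_le hRζ hl hx).trans ?_
  refine mul_le_mul_of_nonneg_left (add_le_add ?_ le_rfl) st.crit.C₂_pos.le
  exact (st.abs_inner_le _ hx).trans (mul_le_mul_of_nonneg_right hl st.ζ_pos.le)

omit [IsProbabilityMeasure P] in
theorem l2Err_le {R : ℝ} (hRζ : R * ζ ≤ c.ε / 2) {l : Vec k} (hl : ‖l - l₀‖ ≤ R) :
    l2Err PX (weightEst ρ b l) (fun x => deriv ρ (z x)) ≤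
      ENNReal.ofReal (2 * c.C₂ ^ 2 * (c.Cg * R ^ 2 + da ^ 2)) := by
  have hi := ((st.integrable_inner_sq (l - l₀)).add (integrable_const (da ^ 2))).const_mul
    (2 * c.C₂ ^ 2)
  calc l2Err PX (weightEst ρ b l) (fun x => deriv ρ (z x))
      ≤ ∫⁻ x, ENNReal.ofReal (2 * c.C₂ ^ 2 * (inner ℝ (l - l₀) (b x) ^ 2 + da ^ 2)) ∂PX := by
        refine lintegral_mono_ae (st.ae_mem.mono fun x hx => ENNReal.ofReal_le_ofReal ?_)
        exact st.sq_weightEst_sub_le hRζ hl hx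
    _ = ENNReal.ofReal (∫ x, 2 * c.C₂ ^ 2 * (inner ℝ (l - l₀) (b x) ^ 2 + da ^ 2) ∂PX) :=
        (ofReal_integral_eq_lintegral_ofReal hi
          (Eventually.of_forall fun x => mul_nonneg (by positivity)
            (add_nonneg (sq_nonneg _) (sq_nonneg _)))).symm
    _ ≤ _ := by
        refine ENNReal.ofReal_le_ofReal ?_
        rw [integral_const_mul, integral_add (st.integrable_inner_sq _) (integrable_const _)]
        simp only [integral_const, probReal_univ, one_smul]
        have h1 := st.quad_upper (l - l₀)
        have := st.Cg_pos
        gcongr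
        exact h1.trans (by gcongr)

omit [IsProbabilityMeasure P] in
-- By Cauchy–Schwarz a quadratic form differs by at most the Frobenius distance of the matrices
-- times `‖d‖²`, and that distance is at most one on good samples.
theorem average_inner_sq_le {A R : ℝ} {ω : Ω}
    (hω : GoodSample P X S PX 𝒳 ρ c n b w q l₀ ζ V A R ω) (d : Vec k) :
    (n : ℝ)⁻¹ * ∑ i ∈ Finset.range n, inner ℝ d (b (X i ω)) ^ 2 ≤ (c.Cg + 1) * ‖d‖ ^ 2 := by
  have hbm := st.b_meas
  set a : Fin k × Fin k → ℝ := fun ij => (n : ℝ)⁻¹ * ∑ i ∈ Finset.range n,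
    b (X i ω) ij.1 * b (X i ω) ij.2 - ∫ x, b x ij.1 * b x ij.2 ∂PX with ha
  have e0 : ∀ x : Vec k, inner ℝ d x ^ 2 =
      ∑ ij : Fin k × Fin k, (d ij.1 * d ij.2) * (x ij.1 * x ij.2) := fun x => by
    rw [real_inner_eq_sum, pow_two, Finset.sum_mul_sum, ← Finset.univ_product_univ,
      Finset.sum_product]
    exact Finset.sum_congr rfl fun i _ => Finset.sum_congr rfl fun j _ => by ring
  have hbd : ∀ x ∈ 𝒳, ∀ j, |b x j| ≤ ζ := fun x hx j =>
    (PiLp.norm_apply_le (b x) j).trans (st.b_bound x hx)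
  have hi : ∀ ij : Fin k × Fin k, Integrable (fun x => b x ij.1 * b x ij.2) PX := fun ij => by
    refine st.integrable_of_bound (by fun_prop) (M := ζ * ζ) fun x hx => ?_
    rw [abs_mul]
    exact mul_le_mul (hbd x hx _) (hbd x hx _) (abs_nonneg _) st.ζ_pos.le
  have e1 : (n : ℝ)⁻¹ * ∑ i ∈ Finset.range n, inner ℝ d (b (X i ω)) ^ 2 -
      ∫ x, inner ℝ d (b x) ^ 2 ∂PX = ∑ ij, (d ij.1 * d ij.2) * a ij := by
    simp only [e0]
    rw [integral_finsetSum _ fun ij _ => (hi ij).const_mul _, Finset.sum_comm, Finset.mul_sum,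
      ← Finset.sum_sub_distrib]
    refine Finset.sum_congr rfl fun ij _ => ?_
    rw [ha, integral_const_mul, ← Finset.mul_sum]
    ring
  have e2 : ∑ ij : Fin k × Fin k, (d ij.1 * d ij.2) ^ 2 = (‖d‖ ^ 2) ^ 2 := by
    rw [pow_two (‖d‖ ^ 2), EuclideanSpace.norm_sq_eq, Finset.sum_mul_sum,
      ← Finset.univ_product_univ, Finset.sum_product]
    simp [mul_pow]
  have hcs : ∑ ij, (d ij.1 * d ij.2) * a ij ≤ ‖d‖ ^ 2 := by
    have h1 := Finset.sum_mul_sq_le_sq_mul_sq Finset.univ (fun ij : Fin k × Fin k =>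
      d ij.1 * d ij.2) a
    rw [e2] at h1
    have h2 : ∑ ij, a ij ^ 2 ≤ 1 := hω.gram
    refine le_of_sq_le_sq ?_ (sq_nonneg _)
    refine h1.trans ?_
    exact mul_le_of_le_one_right (sq_nonneg _) h2
  have := st.quad_upper d
  linarith

omit [IsProbabilityMeasure P] in
theorem empErr_le {A R : ℝ} {ω : Ω} (hRζ : R * ζ ≤ c.ε / 2)
    (hω : GoodSample P X S PX 𝒳 ρ c n b w q l₀ ζ V A R ω) {l : Vec k} (hl : ‖l - l₀‖ ≤ R) :
    empErr n (fun i => X i ω) (weightEst ρ b l) (fun x => deriv ρ (z x)) ≤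
      ENNReal.ofReal (2 * c.C₂ ^ 2 * ((c.Cg + 1) * R ^ 2 + da ^ 2)) := by
  have hn0 : (0 : ℝ) < n := by exact_mod_cast st.one_le_n
  refine ENNReal.ofReal_le_ofReal ?_
  have hCg := st.Cg_pos
  calc (n : ℝ)⁻¹ * ∑ i ∈ Finset.range n, |weightEst ρ b l (X i ω) - deriv ρ (z (X i ω))| ^ 2
      ≤ (n : ℝ)⁻¹ * ∑ i ∈ Finset.range n,
          2 * c.C₂ ^ 2 * (inner ℝ (l - l₀) (b (X i ω)) ^ 2 + da ^ 2) := by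
        gcongr with i _
        exact st.sq_weightEst_sub_le hRζ hl (hω.mem i)
    _ = 2 * c.C₂ ^ 2 * ((n : ℝ)⁻¹ * ∑ i ∈ Finset.range n, inner ℝ (l - l₀) (b (X i ω)) ^ 2 +
          da ^ 2) := by
        rw [← Finset.mul_sum, Finset.sum_add_distrib]
        simp only [Finset.sum_const, Finset.card_range, nsmul_eq_mul]
        field_simp
    _ ≤ 2 * c.C₂ ^ 2 * ((c.Cg + 1) * ‖l - l₀‖ ^ 2 + da ^ 2) := by
        exact mul_le_mul_of_nonneg_left
          (add_le_add (st.average_inner_sq_le hω _) le_rfl) (by positivity)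
    _ ≤ _ := by gcongr

end Stage

end DeconvWeights

end

noncomputable section

namespace DeconvWeights

/-! ### Growing sample sizes -/

/-- Tested on a coordinate vector. It keeps `ζ` away from zero, so that `ζ s → 0` forces `s → 0` and
an error of order `δ` is absorbed in `ζ δ`. -/
theorem le_sq_of_forall_mul_norm_sq_le {r k : ℕ} {PX : Measure (Vec r)} [IsProbabilityMeasure PX]
    {𝒳 : Set (Vec r)} (hmem : ∀ᵐ x ∂PX, x ∈ 𝒳) {b : Vec r → Vec k} {ζ a : ℝ} (hk : 1 ≤ k)
    (hb : ∀ x ∈ 𝒳, ‖b x‖ ≤ ζ) (ha : ∀ d : Vec k, a * ‖d‖ ^ 2 ≤ ∫ x, inner ℝ d (b x) ^ 2 ∂PX) :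
    a ≤ ζ ^ 2 := by
  have e := ha (EuclideanSpace.single ⟨0, hk⟩ (1 : ℝ))
  have hn : ‖(EuclideanSpace.single ⟨0, hk⟩ (1 : ℝ) : Vec k)‖ = 1 := by simp
  rw [hn, one_pow, mul_one] at e
  refine e.trans ?_
  calc _ ≤ ∫ _, ζ ^ 2 ∂PX := by
        refine integral_mono_of_nonneg (Eventually.of_forall fun x => sq_nonneg _)
          (integrable_const _) ?_
        filter_upwards [hmem] with x hx
        have h := (abs_real_inner_le_norm (EuclideanSpace.single ⟨0, hk⟩ (1 : ℝ)) (b x))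
        rw [hn, one_mul] at h
        exact sq_le_sq.2 ((h.trans (hb x hx)).trans (le_abs_self _))
    _ = ζ ^ 2 := by simp

theorem Stage.cl_le_sq {Ω : Type*} [MeasurableSpace Ω] {P : Measure Ω} {r : ℕ}
    {X : ℕ → Ω → Vec r} {S : ℕ → Ω → ℝ} {PX : Measure (Vec r)} [IsProbabilityMeasure PX]
    {𝒳 : Set (Vec r)} {ρ : ℝ → ℝ} {p z : Vec r → ℝ} {c : StageConstants} {k n : ℕ}
    {b : Vec r → Vec k} {w : ℝ → ℝ} {q : Vec r → ℝ} {l₀ : Vec k} {ζ bb V da : ℝ}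
    (st : Stage P X S PX 𝒳 ρ p z c n b w q l₀ ζ bb V da) : c.cl ≤ ζ ^ 2 :=
  le_sq_of_forall_mul_norm_sq_le st.ae_mem st.one_le_k st.b_bound st.quad_lower

/-- A sequence of estimation problems at growing sample sizes, with approximation errors of order
`δ`, biases of order `g` and standard errors of order `s`. -/
structure StageSequence {Ω : Type*} [MeasurableSpace Ω] (P : Measure Ω) {r : ℕ}
    (X : ℕ → Ω → Vec r) (S : ℕ → Ω → ℝ) (PX : Measure (Vec r)) (𝒳 : Set (Vec r)) (ρ : ℝ → ℝ)
    (p z : Vec r → ℝ) (c : StageConstants) (K : ℕ → ℕ) (b : (n : ℕ) → Vec r → Vec (K n))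
    (w : ℕ → ℝ → ℝ) (q : ℕ → Vec r → ℝ) (l₀ : (n : ℕ) → Vec (K n)) (ζ V δ g s : ℕ → ℝ)
    (Ca Cb Cv : ℝ) : Prop where
  stage : ∀ᶠ n in atTop,
    Stage P X S PX 𝒳 ρ p z c n (b n) (w n) (q n) (l₀ n) (ζ n) (Cb * g n) (V n) (Ca * δ n)
  noise_eq : ∀ᶠ n in atTop, noise (V n) (K n) n = Cv * s n
  integral_density : c.m = ∫ x, p x ∂PX
  density_meas : Measurable p
  δ_nonneg : ∀ n, 0 ≤ δ n
  g_nonneg : ∀ n, 0 ≤ g n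
  s_nonneg : ∀ n, 0 ≤ s n
  Ca_nonneg : 0 ≤ Ca
  Cb_nonneg : 0 ≤ Cb
  Cv_nonneg : 0 ≤ Cv
  tendsto_g : Tendsto g atTop (𝓝 0)
  tendsto_bias : Tendsto (fun n => ζ n * (δ n + g n)) atTop (𝓝 0)
  tendsto_noise : Tendsto (fun n => ζ n * s n) atTop (𝓝 0)

/-! ### Asymptotics: choice of the radius and stochastic rates -/

namespace StageSequence

variable {Ω : Type*} [MeasurableSpace Ω] {P : Measure Ω} [IsProbabilityMeasure P] {r : ℕ}
  {X : ℕ → Ω → Vec r} {S : ℕ → Ω → ℝ} {PX : Measure (Vec r)} [IsProbabilityMeasure PX]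
  {𝒳 : Set (Vec r)} {ρ : ℝ → ℝ} {p z : Vec r → ℝ} {c : StageConstants} {K : ℕ → ℕ}
  {b : (n : ℕ) → Vec r → Vec (K n)} {w : ℕ → ℝ → ℝ} {q : ℕ → Vec r → ℝ}
  {l₀ : (n : ℕ) → Vec (K n)} {ζ V δ g s : ℕ → ℝ} {Ca Cb Cv : ℝ}
  (sq : StageSequence P X S PX 𝒳 ρ p z c K b w q l₀ ζ V δ g s Ca Cb Cv)

include sq

omit [IsProbabilityMeasure P] in
theorem tendsto_s : Tendsto s atTop (𝓝 0) := by
  obtain ⟨n₀, st₀⟩ := sq.stage.exists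
  have h0 : 0 < √c.cl := Real.sqrt_pos.2 st₀.cl_pos
  have h1 : Tendsto (fun n => ζ n * s n / √c.cl) atTop (𝓝 0) := by
    simpa using sq.tendsto_noise.div_const (√c.cl)
  refine tendsto_of_tendsto_of_tendsto_of_le_of_le' tendsto_const_nhds h1
    (Eventually.of_forall sq.s_nonneg) ?_
  filter_upwards [sq.stage] with n st
  rw [le_div_iff₀ h0, mul_comm]
  exact mul_le_mul_of_nonneg_right (Real.sqrt_le_iff.2 ⟨st.ζ_pos.le, st.cl_le_sq⟩) (sq.s_nonneg n)

/-- With probability close to one, the sample is good, and the objective function is smaller on a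
sphere around the approximate index than in its centre. -/
theorem exists_goodSample {ε : ℝ} (hε : 0 < ε) :
    ∃ A : ℝ, ∃ M : ℕ, 0 < M ∧ ∀ᶠ n in atTop,
      0 < M * (δ n + g n + s n) ∧ M * (δ n + g n + s n) * ζ n ≤ c.ε / 2 ∧
      P {ω | ¬ (GoodSample P X S PX 𝒳 ρ c n (b n) (w n) (q n) (l₀ n) (ζ n) (V n) A
        (M * (δ n + g n + s n)) ω ∧
        ∀ y ∈ Metric.sphere (l₀ n) (M * (δ n + g n + s n)),
          objective ρ (b n) (w n) n (fun i => S i ω) (fun i => X i ω) y <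
          objective ρ (b n) (w n) n (fun i => S i ω) (fun i => X i ω) (l₀ n))} ≤
        ENNReal.ofReal ε := by
  obtain ⟨n₀, st₀⟩ := sq.stage.exists
  have hη := st₀.η_pos
  have hCg := st₀.Cg_pos
  have hcl := st₀.cl_pos
  have hc₀ := st₀.crit.c₀_pos
  have hC₁ := st₀.crit.C₁_pos
  have hC₂ := st₀.crit.C₂_pos
  have hm0 : 0 ≤ c.m := hη.le.trans st₀.η_le_m
  have hB0 : 0 ≤ c.B := by
    obtain ⟨x, h1, h2⟩ := (st₀.η_le.and st₀.le_B).exists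
    linarith
  have hεc := st₀.ε_pos
  have hCa := sq.Ca_nonneg
  have hCb := sq.Cb_nonneg
  have hCv := sq.Cv_nonneg
  set Q : ℝ := 1 + c.C₁ ^ 2 * c.Cg + c.Cg + 4 * c.C₂ * √c.Cg
  have hQ0 : 0 < Q := by positivity
  -- The exceptional events other than that of the second moment matrix have probability at most `Q
  -- / A ≤ ε/2`; the latter contributes `Cg (ζσ)²`, eventually at most `ε/2`.
  set A : ℝ := max 1 (2 * Q / ε)
  have hA1 : 1 ≤ A := le_max_left _ _
  have hA0 : 0 < A := one_pos.trans_le hA1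
  have hQA : Q / A ≤ ε / 2 := by
    rw [div_le_iff₀ hA0]
    have h1 : 2 * Q / ε ≤ A := le_max_right _ _
    rw [div_le_iff₀ hε] at h1
    linarith
  set c₁ : ℝ := c.c₀ * (c.η / 2) * c.cl with hc₁
  have hc₁0 : 0 < c₁ := by positivity
  set H : ℝ := A * Cv + (c.C₁ * Cb + c.C₂ * Ca * c.B) * √c.Cg + c.m * (A * Cv) +
    (Cb + A * Cv) * (√c.Cg + 1) with hH
  have hH0 : 0 ≤ H := by positivity
  -- `H` is the coefficient of the score bound in terms of `δ + g + s`, and `c₁` the curvature. The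
  -- multiplier `M' + 1` makes the curvature beat the score.
  obtain ⟨M', hM'⟩ := exists_nat_ge (2 * H / c₁)
  rw [div_le_iff₀ hc₁0] at hM'
  have tr : Tendsto (fun n => ((M' + 1 : ℕ) : ℝ) * (ζ n * (δ n + g n) + ζ n * s n)) atTop
      (𝓝 0) := by
    simpa using (sq.tendsto_bias.add sq.tendsto_noise).const_mul ((M' + 1 : ℕ) : ℝ)
  have t1 : Tendsto (fun n => A * (Cv * s n)) atTop (𝓝 0) := by
    simpa using (sq.tendsto_s.const_mul Cv).const_mul A
  have t2 : Tendsto (fun n => Cb * g n + A * (Cv * s n)) atTop (𝓝 0) := by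
    simpa using (sq.tendsto_g.const_mul Cb).add t1
  have t3 : Tendsto (fun n => c.Cg * (ζ n * s n * Cv) ^ 2) atTop (𝓝 0) := by
    simpa using (((sq.tendsto_noise.mul_const Cv).pow 2).const_mul c.Cg)
  have t4 : Tendsto (fun n => A * Cv * (ζ n * s n)) atTop (𝓝 0) := by
    simpa using sq.tendsto_noise.const_mul (A * Cv)
  refine ⟨A, M' + 1, Nat.succ_pos _, ?_⟩
  filter_upwards [sq.stage, sq.noise_eq, tr.eventually_le_const (half_pos hεc),
    t1.eventually_le_const one_pos, t2.eventually_lt_const hη,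
    t3.eventually_le_const (half_pos hε), t4.eventually_lt_const (half_pos hc₁0)]
    with n st hn e1 e2 e3 e4 e5
  have hs : 0 < s n := by
    have h1 := st.noise_pos
    rw [hn] at h1
    exact pos_of_mul_pos_right h1 hCv
  have hδ := sq.δ_nonneg n
  have hg := sq.g_nonneg n
  have hζ := st.ζ_pos
  set R : ℝ := ((M' + 1 : ℕ) : ℝ) * (δ n + g n + s n) with hR
  have hr : 0 < δ n + g n + s n := by positivity
  have hR0 : 0 < R := by positivity
  have hRζ : R * ζ n ≤ c.ε / 2 := by
    refine le_trans (le_of_eq ?_) e1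
    rw [hR]; ring
  refine ⟨hR0, hRζ, ?_⟩
  have hAσ : A * noise (V n) (K n) n ≤ 1 := by rw [hn]; exact e2
  have hlt : Cb * g n + A * noise (V n) (K n) n < c.η := by rw [hn]; exact e3
  have hnum : R * (A * noise (V n) (K n) n + (c.C₁ * (Cb * g n) + c.C₂ * (Ca * δ n) * c.B) * √c.Cg +
      c.m * (A * noise (V n) (K n) n) + (Cb * g n + A * noise (V n) (K n) n) * (√c.Cg + 1)) +
      A * R * (R * ζ n) * noise (V n) (K n) n < c.c₀ * (c.η / 2) * c.cl * R ^ 2 := by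
    rw [hn, ← hc₁]
    have g1 : A * (Cv * s n) + (c.C₁ * (Cb * g n) + c.C₂ * (Ca * δ n) * c.B) * √c.Cg +
        c.m * (A * (Cv * s n)) + (Cb * g n + A * (Cv * s n)) * (√c.Cg + 1) ≤
        H * (δ n + g n + s n) := by
      have x1 : s n ≤ δ n + g n + s n := by linarith
      have x2 : g n ≤ δ n + g n + s n := by linarith
      have x3 : δ n ≤ δ n + g n + s n := by linarith
      generalize δ n + g n + s n = ρ' at x1 x2 x3
      calc _ ≤ A * (Cv * ρ') + (c.C₁ * (Cb * ρ') + c.C₂ * (Ca * ρ') * c.B) * √c.Cg +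
          c.m * (A * (Cv * ρ')) + (Cb * ρ' + A * (Cv * ρ')) * (√c.Cg + 1) := by gcongr
        _ = _ := by rw [hH]; ring
    have g2 := mul_le_mul_of_nonneg_left g1 hR0.le
    have hMc : 2 * H + c₁ ≤ c₁ * ((M' + 1 : ℕ) : ℝ) := by push_cast; linarith
    have e : A * R * (R * ζ n) * (Cv * s n) = R ^ 2 * (A * Cv * (ζ n * s n)) := by ring
    rw [e]
    -- Half of the curvature `c₁ R²` pays for the score term, by the choice of `M'`; the other half
    -- pays strictly for the fluctuation of the remainder, because `ζ s → 0`.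
    have g3 : R * (H * (δ n + g n + s n)) ≤ c₁ / 2 * R ^ 2 - 0 := by
      have : c₁ / 2 * R ^ 2 = R * ((c₁ * ((M' + 1 : ℕ) : ℝ)) / 2 * (δ n + g n + s n)) := by
        rw [hR]; ring
      rw [this, sub_zero]
      refine mul_le_mul_of_nonneg_left (mul_le_mul_of_nonneg_right ?_ hr.le) hR0.le
      linarith
    have g4 : R ^ 2 * (A * Cv * (ζ n * s n)) < R ^ 2 * (c₁ / 2) :=
      mul_lt_mul_of_pos_left e5 (by positivity)
    linarith
  calc _ ≤ P {ω | ¬ GoodSample P X S PX 𝒳 ρ c n (b n) (w n) (q n) (l₀ n) (ζ n) (V n) A R ω} := by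
        refine measure_mono fun ω hω hgood => ?_
        exact hω ⟨hgood, fun y hy => st.objective_lt sq.integral_density sq.density_meas hR0 hRζ
          hgood hAσ hlt hnum hy⟩
    _ ≤ _ := st.measure_not_goodSample_le hA1 hR0 hRζ
    _ ≤ _ := by
        refine ENNReal.ofReal_le_ofReal ?_
        rw [hn]
        have : c.Cg * (ζ n * (Cv * s n)) ^ 2 = c.Cg * (ζ n * s n * Cv) ^ 2 := by ring
        rw [this]
        linarith

omit [IsProbabilityMeasure P] in
/-- The rates of estimators that are close to the approximate index. -/
theorem rates_of_close {E : ℕ → Set Ω} {lam : (n : ℕ) → Ω → Vec (K n)} {π : Vec r → ℝ}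
    (hπ : ∀ x ∈ 𝒳, deriv ρ (z x) = π x)
    (hclose : ∀ ε : ℝ, 0 < ε → ∃ A : ℝ, ∃ M : ℕ, 0 < M ∧ ∀ᶠ n in atTop,
      M * (δ n + g n + s n) * ζ n ≤ c.ε / 2 ∧
      P (E n ∩ {ω | ¬ (GoodSample P X S PX 𝒳 ρ c n (b n) (w n) (q n) (l₀ n) (ζ n) (V n) A
        (M * (δ n + g n + s n)) ω ∧ ‖lam n ω - l₀ n‖ ≤ M * (δ n + g n + s n))}) ≤
        ENNReal.ofReal ε) :
    BigOInProbOn P E (fun n ω => supErr 𝒳 (weightEst ρ (b n) (lam n ω)) π)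
      (fun n => ζ n * (δ n + g n) + ζ n * s n) ∧
    BigOInProbOn P E (fun n ω => l2Err PX (weightEst ρ (b n) (lam n ω)) π)
      (fun n => δ n ^ 2 + g n ^ 2 + s n ^ 2) ∧
    BigOInProbOn P E (fun n ω => empErr n (fun i => X i ω) (weightEst ρ (b n) (lam n ω)) π)
      (fun n => δ n ^ 2 + g n ^ 2 + s n ^ 2) := by
  obtain ⟨n₀, st₀⟩ := sq.stage.exists
  have hcl := st₀.cl_pos
  have hCg := st₀.Cg_pos
  have hC₂ := st₀.crit.C₂_pos
  have hCa := sq.Ca_nonneg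
  have hsq : ∀ (M D : ℝ) (n : ℕ), 0 ≤ D → 2 * c.C₂ ^ 2 * (D * (M * (δ n + g n + s n)) ^ 2 +
      (Ca * δ n) ^ 2) ≤ (2 * c.C₂ ^ 2 * (D * (3 * M ^ 2) + Ca ^ 2) + 1) *
        (δ n ^ 2 + g n ^ 2 + s n ^ 2) := by
    intro M D n hD
    have h1 : (δ n + g n + s n) ^ 2 ≤ 3 * (δ n ^ 2 + g n ^ 2 + s n ^ 2) := by
      nlinarith [sq_nonneg (δ n - g n), sq_nonneg (δ n - s n), sq_nonneg (g n - s n)]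
    have h2 : δ n ^ 2 ≤ δ n ^ 2 + g n ^ 2 + s n ^ 2 := by
      linarith [sq_nonneg (g n), sq_nonneg (s n)]
    have h3 : 0 ≤ δ n ^ 2 + g n ^ 2 + s n ^ 2 := by positivity
    rw [mul_pow, mul_pow]
    calc _ ≤ 2 * c.C₂ ^ 2 * (D * (M ^ 2 * (3 * (δ n ^ 2 + g n ^ 2 + s n ^ 2))) +
          Ca ^ 2 * (δ n ^ 2 + g n ^ 2 + s n ^ 2)) := by gcongr
      _ ≤ _ := by linarith
  refine ⟨fun ε hε => ?_, fun ε hε => ?_, fun ε hε => ?_⟩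
  · obtain ⟨A, M, hM, h⟩ := hclose ε hε
    have hM0 : (0 : ℝ) < M := by exact_mod_cast hM
    refine ⟨c.C₂ * (M + Ca / √c.cl), by positivity, ?_⟩
    filter_upwards [h, sq.stage] with n hn st
    refine (measure_mono (Set.inter_subset_inter_right _ fun ω hω hgood => ?_)).trans hn.2
    rw [Set.mem_ofPred_eq] at hω
    refine absurd hω (not_lt.2 ?_)
    have e : supErr 𝒳 (weightEst ρ (b n) (lam n ω)) π =
        supErr 𝒳 (weightEst ρ (b n) (lam n ω)) (fun x => deriv ρ (z x)) :=
      iSup_congr fun x => iSup_congr fun hx => by simp only [hπ x hx]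
    rw [e]
    refine (st.supErr_le hn.1 hgood.2).trans (ENNReal.ofReal_le_ofReal ?_)
    rw [mul_assoc c.C₂]
    refine mul_le_mul_of_nonneg_left ?_ hC₂.le
    have hζ := st.ζ_pos
    have h1 : √c.cl ≤ ζ n := Real.sqrt_le_iff.2 ⟨hζ.le, st.cl_le_sq⟩
    have hδ := sq.δ_nonneg n
    have hg := sq.g_nonneg n
    have hs := sq.s_nonneg n
    have h0 : 0 < √c.cl := Real.sqrt_pos.2 hcl
    -- The sup rate has no bare `δ`; it is absorbed through `ζ ≥ √cl`.
    have h2 : Ca * δ n ≤ Ca / √c.cl * (ζ n * (δ n + g n) + ζ n * s n) := by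
      calc Ca * δ n = Ca / √c.cl * (√c.cl * δ n) := by field_simp
        _ ≤ Ca / √c.cl * (ζ n * δ n) := by gcongr
        _ ≤ _ := by
            refine mul_le_mul_of_nonneg_left ?_ (by positivity)
            nlinarith [mul_nonneg hζ.le hg, mul_nonneg hζ.le hs]
    rw [add_mul]
    refine add_le_add (le_of_eq ?_) h2
    ring
  · obtain ⟨A, M, hM, h⟩ := hclose ε hε
    refine ⟨2 * c.C₂ ^ 2 * (c.Cg * (3 * M ^ 2) + Ca ^ 2) + 1, by positivity, ?_⟩
    filter_upwards [h, sq.stage] with n hn st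
    refine (measure_mono (Set.inter_subset_inter_right _ fun ω hω hgood => ?_)).trans hn.2
    rw [Set.mem_ofPred_eq] at hω
    refine absurd hω (not_lt.2 ?_)
    have e : l2Err PX (weightEst ρ (b n) (lam n ω)) π =
        l2Err PX (weightEst ρ (b n) (lam n ω)) (fun x => deriv ρ (z x)) :=
      lintegral_congr_ae (st.ae_mem.mono fun x hx => by simp only [hπ x hx])
    rw [e]
    exact (st.l2Err_le hn.1 hgood.2).trans (ENNReal.ofReal_le_ofReal (hsq M _ n hCg.le))
  · obtain ⟨A, M, hM, h⟩ := hclose ε hε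
    refine ⟨2 * c.C₂ ^ 2 * ((c.Cg + 1) * (3 * M ^ 2) + Ca ^ 2) + 1, by positivity, ?_⟩
    filter_upwards [h, sq.stage] with n hn st
    refine (measure_mono (Set.inter_subset_inter_right _ fun ω hω hgood => ?_)).trans hn.2
    rw [Set.mem_ofPred_eq] at hω
    refine absurd hω (not_lt.2 ?_)
    have e : empErr n (fun i => X i ω) (weightEst ρ (b n) (lam n ω)) π =
        empErr n (fun i => X i ω) (weightEst ρ (b n) (lam n ω)) (fun x => deriv ρ (z x)) := by
      unfold empErr
      simp only [hπ _ (hgood.1.mem _)]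
    rw [e]
    exact (st.empErr_le hn.1 hgood.1 hgood.2).trans
      (ENNReal.ofReal_le_ofReal (hsq M _ n (by positivity)))

/-- Local maximisers near the approximate index. -/
theorem exists_localMax_rates {D : Set ℝ} (hD : Set.Icc c.lo c.hi ⊆ D) {π : Vec r → ℝ}
    (hπ : ∀ x ∈ 𝒳, deriv ρ (z x) = π x) :
    ∃ lam : (n : ℕ) → Ω → Vec (K n),
      Tendsto (fun n => P {ω | ¬ (lam n ω ∈ feasible D (b n) n (fun i => X i ω) ∧
        IsLocalMax (objective ρ (b n) (w n) n (fun i => S i ω) (fun i => X i ω)) (lam n ω) ∧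
        ∀ x ∈ 𝒳, inner ℝ (lam n ω) (b n x) ∈ D)}) atTop (𝓝 0) ∧
      BigOInProb P (fun n ω => supErr 𝒳 (weightEst ρ (b n) (lam n ω)) π)
        (fun n => ζ n * (δ n + g n) + ζ n * s n) ∧
      BigOInProb P (fun n ω => l2Err PX (weightEst ρ (b n) (lam n ω)) π)
        (fun n => δ n ^ 2 + g n ^ 2 + s n ^ 2) ∧
      BigOInProb P (fun n ω => empErr n (fun i => X i ω) (weightEst ρ (b n) (lam n ω)) π)
        (fun n => δ n ^ 2 + g n ^ 2 + s n ^ 2) := by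
  classical
  set good : (n : ℕ) → Ω → Vec (K n) → Prop := fun n ω l =>
    l ∈ feasible D (b n) n (fun i => X i ω) ∧
      IsLocalMax (objective ρ (b n) (w n) n (fun i => S i ω) (fun i => X i ω)) l ∧
      ∀ x ∈ 𝒳, inner ℝ l (b n x) ∈ D with hgood
  -- The estimator may not depend on the `ε` of the rates, nor on the multiplier `M` that goes with
  -- it. Taking a local maximiser for the least admissible natural `M` serves all larger multipliers
  -- at once.
  have hex : ∀ n ω, ∃ l : Vec (K n), ∀ M : ℕ,
      (∃ l', ‖l' - l₀ n‖ ≤ M * (δ n + g n + s n) ∧ good n ω l') →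
        ‖l - l₀ n‖ ≤ M * (δ n + g n + s n) ∧ good n ω l := by
    intro n ω
    by_cases h : ∃ M : ℕ, ∃ l', ‖l' - l₀ n‖ ≤ M * (δ n + g n + s n) ∧ good n ω l'
    · obtain ⟨l, hl1, hl2⟩ := Nat.find_spec h
      refine ⟨l, fun M hM => ⟨hl1.trans ?_, hl2⟩⟩
      have h1 : Nat.find h ≤ M := Nat.find_min' h hM
      have := sq.δ_nonneg n
      have := sq.g_nonneg n
      have := sq.s_nonneg n
      gcongr
    · exact ⟨0, fun M hM => absurd ⟨M, hM⟩ h⟩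
  choose lam hlam using hex
  have hloc : ∀ ε : ℝ, 0 < ε → ∃ A : ℝ, ∃ M : ℕ, 0 < M ∧ ∀ᶠ n in atTop,
      M * (δ n + g n + s n) * ζ n ≤ c.ε / 2 ∧
      P {ω | ¬ (GoodSample P X S PX 𝒳 ρ c n (b n) (w n) (q n) (l₀ n) (ζ n) (V n) A
        (M * (δ n + g n + s n)) ω ∧ ‖lam n ω - l₀ n‖ ≤ M * (δ n + g n + s n) ∧
          good n ω (lam n ω))} ≤ ENNReal.ofReal ε := by
    intro ε hε
    obtain ⟨A, M, hM, h⟩ := sq.exists_goodSample hε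
    refine ⟨A, M, hM, ?_⟩
    filter_upwards [h, sq.stage] with n hn st
    refine ⟨hn.2.1, (measure_mono fun ω hω hg => ?_).trans hn.2.2⟩
    exact hω ⟨hg.1, hlam n ω M (st.exists_isLocalMax hD hn.1 hn.2.1 hg.1.mem hg.2)⟩
  refine ⟨lam, ENNReal.tendsto_nhds_zero.2 fun ε hε => ?_, sq.rates_of_close hπ fun ε hε => ?_⟩
  -- Here `ε` is extended real and may be infinite; the minimum with `1` makes it a positive real.
  · obtain ⟨A, M, -, h⟩ := hloc (min ε 1).toReal
      (ENNReal.toReal_pos (by simp [hε.ne']) (by simp))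
    filter_upwards [h] with n hn
    rw [ENNReal.ofReal_toReal (by simp)] at hn
    refine (measure_mono fun ω hω => ?_).trans (hn.2.trans (min_le_left _ _))
    exact fun hg => hω hg.2.2
  · obtain ⟨A, M, hM, h⟩ := hloc ε hε
    refine ⟨A, M, hM, ?_⟩
    filter_upwards [h] with n hn
    refine ⟨hn.1, (measure_mono fun ω hω hg => hω.2 ?_).trans hn.2⟩
    exact ⟨hg.1, hg.2.1⟩

/-- Global maximisers of concave objective functions. -/
theorem globalMax_rates {D : Set ℝ} (hD : Set.Icc c.lo c.hi ⊆ D) {π : Vec r → ℝ}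
    (hπ : ∀ x ∈ 𝒳, deriv ρ (z x) = π x) (lam : (n : ℕ) → Ω → Vec (K n)) :
    let E : ℕ → Set Ω := fun n => {ω |
      ConcaveOn ℝ (feasible D (b n) n (fun i => X i ω))
        (objective ρ (b n) (w n) n (fun i => S i ω) (fun i => X i ω)) ∧
      lam n ω ∈ feasible D (b n) n (fun i => X i ω) ∧
      IsMaxOn (objective ρ (b n) (w n) n (fun i => S i ω) (fun i => X i ω))
        (feasible D (b n) n (fun i => X i ω)) (lam n ω)}
    BigOInProbOn P E (fun n ω => supErr 𝒳 (weightEst ρ (b n) (lam n ω)) π)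
      (fun n => ζ n * (δ n + g n) + ζ n * s n) ∧
    BigOInProbOn P E (fun n ω => l2Err PX (weightEst ρ (b n) (lam n ω)) π)
      (fun n => δ n ^ 2 + g n ^ 2 + s n ^ 2) ∧
    BigOInProbOn P E (fun n ω => empErr n (fun i => X i ω) (weightEst ρ (b n) (lam n ω)) π)
      (fun n => δ n ^ 2 + g n ^ 2 + s n ^ 2) := by
  intro E
  refine sq.rates_of_close hπ fun ε hε => ?_
  obtain ⟨A, M, hM, h⟩ := sq.exists_goodSample hε
  refine ⟨A, M, hM, ?_⟩
  filter_upwards [h, sq.stage] with n hn st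
  refine ⟨hn.2.1, (measure_mono fun ω hω hg => hω.2 ?_).trans hn.2.2⟩
  obtain ⟨hc, hl, hmax⟩ := hω.1
  exact ⟨hg.1, norm_sub_le_of_concaveOn hn.1 hc
    (fun i _ => hD (st.index_mem' (hg.1.mem i))) hl hmax hg.2⟩

end StageSequence

end DeconvWeights

end

noncomputable section

namespace DeconvWeights

/-! ### The local generalised empirical likelihood estimator -/

/-- Bounds of the second moments of a bounded basis, from bounds of the conditional second
moments. -/
theorem second_moment_bounds {r k : ℕ} {PX : Measure (Vec r)} [IsProbabilityMeasure PX]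
    {f : ℝ → Vec r → ℝ} {b : Vec r → Vec k} {t η B ζ c C : ℝ} {𝒳 : Set (Vec r)}
    (hmem : ∀ᵐ x ∂PX, x ∈ 𝒳) (hbm : Measurable b) (hb : ∀ x ∈ 𝒳, ‖b x‖ ≤ ζ)
    (hfm : Measurable (f t)) (hη : 0 < η) (hηf : ∀ᵐ x ∂PX, η ≤ f t x) (hfB : ∀ᵐ x ∂PX, f t x ≤ B)
    (hm : 0 < margDensity PX f t) (hspec : spectrum ℝ (condGram PX f b t) ⊆ Set.Icc c C) :
    (∀ d : Vec k, c * margDensity PX f t / B * ‖d‖ ^ 2 ≤ ∫ x, inner ℝ d (b x) ^ 2 ∂PX) ∧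
    (∀ d : Vec k, ∫ x, inner ℝ d (b x) ^ 2 ∂PX ≤ C * margDensity PX f t / η * ‖d‖ ^ 2) ∧
    ∫ x, ‖b x‖ ^ 2 ∂PX ≤ C * margDensity PX f t / η * k := by
  obtain ⟨x₀, hx₀, h1, h2⟩ := (hmem.and (hηf.and hfB)).exists
  have hB : 0 < B := hη.trans_le (h1.trans h2)
  have hζ : 0 ≤ ζ := (norm_nonneg _).trans (hb x₀ hx₀)
  have hfb : ∀ᵐ x ∂PX, ‖f t x‖ ≤ B := by
    filter_upwards [hηf, hfB] with x h1 h2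
    rwa [Real.norm_of_nonneg (hη.le.trans h1)]
  have hcomp : ∀ x ∈ 𝒳, ∀ j, |b x j| ≤ ζ := fun x hx j =>
    (PiLp.norm_apply_le (b x) j).trans (hb x hx)
  have hint : ∀ i j, Integrable (fun x => b x i * b x j * f t x) PX := fun i j => by
    refine Integrable.mul_bdd (c := B) ?_ hfm.aestronglyMeasurable hfb
    refine Integrable.of_bound (Measurable.aestronglyMeasurable (by fun_prop)) (ζ * ζ) ?_
    filter_upwards [hmem] with x hx
    rw [Real.norm_eq_abs, abs_mul]
    exact mul_le_mul (hcomp x hx _) (hcomp x hx _) (abs_nonneg _) hζ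
  have key : ∀ g : Vec r → ℝ, Integrable g PX → (∀ x, 0 ≤ g x) →
      η * ∫ x, g x ∂PX ≤ ∫ x, g x * f t x ∂PX ∧ ∫ x, g x * f t x ∂PX ≤ B * ∫ x, g x ∂PX := by
    intro g hg h0
    have hi := hg.mul_bdd hfm.aestronglyMeasurable hfb
    constructor
    · rw [← integral_const_mul]
      refine integral_mono_ae (hg.const_mul _) hi ?_
      filter_upwards [hηf] with x hx
      rw [mul_comm]
      exact mul_le_mul_of_nonneg_left hx (h0 x)
    · rw [← integral_const_mul]
      refine integral_mono_ae hi (hg.const_mul _) ?_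
      filter_upwards [hfB] with x hx
      rw [mul_comm B]
      exact mul_le_mul_of_nonneg_left hx (h0 x)
  have hsq : ∀ d : Vec k, Integrable (fun x => inner ℝ d (b x) ^ 2) PX := fun d => by
    refine Integrable.of_bound (Measurable.aestronglyMeasurable (by fun_prop)) ((‖d‖ * ζ) ^ 2) ?_
    filter_upwards [hmem] with x hx
    rw [Real.norm_eq_abs, abs_pow]
    refine pow_le_pow_left₀ (abs_nonneg _) ((abs_real_inner_le_norm _ _).trans ?_) 2
    exact mul_le_mul_of_nonneg_left (hb x hx) (norm_nonneg _)
  have hnsq : Integrable (fun x => ‖b x‖ ^ 2) PX := by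
    refine Integrable.of_bound (Measurable.aestronglyMeasurable (by fun_prop)) (ζ ^ 2) ?_
    filter_upwards [hmem] with x hx
    rw [norm_pow, norm_norm]
    exact pow_le_pow_left₀ (norm_nonneg _) (hb x hx) 2
  refine ⟨fun d => ?_, fun d => ?_, ?_⟩
  · have a1 := (condGram_bounds hspec hint hm d).1
    have a2 := (key _ (hsq d) fun x => sq_nonneg _).2
    rw [div_mul_eq_mul_div, div_le_iff₀ hB]
    linarith
  · have a1 := (condGram_bounds hspec hint hm d).2
    have a2 := (key _ (hsq d) fun x => sq_nonneg _).1
    rw [div_mul_eq_mul_div, le_div_iff₀ hη]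
    linarith
  · have a1 := (integral_norm_sq_bounds hspec hint hm).2
    have a2 := (key _ hnsq fun x => sq_nonneg _).1
    rw [div_mul_eq_mul_div, le_div_iff₀ hη]
    linarith

theorem aestronglyMeasurable_smoothDensity {r : ℕ} {PX : Measure (Vec r)}
    [IsProbabilityMeasure PX] {L : ℝ → ℝ} (hL : Integrable L) {f : ℝ → Vec r → ℝ}
    (hf : Measurable (fun p : Vec r × ℝ => f p.2 p.1)) (t h : ℝ) :
    AEStronglyMeasurable (smoothDensity L f t h) PX := by
  have h1 : Measurable fun p : Vec r × ℝ => f (t - h * p.2) p.1 :=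
    hf.comp (by fun_prop : Measurable fun p : Vec r × ℝ => (p.1, t - h * p.2))
  have h2 : AEStronglyMeasurable (fun p : Vec r × ℝ => L p.2 * f (t - h * p.2) p.1)
      (PX.prod volume) := (hL.1.comp_snd).mul h1.aestronglyMeasurable
  exact h2.integral_prod_right'

/-- The index is not assumed bounded. A single uniform approximation by a bounded basis bounds it,
which makes the infimum and supremum of its range meaningful. -/
theorem isBounded_image_of_approx {r k : ℕ} {𝒳 : Set (Vec r)} {z : Vec r → ℝ} {b : Vec r → Vec k}
    {l : Vec k} {ζ e : ℝ} (hb : ∀ x ∈ 𝒳, ‖b x‖ ≤ ζ)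
    (hz : ∀ x ∈ 𝒳, |z x - inner ℝ l (b x)| ≤ e) : Bornology.IsBounded (z '' 𝒳) := by
  refine isBounded_iff_forall_norm_le.2 ⟨e + ‖l‖ * ζ, ?_⟩
  rintro _ ⟨x, hx, rfl⟩
  have h1 : |inner ℝ l (b x)| ≤ ‖l‖ * ζ :=
    (abs_real_inner_le_norm _ _).trans (mul_le_mul_of_nonneg_left (hb x hx) (norm_nonneg _))
  have h2 : z x = (z x - inner ℝ l (b x)) + inner ℝ l (b x) := by ring
  rw [Real.norm_eq_abs, h2]
  exact (abs_add_le _ _).trans (add_le_add (hz x hx) h1)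

end DeconvWeights

end

/-! ### Verification of the hypotheses and conclusion -/

open DeconvWeights in
theorem theorem2
    -- the sample: independent copies of (treatment, covariates, measurement error)
    {Ω : Type*} [MeasurableSpace Ω] (P : Measure Ω) [IsProbabilityMeasure P] {r : ℕ}
    (T U : ℕ → Ω → ℝ) (X : ℕ → Ω → Vec r)
    (hT : ∀ i, Measurable (T i)) (hU : ∀ i, Measurable (U i)) (hX : ∀ i, Measurable (X i))
    (hindep : iIndepFun (fun i ω => (T i ω, X i ω, U i ω)) P)
    (hident : ∀ i, IdentDistrib (fun ω => (T i ω, X i ω, U i ω))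
      (fun ω => (T 0 ω, X 0 ω, U 0 ω)) P P)
    (herr : IndepFun (fun ω => (T 0 ω, X 0 ω)) (U 0) P)
    -- law and support of the covariates, support of the treatment, observed treatment,
    -- characteristic function of the error
    (PX : Measure (Vec r)) (hPX : PX = P.map (X 0))
    (𝒳 : Set (Vec r)) (h𝒳 : 𝒳 = PX.support)
    (𝒯 : Set ℝ) (h𝒯 : 𝒯 = (P.map (T 0)).support)
    (S : ℕ → Ω → ℝ) (hS : ∀ i ω, S i ω = T i ω + U i ω)
    (φU : ℝ → ℂ) (hφU : φU = charFun (P.map (U 0)))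
    -- conditional density of the treatment given the covariates
    (f : ℝ → Vec r → ℝ) (hf_meas : Measurable (fun p : Vec r × ℝ => f p.2 p.1))
    (hf_nonneg : ∀ t x, 0 ≤ f t x)
    (hf : P.map (fun ω => (X 0 ω, T 0 ω)) =
      (PX.prod volume).withDensity (fun p => ENNReal.ofReal (f p.2 p.1)))
    -- ordinary smooth error
    (β : ℝ) (hφU_ne : ∀ w, φU w ≠ 0) (hU_smooth : OrdinarySmooth β φU)
    -- kernel
    (L : ℝ → ℝ) (hL_even : ∀ v, L (-v) = L v) (hL_int : Integrable L) (hL_one : ∫ v, L v = 1)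
    (hL_mom : Integrable (fun v : ℝ => v ^ 2 * L v)) (hL_ord : KernelOrdinary β L)
    -- compact supports and strict positivity
    (h𝒳_comp : IsCompact 𝒳) (h𝒯_comp : IsCompact 𝒯)
    (η : ℝ) (hη : 0 < η) (hpos : ∀ t ∈ 𝒯, ∀ x ∈ 𝒳, η ≤ f t x)
    -- smoothness of the conditional density in the treatment
    (hf_smooth : ∃ B : ℝ, ∀ᵐ x ∂PX, ContDiffOn ℝ 3 (fun t => f t x) (interior 𝒯) ∧
      (∀ t ∈ 𝒯, f t x ≤ B) ∧
      ∀ d ∈ Finset.range 3, ∀ t ∈ interior 𝒯, |iteratedDeriv d (fun t => f t x) t| ≤ B)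
    -- criterion function
    (D : Set ℝ) (hD_open : IsOpen D) (hD_conv : Convex ℝ D)
    (ρ : ℝ → ℝ) (hρ_smooth : ContDiffOn ℝ 2 ρ D) (hρ_conc : ∀ v ∈ D, deriv (deriv ρ) v < 0)
    (hρ_range : ∀ t ∈ 𝒯, ∀ x ∈ 𝒳, stabWeight PX f t x ∈ deriv ρ '' D)
    (hρ_inner : ∀ t ∈ 𝒯, closure ((fun x => linkInv ρ D (stabWeight PX f t x)) '' 𝒳) ⊆ D)
    -- sieve basis: approximation error, conditional second moments, size
    (u : (k : ℕ) → Vec r → Vec k) (hu_meas : ∀ k, Measurable (u k))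
    (α : ℝ) (hα : 0 < α)
    (h_approx : ∀ t ∈ 𝒯, ∃ l : (k : ℕ) → Vec k, ∃ C : ℝ, ∀ᶠ k : ℕ in atTop, ∀ x ∈ 𝒳,
      |linkInv ρ D (stabWeight PX f t x) - inner ℝ (l k) (u k x)| ≤ C * (k : ℝ) ^ (-α))
    (h_gram : ∀ t ∈ 𝒯, ∃ c C : ℝ, 0 < c ∧ ∀ k : ℕ,
      spectrum ℝ (condGram PX f (u k) t) ⊆ Set.Icc c C)
    (ζ : ℕ → ℝ) (hζ : ∀ k, ∀ x ∈ 𝒳, ‖u k x‖ ≤ ζ k)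
    -- smoothing parameters
    (K : ℕ → ℕ) (hK : Tendsto K atTop atTop)
    (h₀ : ℕ → ℝ) (hh₀_pos : ∀ N, 0 < h₀ N) (hh₀ : Tendsto h₀ atTop (𝓝 0))
    (h_bias : Tendsto (fun N => ζ (K N) * ((K N : ℝ) ^ (-α) + h₀ N ^ 2)) atTop (𝓝 0))
    (h_var : Tendsto (fun N : ℕ => ζ (K N) *
      √((K N : ℝ) / ((N : ℝ) * h₀ N ^ (1 + 2 * β)))) atTop (𝓝 0))
    -- the treatment level, the sample objective function, its domain, and the two rates
    (t : ℝ) (ht : t ∈ interior 𝒯)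
    (G : (N : ℕ) → Ω → Vec (K N) → ℝ)
    (hG : ∀ N ω, G N ω = objective ρ (u (K N)) (fun s => deconvKernel L φU (h₀ N) ((t - s) / h₀ N))
      N (fun i => S i ω) (fun i => X i ω))
    (F : (N : ℕ) → Ω → Set (Vec (K N)))
    (hF : ∀ N ω, F N ω = feasible D (u (K N)) N (fun i => X i ω))
    (a₁ a₂ : ℕ → ℝ)
    (ha₁ : ∀ N : ℕ, a₁ N = ζ (K N) * ((K N : ℝ) ^ (-α) + h₀ N ^ 2) +
      ζ (K N) * √((K N : ℝ) / ((N : ℝ) * h₀ N ^ (1 + 2 * β))))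
    (ha₂ : ∀ N : ℕ, a₂ N = ((K N : ℝ) ^ (-2 * α) + h₀ N ^ 4) +
      (K N : ℝ) / ((N : ℝ) * h₀ N ^ (1 + 2 * β))) :
    -- with probability tending to one there is a local maximiser that has the stated rates
    (∃ lam : (N : ℕ) → Ω → Vec (K N),
      Tendsto (fun N => P {ω | ¬ (lam N ω ∈ F N ω ∧ IsLocalMax (G N ω) (lam N ω) ∧
        ∀ x ∈ 𝒳, inner ℝ (lam N ω) (u (K N) x) ∈ D)}) atTop (𝓝 0) ∧
      BigOInProb P (fun N ω => supErr 𝒳 (weightEst ρ (u (K N)) (lam N ω))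
        (stabWeight PX f t)) a₁ ∧
      BigOInProb P (fun N ω => l2Err PX (weightEst ρ (u (K N)) (lam N ω))
        (stabWeight PX f t)) a₂ ∧
      BigOInProb P (fun N ω => empErr N (fun i => X i ω) (weightEst ρ (u (K N)) (lam N ω))
        (stabWeight PX f t)) a₂) ∧
    -- where the objective function is concave, every global maximiser has the stated rates
    (∀ lam : (N : ℕ) → Ω → Vec (K N), ∀ A : ℕ → Set Ω,
      (∀ N, A N = {ω | ConcaveOn ℝ (F N ω) (G N ω) ∧ lam N ω ∈ F N ω ∧
        IsMaxOn (G N ω) (F N ω) (lam N ω)}) →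
      BigOInProbOn P A (fun N ω => supErr 𝒳 (weightEst ρ (u (K N)) (lam N ω))
        (stabWeight PX f t)) a₁ ∧
      BigOInProbOn P A (fun N ω => l2Err PX (weightEst ρ (u (K N)) (lam N ω))
        (stabWeight PX f t)) a₂ ∧
      BigOInProbOn P A (fun N ω => empErr N (fun i => X i ω) (weightEst ρ (u (K N)) (lam N ω))
        (stabWeight PX f t)) a₂) := by
  subst hφU h𝒳 hPX
  obtain rfl : S = fun i ω => T i ω + U i ω := funext fun i => funext fun ω => hS i ω
  obtain rfl : F = _ := funext fun N => funext fun ω => hF N ω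
  have hPU : IsProbabilityMeasure (P.map (U 0)) :=
    Measure.isProbabilityMeasure_map (hU 0).aemeasurable
  set PX : Measure (Vec r) := P.map (X 0) with hPX
  have hPXp : IsProbabilityMeasure PX := Measure.isProbabilityMeasure_map (hX 0).aemeasurable
  have hmem : ∀ᵐ x ∂PX, x ∈ PX.support := Measure.support_mem_ae
  have ht𝒯 : t ∈ 𝒯 := interior_subset ht
  obtain ⟨B, hB⟩ := hf_smooth
  have hη_le : ∀ᵐ x ∂PX, η ≤ f t x := hmem.mono fun x hx => hpos t ht𝒯 x hx
  have hle_B : ∀ᵐ x ∂PX, f t x ≤ B := hB.mono fun x hx => hx.2.1 t ht𝒯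
  have hηB : η ≤ B := by
    obtain ⟨x, h1, h2⟩ := (hη_le.and hle_B).exists
    exact h1.trans h2
  have hB0 : 0 < B := hη.trans_le hηB
  have hft : ∀ s, Measurable (f s) := fun s =>
    hf_meas.comp (by fun_prop : Measurable fun x : Vec r => (x, s))
  have hftx : ∀ x, Measurable fun s => f s x := fun x =>
    hf_meas.comp (by fun_prop : Measurable fun s : ℝ => (x, s))
  -- The density is assumed bounded only on the support of the treatment. Off the support it
  -- vanishes almost everywhere, so the bound extends to almost every real `s`.
  have hB_ae : ∀ᵐ x ∂PX, ∀ᵐ s, |f s x| ≤ B := by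
    filter_upwards [ae_ae_density_eq_zero (hT 0) (hX 0) hf_meas hf_nonneg hf, hB] with x h1 h2
    filter_upwards [h1] with s hs
    rw [← h𝒯] at hs
    by_cases hs𝒯 : s ∈ 𝒯
    · rw [abs_of_nonneg (hf_nonneg s x)]
      exact h2.2.1 s hs𝒯
    · rw [hs hs𝒯, abs_zero]
      exact hB0.le
  have hfint : Integrable (f t) PX := by
    refine Integrable.of_bound (hft t).aestronglyMeasurable B ?_
    filter_upwards [hle_B] with x hx
    rwa [Real.norm_of_nonneg (hf_nonneg t x)]
  set m := margDensity PX f t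
  have hηm : η ≤ m := by
    have := integral_mono_ae (integrable_const η) hfint hη_le
    rw [integral_const, probReal_univ, one_smul] at this
    exact this
  have hm0 : 0 < m := hη.trans_le hηm
  set π := stabWeight PX f t with hπ
  set z : Vec r → ℝ := fun x => linkInv ρ D (π x)
  have hzπ : ∀ x ∈ PX.support, deriv ρ (z x) = π x := fun x hx =>
    Function.invFunOn_eq (hρ_range t ht𝒯 x hx)
  have hweight : ∀ x ∈ PX.support, deriv ρ (z x) * f t x = m := fun x hx => by
    rw [hzπ x hx, hπ, stabWeight, div_mul_cancel₀]
    exact (hη.trans_le (hpos t ht𝒯 x hx)).ne'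
  obtain ⟨l, Ca, hl⟩ := h_approx t ht𝒯
  have hl' : ∀ᶠ k : ℕ in atTop, ∀ x ∈ PX.support,
      |z x - inner ℝ (l k) (u k x)| ≤ |Ca| * (k : ℝ) ^ (-α) := by
    filter_upwards [hl] with k hk x hx
    refine (hk x hx).trans (mul_le_mul_of_nonneg_right (le_abs_self _) (by positivity))
  have hZb : Bornology.IsBounded (z '' PX.support) := by
    obtain ⟨k, hk⟩ := hl'.exists
    exact isBounded_image_of_approx (hζ k) hk
  have hZne : (z '' PX.support).Nonempty := by
    obtain ⟨x, hx⟩ := hmem.exists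
    exact ⟨z x, x, hx, rfl⟩
  obtain ⟨lo, hi, ε, hε, hIcc, hzIcc⟩ :=
    exists_Icc_subset_of_closure_subset hD_open hD_conv hZne hZb (hρ_inner t ht𝒯)
  obtain ⟨c₀, C₁, C₂, hcrit⟩ := exists_criterionBounds hD_open hρ_smooth hρ_conc hIcc
  obtain ⟨cg, Cg', hcg, hspec⟩ := h_gram t ht𝒯
  -- The given upper spectral bound is not known to be positive.
  set Cg := max Cg' 1
  have hCg0 : 0 < Cg := one_pos.trans_le (le_max_right _ _)
  have hspec' : ∀ k, spectrum ℝ (condGram PX f (u k) t) ⊆ Set.Icc cg Cg := fun k =>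
    (hspec k).trans (Set.Icc_subset_Icc_right (le_max_left _ _))
  have hgram := fun k => second_moment_bounds hmem (hu_meas k) (hζ k) (hft t) hη hη_le hle_B hm0
    (hspec' k)
  obtain ⟨d, hd, hball⟩ := Metric.isOpen_iff.1 isOpen_interior t ht
  obtain ⟨Ci, hCi, hinv⟩ := exists_inv_charFun_le hφU_ne hU_smooth
  have hβ : 0 ≤ β := zero_le_one.trans hU_smooth.1
  obtain ⟨V₀, hV₀, hV⟩ := exists_lintegral_deconvKernel_sq_le hL_int hL_ord hβ hφU_ne hinv
  -- The maximum with `1` ensures a variance factor of at least one for `h ≤ 1`, so averages without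
  -- kernel weights obey the same noise level.
  set Vc := max (B * V₀) 1
  have hVc0 : 0 < Vc := one_pos.trans_le (le_max_right _ _)
  set I := ∫ v, |v ^ 2 * L v|
  have hI0 : 0 ≤ I := integral_nonneg fun v => abs_nonneg _
  have hsplit : Measurable fun y : ℝ × Vec r × ℝ => (y.2.1, y.1 + y.2.2) := by fun_prop
  have hind : iIndepFun (fun i ω => (X i ω, T i ω + U i ω)) P :=
    hindep.comp (fun _ y => (y.2.1, y.1 + y.2.2)) fun _ => hsplit
  have hlaw : ∀ i, P.map (fun ω => (X i ω, T i ω + U i ω)) =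
      P.map (fun ω => (X 0 ω, T 0 ω + U 0 ω)) := fun i =>
    ((hident i).comp hsplit).map_eq
  have hsample := map_sample_eq (hT 0) (hU 0) (hX 0) herr hf
  set c : StageConstants := ⟨m, η, B, cg * m / B, Cg * m / η, lo, hi, ε, c₀, C₁, C₂⟩ with hc
  set δ : ℕ → ℝ := fun N => (K N : ℝ) ^ (-α) with hδ
  set g : ℕ → ℝ := fun N => h₀ N ^ 2 with hg
  set s : ℕ → ℝ := fun N => √((K N : ℝ) / ((N : ℝ) * h₀ N ^ (1 + 2 * β))) with hs
  have tδ : Tendsto δ atTop (𝓝 0) :=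
    (tendsto_rpow_neg_atTop hα).comp (tendsto_natCast_atTop_atTop.comp hK)
  have tg : Tendsto g atTop (𝓝 0) := by simpa using hh₀.pow 2
  have tδ' : Tendsto (fun N => |Ca| * δ N) atTop (𝓝 0) := by simpa using tδ.const_mul |Ca|
  have tg' : Tendsto (fun N => (B + 2 * B / d ^ 2 + B / d) * I * g N) atTop (𝓝 0) := by
    simpa using tg.const_mul ((B + 2 * B / d ^ 2 + B / d) * I)
  have sq : StageSequence P X (fun i ω => T i ω + U i ω) PX PX.support ρ (f t) z c K
      (fun N => u (K N)) (fun N => kernelWeight L (charFun (P.map (U 0))) t (h₀ N))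
      (fun N => smoothDensity L f t (h₀ N)) (fun N => l (K N)) (fun N => ζ (K N))
      (fun N => Vc * h₀ N ^ (-(1 + 2 * β))) δ g s |Ca| ((B + 2 * B / d ^ 2 + B / d) * I) √Vc := by
    refine ⟨?_, ?_, rfl, hft t, fun N => by positivity, fun N => by positivity,
      fun N => by positivity, by positivity, by positivity, by positivity, tg, h_bias, h_var⟩
    · filter_upwards [tδ'.eventually_le_const (half_pos hε), tg'.eventually_le_const (half_pos hη),
        hh₀.eventually_le_const one_pos, hK.eventually hl', hK.eventually_ge_atTop 1,
        eventually_ge_atTop 1] with N n1 n2 n3 n4 n5 n6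
      have hhp := hh₀_pos N
      have hcont := continuous_deconvKernel hL_int hL_ord hβ hφU_ne hinv hhp
      obtain ⟨M, hM⟩ := abs_deconvKernel_le (L := L) (μ := P.map (U 0)) (h₀ N)
      have hcl : 0 < cg * m / B := by positivity
      -- Only upper bounds by `ζ` are assumed; positivity follows from the lower bound of the second
      -- moments of the basis.
      have hζ0 : 0 < ζ (K N) := by
        obtain ⟨x, hx⟩ := hmem.exists
        have h1 : 0 ≤ ζ (K N) := (norm_nonneg _).trans (hζ (K N) x hx)
        have h2 := hcl.trans_le (le_sq_of_forall_mul_norm_sq_le hmem n5 (hζ (K N)) (hgram (K N)).1)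
        exact lt_of_le_of_ne h1 fun h => by simp [← h] at h2
      exact {
        X_meas := hX
        S_meas := fun i => (hT i).add (hU i)
        indep := hind
        law := hlaw
        map_X := rfl
        ae_mem := hmem
        η_pos := hη
        η_le_m := hηm
        η_le := hη_le
        le_B := hle_B
        weight_eq := hweight
        w_meas := by
          have : Continuous (kernelWeight L (charFun (P.map (U 0))) t (h₀ N)) := by
            unfold kernelWeight
            fun_prop
          exact this.measurable
        w_mean := fun g hgm hgi => integral_kernelWeight_mul (hT 0) (hU 0) (hX 0) rfl hf_meas
          hf_nonneg hsample hhp hcont hM (integral_deconvKernel hL_int hL_ord hβ hφU_ne hinv hhp)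
          t hgm hgi
        w_sq := fun g hgm => by
          refine (lintegral_kernelWeight_sq_le (hT 0) (hU 0) (hX 0) hf_meas hsample hB0.le hB_ae
            hhp hcont (hV _ hhp n3) t hgm).trans ?_
          refine mul_le_mul_left (ENNReal.ofReal_le_ofReal ?_) _
          have e : -(1 + 2 * β) = -1 + -(2 * β) := by ring
          rw [e, Real.rpow_add hhp, Real.rpow_neg_one]
          have : B * V₀ * ((h₀ N)⁻¹ * h₀ N ^ (-(2 * β))) ≤
              Vc * ((h₀ N)⁻¹ * h₀ N ^ (-(2 * β))) := by
            gcongr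
            exact le_max_left _ _
          linarith
        q_meas := aestronglyMeasurable_smoothDensity hL_int hf_meas t (h₀ N)
        q_bias := by
          filter_upwards [hB, hB_ae] with x h1 h2
          exact abs_smoothDensity_sub_le hL_even hL_int hL_one hL_mom (hftx x) hd hhp
            (h1.1.mono hball) (fun k hk y hy => h1.2.2 k hk y (hball hy)) h2
        bb_le := n2
        b_meas := hu_meas _
        b_bound := hζ _
        ζ_pos := hζ0
        cl_pos := hcl
        Cg_pos := by positivity
        quad_lower := (hgram _).1
        quad_upper := (hgram _).2.1
        norm_sq := (hgram _).2.2
        crit := hcrit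
        ε_pos := hε
        z_mem := fun x hx => hzIcc _ ⟨x, hx, rfl⟩
        approx := n4
        da_nonneg := by positivity
        da_le := n1
        one_le_n := n6
        one_le_k := n5
        one_le_V := by
          have h1 : 1 ≤ h₀ N ^ (-(1 + 2 * β)) :=
            Real.one_le_rpow_of_pos_of_le_one_of_nonpos hhp n3 (by linarith)
          exact one_le_mul_of_one_le_of_one_le (le_max_right _ _) h1 }
    · refine Eventually.of_forall fun N => ?_
      have hhp := hh₀_pos N
      rw [noise, hs, ← Real.sqrt_mul hVc0.le, Real.rpow_neg hhp.le]
      congr 1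
      field_simp
  -- The factor `h⁻¹` that turns the kernel into a density-scaled weight cancels between numerator
  -- and denominator.
  have hw : ∀ N ω, objective ρ (u (K N)) (kernelWeight L (charFun (P.map (U 0))) t (h₀ N)) N
      (fun i => T i ω + U i ω) (fun i => X i ω) = G N ω := fun N ω => by
    rw [hG]
    exact objective_const_mul_weight ρ (u (K N))
      (fun s => deconvKernel L (charFun (P.map (U 0))) (h₀ N) ((t - s) / h₀ N)) N _ _
      (inv_pos.2 (hh₀_pos N)).ne'
  have e₁ : a₁ = fun N => ζ (K N) * (δ N + g N) + ζ (K N) * s N := funext ha₁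
  have e₂ : a₂ = fun N => δ N ^ 2 + g N ^ 2 + s N ^ 2 := by
    ext N
    have hhp := hh₀_pos N
    rw [ha₂, hδ, hg, hs]
    simp only
    rw [Real.sq_sqrt (by positivity), ← pow_mul, ← Real.rpow_mul_natCast (by positivity)]
    congr 3
    push_cast
    ring
  rw [e₁, e₂]
  constructor
  · have := sq.exists_localMax_rates hIcc hzπ
    simp only [hw] at this
    exact this
  · intro lam A hA
    obtain rfl : A = _ := funext hA
    have := sq.globalMax_rates hIcc hzπ lam
    simp only [hw] at this
    exact this
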